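/- Let $d\in\{2,3\}$ and let $\Omega\subseteq\mathbb R^d$ be a bounded polygonal (if $d=2$) or polyhedral (if $d=3$) Lipschitz domain. Let $p\in[2,\infty)$, $p'=\frac{p}{p-1}$, $\delta\ge 0$ and $k\in\mathbb N_0$. Put $\varphi(t)=\int_0^t\varphi'(s)\,\mathrm ds$ with $\varphi'(s)=(\delta+s)^{p-2}s$, and for $a\ge 0$ put $\varphi_a(t)=\int_0^t\varphi'(a+s)\frac{s}{a+s}\,\mathrm ds$. Write $\psi^*(t)=\sup_{s\ge 0}(st-\psi(s))$, $\rho_{\psi,\Omega}(u)=\int_\Omega\psi(x,|u(x)|)\,\mathrm dx$, $\langle u\rangle_S=\frac1{|S|}\int_S u\,\mathrm dx$, and $\|u\|_{2,\sigma,\Omega}^2=\int_\Omega|u|^2\sigma\,\mathrm dx$. Let $A\in (L^p(\Omega))^{d\times d}$, let $\overline A$ be its extension by zero to $\mathbb R^d$, and suppose that $\mu_A:=(\delta+|\overline A|)^{p-2}$ (Frobenius norm) belongs to $A_2(\mathbb R^d)$, i.e. $\mu_A\in L^1_{\rm loc}(\mathbb R^d)$, $\mu_A>0$ a.e. and $[\mu_A]_{A_2(\mathbb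 R^d)}:=\sup_B\langle\mu_A\rangle_B\langle\mu_A^{-1}\rangle_B<\infty$ (supremum over all balls), and that $F(A):=(\delta+|A^{\rm sym}|)^{(p-2)/2}A^{\rm sym}\in (W^{1,2}(\Omega))^{d\times d}$, where $A^{\rm sym}=\frac12(A+A^\top)$. Let $\mathcal T_h$ be a conforming triangulation of $\Omega$ into closed $d$-simplices with maximal mesh-size $h=\max_{K\in\mathcal T_h}\operatorname{diam}K\le 1$ and chunkiness (the ratio of the diameter to the inradius) of every simplex at most $\omega_0$. Let $Q_h^k$ be the space of functions on $\Omega$ that are a polynomial of degree at most $k$ on each $K\in\mathcal T_h$, and put $L_0^{p'}(\Omega)=\{z\in L^{p'}(\Omega):\langle z\rangle_\Omega=0\}$. Then, for every $C$, there is a constant $c>0$, depending only on $p$, $k$, $\Omega$, $\omega_0$, $C$ and (an upper bound for) $[\mu_A]_{A_2(\mathbb R^d)}$, such that the following holds for all $\delta$, $A$, $\mathcal T_h$ as above and all $z\in L^{p'}_0(\Omega)$ with a weak gradient $\nabla z\in (L^1_{\rm loc}(\Omega))^d$. (i) Let $\Pi_h^Q\colon L^{p'}(\Omega)\to Q_h^k$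 be a linear projection (so $\Pi_h^Qz_h=z_h$ for all $z_h\in Q_h^k$) that is locally $L^1$-stable with constant $C$, i.e. $\langle|\Pi_h^Qw|\rangle_K\le C\,\langle|w|\rangle_{\omega_K}$ for all $w\in L^{p'}(\Omega)$ and $K\in\mathcal T_h$, where $\omega_K=\bigcup\{K'\in\mathcal T_h: K'\cap K\ne\emptyset\}$. Then, for both choices of the sign, $$\rho_{(\varphi_{|A|})^*,\Omega}\big(z-\Pi_h^Qz\pm\langle\Pi_h^Qz\rangle_\Omega\big)\le\begin{cases}c\,h^{p'}\rho_{\varphi^*,\Omega}(\nabla z)&\text{if }z\in W^{1,p'}(\Omega),\\ c\,h^2\,\|\nabla z\|^2_{2,\mu_A^{-1},\Omega}&\text{if }\nabla z\in (L^2(\Omega;\mu_A^{-1}))^d.\end{cases}$$ (ii) Likewise, $$\inf_{z_h\in Q_h^k,\ \langle z_h\rangle_\Omega=0}\rho_{(\varphi_{|A|})^*,\Omega}(z-z_h)\le\begin{cases}c\,h^{p'}\rho_{\varphi^*,\Omega}(\nabla z)&\text{if }z\in W^{1,p'}(\Omega),\\ c\,h^2\,\|\nabla z\|^2_{2,\mu_A^{-1},\Omega}&\text{if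 }\nabla z\in (L^2(\Omega;\mu_A^{-1}))^d.\end{cases}$$ -/

import Mathlib

open MeasureTheory Set
open scoped ENNReal ContDiff

noncomputable section

namespace PressureApprox

/-- The ambient Euclidean space `ℝ^d`. -/
abbrev E (d : ℕ) : Type := EuclideanSpace ℝ (Fin d)

/-! ### Domains -/

/-- Every boundary point of `Ω` has a ball around it in which `Ω` is the open epigraph of a Lipschitz
function over a hyperplane. Here `n` is the direction of the vertical axis and `x - ⟪n, x⟫ n` is the
projection of `x` to the hyperplane orthogonal to `n`. -/
def HasLipschitzBoundary {d : ℕ} (Ω : Set (E d)) : Prop :=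
  ∀ x₀ ∈ frontier Ω, ∃ (n : E d) (r : ℝ) (L : NNReal) (g : E d → ℝ),
    ‖n‖ = 1 ∧ 0 < r ∧ LipschitzWith L g ∧
      ∀ x ∈ Metric.ball x₀ r, x ∈ Ω ↔ g (x - inner ℝ n x • n) < inner ℝ n x

/-- A bounded polygonal (`d = 2`) or polyhedral (`d = 3`) Lipschitz domain: bounded, open, connected
(in particular non-empty), with Lipschitz boundary that is contained in finitely many hyperplanes. -/
structure IsPolyhedralLipschitzDomain {d : ℕ} (Ω : Set (E d)) : Prop where
  isOpen : IsOpen Ω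
  isConnected : IsConnected Ω
  isBounded : Bornology.IsBounded Ω
  lipschitz : HasLipschitzBoundary Ω
  polyhedral : ∃ H : Finset (E d × ℝ), (∀ nb ∈ H, nb.1 ≠ 0) ∧
    frontier Ω ⊆ {x | ∃ nb ∈ H, inner ℝ nb.1 x = nb.2}

/-! ### Weak gradients and Sobolev functions -/

/-- `G` is the weak gradient of `u` in the open set `Ω`. -/
def HasWeakGrad {d : ℕ} (Ω : Set (E d)) (u : E d → ℝ) (G : E d → E d) : Prop :=
  LocallyIntegrableOn u Ω ∧ LocallyIntegrableOn G Ω ∧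
    ∀ η : E d → ℝ, ContDiff ℝ ∞ η → HasCompactSupport η → tsupport η ⊆ Ω → ∀ i : Fin d,
      ∫ x in Ω, u x * fderiv ℝ η x (EuclideanSpace.single i 1) = - ∫ x in Ω, G x i * η x

/-- `u ∈ W^{1,q}(Ω)`. -/
def MemW1 {d : ℕ} (Ω : Set (E d)) (q : ℝ≥0∞) (u : E d → ℝ) : Prop :=
  MemLp u q (volume.restrict Ω) ∧
    ∃ G : E d → E d, HasWeakGrad Ω u G ∧ MemLp G q (volume.restrict Ω)

/-! ### N-functions -/

/-- The Hölder conjugate exponent `p' = p / (p - 1)`. -/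
def dualExp (p : ℝ) : ℝ := p / (p - 1)

/-- `φ'(t) = (δ + t)^(p-2) t`. -/
def dphi (p δ t : ℝ) : ℝ := (δ + t) ^ (p - 2) * t

/-- The special N-function `φ(t) = ∫₀ᵗ φ'(s) ds`. -/
def phi (p δ t : ℝ) : ℝ := ∫ s in (0 : ℝ)..t, dphi p δ s

/-- The shifted N-function `φ_a(t) = ∫₀ᵗ φ'(a + s) s / (a + s) ds`. -/
def phiShift (p δ a t : ℝ) : ℝ := ∫ s in (0 : ℝ)..t, dphi p δ (a + s) * (s / (a + s))

/-- The convex conjugate `ψ*(t) = sup_{s ≥ 0} (s t - ψ(s))`, with values in `[0, ∞]`. Truncating the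
negative terms is harmless, because `s = 0` contributes `0` when `ψ 0 = 0`. -/
def conj (ψ : ℝ → ℝ) (t : ℝ) : ℝ≥0∞ := ⨆ (s : ℝ) (_ : 0 ≤ s), ENNReal.ofReal (s * t - ψ s)

/-- The modular `ρ_{ψ,Ω}(u) = ∫_Ω ψ(x, |u(x)|) dx`. -/
def modular {d : ℕ} {F : Type*} [Norm F] (Ω : Set (E d)) (ψ : E d → ℝ → ℝ≥0∞) (u : E d → F) :
    ℝ≥0∞ :=
  ∫⁻ x in Ω, ψ x ‖u x‖

/-! ### Tensor fields -/

/-- The Frobenius norm of a tensor. -/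
def frob {d : ℕ} (B : Matrix (Fin d) (Fin d) ℝ) : ℝ := Real.sqrt (∑ i, ∑ j, B i j ^ 2)

/-- The symmetric part of a tensor. -/
def symPart {d : ℕ} (B : Matrix (Fin d) (Fin d) ℝ) : Matrix (Fin d) (Fin d) ℝ :=
  (1 / 2 : ℝ) • (B + B.transpose)

/-- `F(B) = (δ + |B^sym|)^((p-2)/2) B^sym`. -/
def tensorF {d : ℕ} (p δ : ℝ) (B : Matrix (Fin d) (Fin d) ℝ) : Matrix (Fin d) (Fin d) ℝ :=
  (δ + frob (symPart B)) ^ ((p - 2) / 2) • symPart B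

/-- The weight `μ_A = (δ + |Ā|)^(p-2)` on `ℝ^d`, where `Ā` is `A` in `Ω` and zero elsewhere. -/
def muWeight {d : ℕ} (Ω : Set (E d)) (p δ : ℝ) (A : E d → Matrix (Fin d) (Fin d) ℝ) (x : E d) : ℝ :=
  (δ + frob (Ω.indicator A x)) ^ (p - 2)

/-- The generalized N-function `(x, t) ↦ (φ_{|A(x)|})*(t)`. -/
def conjShift {d : ℕ} (p δ : ℝ) (A : E d → Matrix (Fin d) (Fin d) ℝ) (x : E d) (t : ℝ) : ℝ≥0∞ :=
  conj (phiShift p δ (frob (A x))) t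

/-- The squared weighted norm `‖u‖²_{2,σ,Ω} = ∫_Ω |u|² σ dx`. -/
def weightedSq {d : ℕ} (Ω : Set (E d)) (σ : E d → ℝ) (u : E d → E d) : ℝ≥0∞ :=
  ∫⁻ x in Ω, ENNReal.ofReal (‖u x‖ ^ 2 * σ x)

/-! ### Muckenhoupt weights -/

/-- The constant `[σ]_{A_2} = sup_B ⟨σ⟩_B ⟨σ⁻¹⟩_B`, with the supremum over all balls. -/
def A2const {d : ℕ} (σ : E d → ℝ) : ℝ≥0∞ :=
  ⨆ (x : E d) (r : ℝ) (_ : 0 < r),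
    laverage (volume.restrict (Metric.ball x r)) (fun y => ENNReal.ofReal (σ y)) *
      laverage (volume.restrict (Metric.ball x r)) (fun y => ENNReal.ofReal ((σ y)⁻¹))

/-- `σ` is a weight (locally integrable and almost everywhere positive) in the class `A_2(ℝ^d)`. -/
structure IsA2Weight {d : ℕ} (σ : E d → ℝ) : Prop where
  locallyIntegrable : LocallyIntegrable σ
  pos : ∀ᵐ x, 0 < σ x
  finite : A2const σ < ⊤

/-! ### Triangulations and piecewise polynomials -/

/-- The closed simplex with vertex set `K`. -/
def cell {d : ℕ} (K : Finset (E d)) : Set (E d) := convexHull ℝ (K : Set (E d))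

/-- A conforming triangulation of `Ω` into finitely many closed `d`-dimensional simplices, each given
by its set of vertices: two simplices meet in the common face that their common vertices span. -/
structure IsTriangulation {d : ℕ} (Ω : Set (E d)) (T : Finset (Finset (E d))) : Prop where
  card : ∀ K ∈ T, K.card = d + 1
  indep : ∀ K ∈ T, AffineIndependent ℝ ((↑) : K → E d)
  conforming : ∀ K ∈ T, ∀ K' ∈ T,
    cell K ∩ cell K' = convexHull ℝ ((K : Set (E d)) ∩ (K' : Set (E d)))
  cover : ⋃ K ∈ T, cell K = closure Ω

/-- The maximal mesh-size `h = max_K diam K`. -/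
def meshSize {d : ℕ} (T : Finset (Finset (E d))) : ℝ :=
  sSup ((fun K => Metric.diam (cell K)) '' (T : Set (Finset (E d))))

/-- The supremum of the radii of the balls contained in `S`. -/
def inradius {d : ℕ} (S : Set (E d)) : ℝ :=
  sSup {r : ℝ | 0 ≤ r ∧ ∃ x, Metric.ball x r ⊆ S}

/-- The chunkiness of a simplex. -/
def chunkiness {d : ℕ} (K : Finset (E d)) : ℝ := Metric.diam (cell K) / inradius (cell K)

/-- The patch `ω_K`: the union of all simplices that meet `K`. -/
def patch {d : ℕ} (T : Finset (Finset (E d))) (K : Finset (E d)) : Set (E d) :=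
  ⋃ K' ∈ {K' ∈ (T : Set (Finset (E d))) | (cell K' ∩ cell K).Nonempty}, cell K'

/-- The space `Q_h^k` of functions that are a polynomial of degree at most `k` on each simplex, as a
subspace of `L^q(Ω)`. (Such functions are bounded, so that for bounded `Ω` the choice of `q` does not
matter.) -/
def Qhk {d : ℕ} (Ω : Set (E d)) (T : Finset (Finset (E d))) (k : ℕ) (q : ℝ≥0∞) :
    Submodule ℝ (Lp ℝ q (volume.restrict Ω)) where
  carrier := {z | ∀ K ∈ T, ∃ P : MvPolynomial (Fin d) ℝ, P.totalDegree ≤ k ∧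
    ∀ᵐ x ∂(volume.restrict Ω), x ∈ cell K → z x = MvPolynomial.eval (fun i => x i) P}
  zero_mem' := by
    intro K _
    refine ⟨0, by simp, ?_⟩
    filter_upwards [Lp.coeFn_zero ℝ q (volume.restrict Ω)] with x hx _
    rw [hx]; simp
  add_mem' := by
    intro u v hu hv K hK
    obtain ⟨P, hP, hPu⟩ := hu K hK
    obtain ⟨R, hR, hRv⟩ := hv K hK
    refine ⟨P + R, (MvPolynomial.totalDegree_add P R).trans (max_le hP hR), ?_⟩
    filter_upwards [Lp.coeFn_add u v, hPu, hRv] with x hx h1 h2 hxK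
    rw [hx]; simp [h1 hxK, h2 hxK]
  smul_mem' := by
    intro a u hu K hK
    obtain ⟨P, hP, hPu⟩ := hu K hK
    refine ⟨a • P, (MvPolynomial.totalDegree_smul_le a P).trans hP, ?_⟩
    filter_upwards [Lp.coeFn_smul a u, hPu] with x hx h1 hxK
    rw [hx]; simp [h1 hxK, MvPolynomial.smul_eval]

/-- Local `L¹`-stability with constant `C`: `⟨|P z|⟩_K ≤ C ⟨|z|⟩_{ω_K}` for all `z` and `K`. -/
def LocallyL1Stable {d : ℕ} (Ω : Set (E d)) (T : Finset (Finset (E d))) (q : ℝ≥0∞) (C : ℝ)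
    (P : Lp ℝ q (volume.restrict Ω) →ₗ[ℝ] Lp ℝ q (volume.restrict Ω)) : Prop :=
  ∀ z : Lp ℝ q (volume.restrict Ω), ∀ K ∈ T,
    ⨍ x in cell K, |P z x| ∂(volume.restrict Ω) ≤
      C * ⨍ x in patch T K, |z x| ∂(volume.restrict Ω)

end PressureApprox

end

namespace PressureApprox

/-! Since p ≥ 2, the shifted function φ_a(t) dominates both φ(t) and (δ+a)^(p-2) t²/2. Its conjugate
at t is therefore at most φ*(t) and at most t²/(δ+a)^(p-2) (`conj_phiShift_le_conj_phi`,
`conj_phiShift_le_sq`). What remains is a first-order approximation estimate in two modulars: g = φ*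
with Lebesgue measure, and g(t) = t² with the measure μ_A⁻¹ dx. They share two features: g(2t) ≤ 4
g(t), and taking means over balls is bounded in the modular. The second holds by Jensen with
constant 1 in the first case (`averagingPair_conjExt_phi`), and by Cauchy-Schwarz with the A_2
constant in the second (`averagingPair_sq`). `AveragingPair` records these features, and the
estimate is proved once for all such pairs, with constants that depend on the pair only through its
averaging constant.

Poincaré's inequality is obtained without a maximal function. If x sees a ball B of Ω, integrating
∇z along segments bounds ∫_B |z(x) - z(y)| dy by the means of |∇z| over the balls B(x, tD), averaged
over t ∈ (0,1] (`ae_lintegral_sub_le`). For a fixed radius these means are bounded in the modular by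
Fubini in the centre, uniformly in the radius; Jensen in t handles the scales
(`AveragingPair.lintegral_scaleAverage_le`). At small scales a Lipschitz domain offers one such ball
to all its points near a given point (`exists_visible_ball`), which gives `exists_local_poincare`.
Chaining in L¹ by connectedness and compactness leads to `exists_global_poincare`.

A projection onto piecewise polynomials fixes constants q. Local L¹-stability and an inverse
estimate for polynomials bound |Πz - q| pointwise on a simplex by the mean of |z - q| over its patch
(`exists_isProj_le`). Bounded overlap of the patches, the local Poincaré inequality at scale h and
integration over the centre of the ball give order h (`exists_approximation_le`). The mean
correction is harmless because ⟨Πz⟩ = -⟨z - Πz⟩, and the piecewise means of z already serve as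
competitors in (ii). Finally φ(ct) ≤ c^p φ(t) for c ≥ 1 turns a factor h ≤ 1 inside φ* into h^(p')
outside. -/

/-! ### Averaging over balls in a modular -/

/-- An increasing function `g` of quadratic growth and a measure `ν` such that averaging over balls is
bounded in the modular `f ↦ ∫ g(f) dν`, with constant `a`. -/
structure AveragingPair {d : ℕ} (a : ℝ≥0∞) (g : ℝ≥0∞ → ℝ≥0∞) (ν : Measure (E d)) : Prop where
  mono : Monotone g
  zero : g 0 = 0
  two_mul : ∀ t, g (2 * t) ≤ 4 * g t
  jensen : ∀ f : ℝ → ℝ≥0∞, Measurable f →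
    g (∫⁻ t in Ioc (0 : ℝ) 1, f t) ≤ ∫⁻ t in Ioc (0 : ℝ) 1, g (f t)
  average : ∀ (x : E d) (r : ℝ), 0 < r → ∀ f : E d → ℝ≥0∞, Measurable f →
    ν (Metric.ball x r) * g (⨍⁻ y in Metric.ball x r, f y ∂volume) ≤
      a * ∫⁻ y in Metric.ball x r, g (f y) ∂ν
  ac : ν ≪ volume
  sfinite : SFinite ν

theorem volume_ball_smul {d : ℕ} (x y : E d) {r s : ℝ} (hr : 0 < r) (hs : 0 < s) :
    volume (Metric.ball x (s * r)) = ENNReal.ofReal (s ^ d) * volume (Metric.ball y r) := by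
  rw [Measure.addHaar_ball_of_pos _ _ (mul_pos hs hr), Measure.addHaar_ball_of_pos _ _ hr,
    mul_pow, ENNReal.ofReal_mul (by positivity), mul_assoc]
  simp

theorem volume_ball_two_mul {d : ℕ} (x y : E d) {r : ℝ} (hr : 0 < r) :
    volume (Metric.ball x (2 * r)) = 2 ^ d * volume (Metric.ball y r) := by
  rw [volume_ball_smul x y hr two_pos, ENNReal.ofReal_pow (by norm_num)]
  simp

theorem measurable_indicator_ball {d : ℕ} (s : ℝ) {H : E d → ℝ≥0∞} (hH : Measurable H) :
    Measurable (fun q : E d × E d => (Metric.ball q.1 s).indicator H q.2) := by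
  have hS : MeasurableSet {q : E d × E d | dist q.2 q.1 < s} :=
    measurableSet_lt (by fun_prop) (by fun_prop)
  have := (hH.comp measurable_snd).indicator hS
  convert this using 1
  funext q
  by_cases h : dist q.2 q.1 < s <;> simp [Set.indicator, h]

theorem measurable_setLIntegral_ball {d : ℕ} (ν : Measure (E d)) [SFinite ν] (s : ℝ)
    {f : E d → ℝ≥0∞} (hf : Measurable f) :
    Measurable (fun x => ∫⁻ y in Metric.ball x s, f y ∂ν) := by
  have := (measurable_indicator_ball s hf).lintegral_prod_right' (ν := ν)
  convert this using 2 with x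
  symm
  exact lintegral_indicator Metric.isOpen_ball.measurableSet f

/-- Integrating the integrals over balls of radius `s` with respect to the centre. -/
theorem lintegral_setLIntegral_ball {d : ℕ} (ν : Measure (E d)) [SFinite ν] (s : ℝ)
    {H : E d → ℝ≥0∞} (hH : AEMeasurable H ν) :
    ∫⁻ x, ∫⁻ y in Metric.ball x s, H y ∂ν = volume (Metric.ball (0 : E d) s) * ∫⁻ y, H y ∂ν := by
  have e : ∀ x, ∫⁻ y in Metric.ball x s, H y ∂ν =
      ∫⁻ y, (Metric.ball x s).indicator (hH.mk H) y ∂ν := by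
    intro x
    rw [lintegral_indicator Metric.isOpen_ball.measurableSet]
    exact lintegral_congr_ae (ae_restrict_of_ae hH.ae_eq_mk)
  simp_rw [e]
  rw [lintegral_lintegral_swap (measurable_indicator_ball s hH.measurable_mk).aemeasurable,
    ← lintegral_const_mul _ hH.measurable_mk |>.trans
      (congrArg _ (lintegral_congr_ae hH.ae_eq_mk.symm))]
  refine lintegral_congr fun y => ?_
  have : (fun x => (Metric.ball x s).indicator (hH.mk H) y) =
      (Metric.ball y s).indicator (fun _ => hH.mk H y) := by
    funext x
    by_cases h : dist x y < s
    · simp [Set.indicator, h, dist_comm y x]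
    · simp [Set.indicator, h, dist_comm y x]
  rw [this, lintegral_indicator_const Metric.isOpen_ball.measurableSet,
    Measure.addHaar_ball_center, mul_comm]

namespace AveragingPair

variable {d : ℕ} {a : ℝ≥0∞} {g : ℝ≥0∞ → ℝ≥0∞} {ν : Measure (E d)}

theorem measurable (h : AveragingPair a g ν) : Measurable g := h.mono.measurable

theorem pow_two_mul (h : AveragingPair a g ν) (m : ℕ) (t : ℝ≥0∞) :
    g (2 ^ m * t) ≤ 4 ^ m * g t := by
  induction m with
  | zero => simp
  | succ m ih =>
    calc g (2 ^ (m + 1) * t) = g (2 * (2 ^ m * t)) := by ring_nf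
      _ ≤ 4 * g (2 ^ m * t) := h.two_mul _
      _ ≤ 4 * (4 ^ m * g t) := by gcongr
      _ = 4 ^ (m + 1) * g t := by ring

theorem add_le (h : AveragingPair a g ν) (s t : ℝ≥0∞) : g (s + t) ≤ 4 * g s + 4 * g t := by
  rcases le_total s t with hst | hst
  · refine le_trans ((h.mono ?_).trans (h.two_mul t)) le_add_self
    rw [_root_.two_mul]; gcongr
  · refine le_trans ((h.mono ?_).trans (h.two_mul s)) le_self_add
    rw [_root_.two_mul]; gcongr

/-- Averages over a subset that fills a fixed portion of a ball. -/
theorem average_subset (h : AveragingPair a g ν) {S : Set (E d)} (hS : MeasurableSet S) {x : E d}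
    {r : ℝ} (hr : 0 < r) (hSB : S ⊆ Metric.ball x r) {m : ℕ}
    (hm : volume (Metric.ball x r) ≤ 2 ^ m * volume S) {f : E d → ℝ≥0∞}
    (hf : AEMeasurable f (volume.restrict S)) :
    ν (Metric.ball x r) * g (⨍⁻ y in S, f y ∂volume) ≤ 4 ^ m * a * ∫⁻ y in S, g (f y) ∂ν := by
  set B := Metric.ball x r
  set f' : E d → ℝ≥0∞ := S.indicator (hf.mk f)
  have hf' : Measurable f' := hf.measurable_mk.indicator hS
  have hB0 : volume B ≠ 0 := (Metric.measure_ball_pos volume x hr).ne'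
  have hB1 : volume B ≠ ⊤ := measure_ball_lt_top.ne
  have h2 : (2 : ℝ≥0∞) ^ m ≠ ⊤ := by simp
  have hS0 : volume S ≠ 0 := by
    intro h0; rw [h0, mul_zero] at hm; exact hB0 (le_antisymm hm bot_le)
  have i1 : ∫⁻ y in S, f y = ∫⁻ y in B, f' y := by
    rw [lintegral_congr_ae hf.ae_eq_mk, setLIntegral_indicator hS,
      inter_eq_self_of_subset_left hSB]
  -- Extending by zero from S to the ball changes the mean by at most the volume ratio 2^m, which g
  -- turns into 4^m.
  have key : ⨍⁻ y in S, f y ∂volume ≤ 2 ^ m * ⨍⁻ y in B, f' y ∂volume := by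
    rw [setLAverage_eq, setLAverage_eq, i1, ENNReal.div_eq_inv_mul, ENNReal.div_eq_inv_mul,
      ← mul_assoc]
    gcongr
    rw [ENNReal.inv_le_iff_inv_le, ENNReal.mul_inv (Or.inl (by simp)) (Or.inl h2), inv_inv,
      mul_comm, ← ENNReal.div_eq_inv_mul.trans (mul_comm _ _)]
    exact ENNReal.div_le_of_le_mul' hm
  have i2 : ∫⁻ y in B, g (f' y) ∂ν = ∫⁻ y in S, g (f y) ∂ν := by
    have e : (fun y => g (f' y)) = S.indicator (fun y => g (hf.mk f y)) := by
      funext y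
      by_cases hy : y ∈ S <;> simp [f', hy, h.zero]
    rw [e, setLIntegral_indicator hS, inter_eq_self_of_subset_left hSB]
    refine lintegral_congr_ae ?_
    filter_upwards [(h.ac.restrict S).ae_le hf.ae_eq_mk] with y hy
    rw [hy]
  calc ν B * g (⨍⁻ y in S, f y ∂volume) ≤ ν B * (4 ^ m * g (⨍⁻ y in B, f' y ∂volume)) := by
        gcongr; exact (h.mono key).trans (h.pow_two_mul m _)
    _ = 4 ^ m * (ν B * g (⨍⁻ y in B, f' y ∂volume)) := by ring
    _ ≤ 4 ^ m * (a * ∫⁻ y in B, g (f' y) ∂ν) := mul_le_mul_right (h.average x r hr f' hf') _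
    _ = _ := by rw [i2, mul_assoc]

/-- The averages over balls of a fixed radius are bounded in the modular, uniformly in the radius. -/
theorem lintegral_average_le (h : AveragingPair a g ν) {s : ℝ} (hs : 0 < s) {f : E d → ℝ≥0∞}
    (hf : Measurable f) :
    ∫⁻ x, g (⨍⁻ y in Metric.ball x s, f y ∂volume) ∂ν ≤ 8 ^ d * a * ∫⁻ x, g (f x) ∂ν := by
  have := h.sfinite
  have hgm := h.measurable
  have hV0 : volume (Metric.ball (0 : E d) s) ≠ 0 := (Metric.measure_ball_pos volume 0 hs).ne'
  have hV1 : volume (Metric.ball (0 : E d) s) ≠ ⊤ := measure_ball_lt_top.ne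
  have hF : Measurable (fun x => g (⨍⁻ y in Metric.ball x s, f y ∂volume)) := by
    refine hgm.comp ?_
    simp_rw [setLAverage_eq, Measure.addHaar_ball_center]
    exact (measurable_setLIntegral_ball volume s hf).div_const _
  -- For x in B(x', s) the mean over B(x, s) is at most 2^d times the mean over B(x', 2s), which no
  -- longer depends on x, so the averaging inequality applies on B(x', 2s). Integrating over x'
  -- costs the volume ratio 2^d, and 4^d · 2^d = 8^d.
  have key : ∀ x', ∫⁻ x in Metric.ball x' s, g (⨍⁻ y in Metric.ball x s, f y ∂volume) ∂ν ≤
      4 ^ d * a * ∫⁻ x in Metric.ball x' (2 * s), g (f x) ∂ν := by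
    intro x'
    have b : ∀ x ∈ Metric.ball x' s, g (⨍⁻ y in Metric.ball x s, f y ∂volume) ≤
        4 ^ d * g (⨍⁻ y in Metric.ball x' (2 * s), f y ∂volume) := by
      intro x hx
      refine (h.mono ?_).trans (h.pow_two_mul d _)
      rw [setLAverage_eq, setLAverage_eq, volume_ball_two_mul x' x hs, ENNReal.div_eq_inv_mul,
        ENNReal.div_eq_inv_mul, ENNReal.mul_inv (Or.inl (by simp)) (Or.inl (by simp)), ← mul_assoc,
        ← mul_assoc, ENNReal.mul_inv_cancel (by simp) (by simp), one_mul]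
      gcongr
      refine Metric.ball_subset_ball' ?_
      have := Metric.mem_ball.1 hx
      linarith
    calc ∫⁻ x in Metric.ball x' s, g (⨍⁻ y in Metric.ball x s, f y ∂volume) ∂ν
        ≤ ∫⁻ x in Metric.ball x' s, 4 ^ d * g (⨍⁻ y in Metric.ball x' (2 * s), f y ∂volume) ∂ν :=
          setLIntegral_mono' Metric.isOpen_ball.measurableSet b
      _ = 4 ^ d * (ν (Metric.ball x' s) * g (⨍⁻ y in Metric.ball x' (2 * s), f y ∂volume)) := by
          rw [setLIntegral_const]; ring
      _ ≤ 4 ^ d * (ν (Metric.ball x' (2 * s)) * g (⨍⁻ y in Metric.ball x' (2 * s), f y ∂volume)) := by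
          gcongr; linarith
      _ ≤ 4 ^ d * (a * ∫⁻ x in Metric.ball x' (2 * s), g (f x) ∂ν) := 
          mul_le_mul_right (h.average x' _ (by linarith) f hf) _
      _ = _ := by ring
  have hgf : Measurable fun x => g (f x) := hgm.comp hf
  have tot := lintegral_mono (μ := volume) key
  rw [lintegral_setLIntegral_ball ν s hF.aemeasurable, lintegral_const_mul _
    (measurable_setLIntegral_ball ν _ hgf),
    lintegral_setLIntegral_ball ν (2 * s) hgf.aemeasurable,
    volume_ball_two_mul 0 0 hs] at tot
  rw [← ENNReal.mul_le_mul_iff_right hV0 hV1]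
  refine tot.trans (le_of_eq ?_)
  have : (8 : ℝ≥0∞) ^ d = 4 ^ d * 2 ^ d := by rw [← mul_pow]; norm_num
  rw [this]; ring

end AveragingPair

/-! ### Mollification and integration along segments -/

/-- The mollification of a function, extended by zero from `Ω`. -/
noncomputable def mollify {d : ℕ} (Ω : Set (E d)) (η : ContDiffBump (0 : E d)) (z : E d → ℝ) : E d → ℝ :=
  convolution (η.normed volume) (Ω.indicator z) (ContinuousLinearMap.lsmul ℝ ℝ) volume

theorem contDiff_mollify {d : ℕ} {Ω : Set (E d)} (hΩ : IsOpen Ω) (η : ContDiffBump (0 : E d))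
    {z : E d → ℝ} (hz : IntegrableOn z Ω) : ContDiff ℝ 1 (mollify Ω η z) :=
  η.hasCompactSupport_normed.contDiff_convolution_left (n := 1) _ η.contDiff_normed
    (hz.integrable_indicator hΩ.measurableSet).locallyIntegrable

/-- As the support ball around x lies in Ω, the reflected kernel `y ↦ η(x - y)` is an admissible
test function; its sign cancels the one in the definition of the weak gradient. -/
theorem fderiv_mollify_single {d : ℕ} {Ω : Set (E d)} (hΩ : IsOpen Ω) (η : ContDiffBump (0 : E d))
    {z : E d → ℝ} {G : E d → E d} (hz : IntegrableOn z Ω) (hG : HasWeakGrad Ω z G) {x : E d}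
    (hx : Metric.closedBall x η.rOut ⊆ Ω) (i : Fin d) :
    fderiv ℝ (mollify Ω η z) x (EuclideanSpace.single i 1) =
      ∫ y in Ω, G y i * η.normed volume (x - y) := by
  have hzi := (hz.integrable_indicator hΩ.measurableSet).locallyIntegrable
  have hk : ContDiff ℝ ∞ (η.normed (volume : Measure (E d))) := η.contDiff_normed
  have hk1 : ContDiff ℝ 1 (η.normed (volume : Measure (E d))) := η.contDiff_normed (n := 1)
  have h1 := (η.hasCompactSupport_normed.hasFDerivAt_convolution_left
    (ContinuousLinearMap.lsmul ℝ ℝ) hk1 hzi x).fderiv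
  change fderiv ℝ (convolution _ _ _ _) x _ = _
  have hex := ((η.hasCompactSupport_normed (μ := (volume : Measure (E d)))).fderiv
    (𝕜 := ℝ)).convolutionExists_left ((ContinuousLinearMap.lsmul ℝ ℝ).precompL (E d))
    (hk1.continuous_fderiv one_ne_zero) hzi x
  rw [h1, convolution_def, ContinuousLinearMap.integral_apply hex]
  simp only [ContinuousLinearMap.precompL_apply, ContinuousLinearMap.lsmul_apply, smul_eq_mul]
  rw [← integral_sub_left_eq_self _ _ x]
  simp only [sub_sub_cancel]
  set ψ : E d → ℝ := fun y => η.normed volume (x - y)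
  have hψ : ContDiff ℝ ∞ ψ := hk.comp (contDiff_const.sub contDiff_id)
  have hsupp : tsupport ψ ⊆ Metric.closedBall x η.rOut := by
    refine closure_minimal (fun y hy => ?_) Metric.isClosed_closedBall
    have : x - y ∈ Function.support (η.normed (volume : Measure (E d))) := hy
    rw [η.support_normed_eq, mem_ball_zero_iff] at this
    rw [Metric.mem_closedBall, dist_comm, dist_eq_norm]
    exact this.le
  have hcs : HasCompactSupport ψ := (isCompact_closedBall x η.rOut).of_isClosed_subset
    (isClosed_tsupport _) hsupp
  have hd : ∀ y, fderiv ℝ ψ y (EuclideanSpace.single i 1) =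
      - fderiv ℝ (η.normed volume) (x - y) (EuclideanSpace.single i 1) := by
    intro y
    have hb : HasFDerivAt (fun y : E d => x - y) (-ContinuousLinearMap.id ℝ (E d)) y :=
      (hasFDerivAt_id y).const_sub x
    have := ((hk1.differentiable one_ne_zero (x - y)).hasFDerivAt.comp y hb).fderiv
    change fderiv ℝ (η.normed volume ∘ fun y => x - y) y _ = _
    rw [this]; simp
  have := hG.2.2 ψ hψ hcs (hsupp.trans hx) i
  simp_rw [hd, mul_neg, integral_neg, neg_inj] at this
  rw [← this, ← integral_indicator hΩ.measurableSet]
  refine integral_congr_ae (Filter.Eventually.of_forall fun y => ?_)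
  by_cases hy : y ∈ Ω <;> simp [hy, mul_comm]

/-- Here `f` is an everywhere measurable representative of |∇z| extended by zero, so that the later
exchanges of integrals need no null sets. -/
theorem enorm_fderiv_mollify_le {d : ℕ} {Ω : Set (E d)} (hΩ : IsOpen Ω)
    (η : ContDiffBump (0 : E d)) {z : E d → ℝ} {G : E d → E d} (hz : IntegrableOn z Ω)
    (hGi : IntegrableOn G Ω) (hG : HasWeakGrad Ω z G)
    {f : E d → ℝ≥0∞} (hf : Measurable f) (hfG : (Ω.indicator fun y => ‖G y‖ₑ) =ᵐ[volume] f)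
    {x : E d} (hx : Metric.closedBall x η.rOut ⊆ Ω) (v : E d) :
    ‖fderiv ℝ (mollify Ω η z) x v‖ₑ ≤ ‖v‖ₑ * ∫⁻ w, ‖η.normed volume w‖ₑ * f (x - w) := by
  have hcb : ∃ Cb, ∀ y, ‖η.normed volume (x - y)‖ ≤ Cb := by
    obtain ⟨Cb, h⟩ := η.hasCompactSupport_normed.exists_bound_of_continuous
      (η.continuous_normed (μ := (volume : Measure (E d))))
    exact ⟨Cb, fun y => h _⟩
  obtain ⟨Cb, hCb⟩ := hcb
  have hcont : Continuous fun y => η.normed (volume : Measure (E d)) (x - y) :=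
    η.continuous_normed.comp (continuous_const.sub continuous_id)
  have hint : ∀ i : Fin d, Integrable (fun y => G y i * η.normed volume (x - y))
      (volume.restrict Ω) := by
    intro i
    have hGc : Integrable (fun y => G y i) (volume.restrict Ω) :=
      (EuclideanSpace.proj (𝕜 := ℝ) i).integrable_comp hGi
    exact hGc.mul_bdd hcont.aestronglyMeasurable (Filter.Eventually.of_forall hCb)
  have e : fderiv ℝ (mollify Ω η z) x v =
      ∫ y in Ω, inner ℝ (G y) v * η.normed volume (x - y) := by
    have hv : v = ∑ i, v i • EuclideanSpace.single i (1 : ℝ) := by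
      ext j; simp [Finset.sum_apply, Pi.single_apply]
    conv_lhs => rw [hv]
    simp_rw [map_sum, map_smul, fderiv_mollify_single hΩ η hz hG hx, smul_eq_mul]
    simp_rw [← integral_const_mul]
    rw [← integral_finsetSum _ fun i _ => (hint i).const_mul _]
    refine integral_congr_ae (Filter.Eventually.of_forall fun y => ?_)
    simp only [PiLp.inner_apply, Finset.sum_mul]
    refine Finset.sum_congr rfl fun i _ => ?_
    simp; ring
  rw [e]
  refine (enorm_integral_le_lintegral_enorm _).trans ?_
  calc ∫⁻ y in Ω, ‖inner ℝ (G y) v * η.normed volume (x - y)‖ₑ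
      ≤ ∫⁻ y in Ω, ‖v‖ₑ * (‖η.normed volume (x - y)‖ₑ * ‖G y‖ₑ) := by
        refine lintegral_mono fun y => ?_
        rw [enorm_mul]
        calc _ ≤ (‖G y‖ₑ * ‖v‖ₑ) * ‖η.normed volume (x - y)‖ₑ := by
              gcongr
              rw [← ofReal_norm, ← ofReal_norm (G y), ← ofReal_norm v,
                ← ENNReal.ofReal_mul (norm_nonneg _)]
              exact ENNReal.ofReal_le_ofReal (norm_inner_le_norm _ _)
          _ = _ := by ring
    _ = ∫⁻ y, ‖v‖ₑ * (‖η.normed volume (x - y)‖ₑ * f y) := by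
        rw [← lintegral_indicator hΩ.measurableSet]
        refine lintegral_congr_ae ?_
        filter_upwards [hfG] with y hy
        rw [← hy]
        by_cases h : y ∈ Ω <;> simp [h]
    _ = ‖v‖ₑ * ∫⁻ y, ‖η.normed volume (x - y)‖ₑ * f y :=
        lintegral_const_mul _ (by have := hcont.enorm.measurable; fun_prop)
    _ = _ := by
        rw [← lintegral_sub_left_eq_self _ x]
        simp

theorem enorm_mollify_sub_le {d : ℕ} {Ω : Set (E d)} (hΩ : IsOpen Ω)
    (η : ContDiffBump (0 : E d)) {z : E d → ℝ} {G : E d → E d} (hz : IntegrableOn z Ω)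
    (hGi : IntegrableOn G Ω) (hG : HasWeakGrad Ω z G)
    {f : E d → ℝ≥0∞} (hf : Measurable f) (hfG : (Ω.indicator fun y => ‖G y‖ₑ) =ᵐ[volume] f)
    {x y : E d} (hxy : ∀ t ∈ Ioc (0 : ℝ) 1, Metric.closedBall (x + t • (y - x)) η.rOut ⊆ Ω) :
    ‖mollify Ω η z x - mollify Ω η z y‖ₑ ≤ ‖y - x‖ₑ *
      ∫⁻ t in Ioc (0 : ℝ) 1, ∫⁻ w, ‖η.normed volume w‖ₑ * f (x + t • (y - x) - w) := by
  have hZ := contDiff_mollify hΩ η hz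
  have hder : ∀ t ∈ uIcc (0 : ℝ) 1, HasDerivAt (fun t : ℝ => mollify Ω η z (x + t • (y - x)))
      (fderiv ℝ (mollify Ω η z) (x + t • (y - x)) (y - x)) t := by
    intro t _
    have h1 : HasDerivAt (fun t : ℝ => x + t • (y - x)) (y - x) t := by
      simpa using ((hasDerivAt_id t).smul_const (y - x)).const_add x
    exact (hZ.differentiable one_ne_zero _).hasFDerivAt.comp_hasDerivAt t h1
  have hc : Continuous fun t : ℝ => fderiv ℝ (mollify Ω η z) (x + t • (y - x)) (y - x) := by
    have := hZ.continuous_fderiv one_ne_zero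
    fun_prop
  have := intervalIntegral.integral_eq_sub_of_hasDerivAt hder (hc.intervalIntegrable 0 1)
  simp only [zero_smul, add_zero, one_smul, add_sub_cancel] at this
  rw [enorm_sub_rev, ← this, intervalIntegral.integral_of_le zero_le_one]
  refine (enorm_integral_le_lintegral_enorm _).trans ?_
  have hm : Measurable fun t : ℝ => ∫⁻ w, ‖η.normed volume w‖ₑ * f (x + t • (y - x) - w) := by
    have hk := (η.continuous_normed (μ := (volume : Measure (E d)))).enorm.measurable
    have : Measurable fun q : ℝ × E d =>
        ‖η.normed volume q.2‖ₑ * f (x + q.1 • (y - x) - q.2) :=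
      (hk.comp measurable_snd).mul (hf.comp (by fun_prop))
    exact this.lintegral_prod_right'
  rw [← lintegral_const_mul _ hm]
  exact setLIntegral_mono' measurableSet_Ioc fun t ht =>
    enorm_fderiv_mollify_le hΩ η hz hGi hG hf hfG (hxy t ht) _

/-! ### Scale averages and difference quotients -/

/-- The mean over the scales `s ∈ (0, D]` of the averages over the balls of radius `s`. -/
noncomputable def scaleAverage {d : ℕ} (D : ℝ) (f : E d → ℝ≥0∞) (x : E d) : ℝ≥0∞ :=
  ∫⁻ t in Ioc (0 : ℝ) 1, ⨍⁻ y in Metric.ball x (t * D), f y ∂volume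

theorem measurable_setLAverage_ball {d : ℕ} (D : ℝ) {f : E d → ℝ≥0∞} (hf : Measurable f) :
    Measurable fun q : E d × ℝ => ⨍⁻ y in Metric.ball q.1 (q.2 * D), f y ∂volume := by
  have key : ∀ {h : E d → ℝ≥0∞}, Measurable h →
      Measurable fun q : E d × ℝ => ∫⁻ y in Metric.ball q.1 (q.2 * D), h y := by
    intro h hh
    have hS : MeasurableSet {q : (E d × ℝ) × E d | dist q.2 q.1.1 < q.1.2 * D} :=
      measurableSet_lt (by fun_prop) (by fun_prop)
    have := ((hh.comp measurable_snd).indicator hS).lintegral_prod_right' (ν := volume)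
    convert this using 2 with q
    rw [← lintegral_indicator Metric.isOpen_ball.measurableSet]
    refine lintegral_congr fun y => ?_
    by_cases hy : dist y q.1 < q.2 * D <;> simp [Set.indicator, hy]
  simp_rw [setLAverage_eq]
  refine (key hf).div ?_
  simpa using key (h := fun _ => 1) measurable_const

theorem measurable_scaleAverage {d : ℕ} (D : ℝ) {f : E d → ℝ≥0∞} (hf : Measurable f) :
    Measurable (scaleAverage D f) :=
  (measurable_setLAverage_ball D hf).lintegral_prod_right' (ν := volume.restrict (Ioc (0 : ℝ) 1))

theorem lintegral_setLAverage_ball {d : ℕ} {s : ℝ} (hs : 0 < s) {f : E d → ℝ≥0∞}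
    (hf : Measurable f) :
    ∫⁻ x, ⨍⁻ y in Metric.ball x s, f y ∂volume = ∫⁻ x, f x := by
  have hV0 : volume (Metric.ball (0 : E d) s) ≠ 0 := (Metric.measure_ball_pos volume 0 hs).ne'
  have hV1 : volume (Metric.ball (0 : E d) s) ≠ ⊤ := measure_ball_lt_top.ne
  simp_rw [setLAverage_eq, Measure.addHaar_ball_center, ENNReal.div_eq_inv_mul]
  rw [lintegral_const_mul _ (measurable_setLIntegral_ball volume s hf),
    lintegral_setLIntegral_ball volume s hf.aemeasurable, ← mul_assoc,
    ENNReal.inv_mul_cancel hV0 hV1, one_mul]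

/-- Used qualitatively: the scale average of an integrable function is integrable, so it is finite
almost everywhere and its mollifications converge almost everywhere. -/
theorem lintegral_scaleAverage {d : ℕ} {D : ℝ} (hD : 0 < D) {f : E d → ℝ≥0∞} (hf : Measurable f) :
    ∫⁻ x, scaleAverage D f x = ∫⁻ x, f x := by
  unfold scaleAverage
  rw [lintegral_lintegral_swap (measurable_setLAverage_ball D hf).aemeasurable]
  calc _ = ∫⁻ t in Ioc (0 : ℝ) 1, ∫⁻ x, f x :=
        setLIntegral_congr_fun measurableSet_Ioc fun t ht =>
          lintegral_setLAverage_ball (mul_pos ht.1 hD) hf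
    _ = _ := by simp

theorem lintegral_comp_homothety {d : ℕ} {t : ℝ} (ht : 0 < t) (c x : E d) {f : E d → ℝ≥0∞}
    (hf : Measurable f) :
    ∫⁻ y, f (c + t • (y - x)) = ENNReal.ofReal (t ^ d)⁻¹ * ∫⁻ y, f y := by
  rw [lintegral_sub_right_eq_self (fun y => f (c + t • y)) x]
  have := lintegral_map (μ := (volume : Measure (E d))) (f := fun y => f (c + y))
    (g := fun y => t • y) (by fun_prop) (by fun_prop)
  rw [← this, Measure.map_addHaar_smul _ ht.ne', lintegral_smul_measure,
    lintegral_add_left_eq_self f c, smul_eq_mul]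
  congr 2
  rw [abs_of_pos (by positivity)]; simp

/-- The homothety has Jacobian t^(-d), which is exactly what normalises the integral over the ball
of radius tD to a mean, up to |B_D|. Hence no singular kernel in t appears. -/
theorem lintegral_homothety_ball_le {d : ℕ} {t D : ℝ} (ht : 0 < t) (hD : 0 < D) (x w : E d)
    {f : E d → ℝ≥0∞} (hf : Measurable f) :
    ∫⁻ y in Metric.ball x D, f (x + t • (y - x) - w) ≤
      volume (Metric.ball (0 : E d) D) * ⨍⁻ y in Metric.ball (x - w) (t * D), f y ∂volume := by
  have hV0 : volume (Metric.ball (0 : E d) D) ≠ 0 := (Metric.measure_ball_pos volume 0 hD).ne'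
  have hV1 : volume (Metric.ball (0 : E d) D) ≠ ⊤ := measure_ball_lt_top.ne
  have hB : MeasurableSet (Metric.ball (x - w) (t * D)) := Metric.isOpen_ball.measurableSet
  calc ∫⁻ y in Metric.ball x D, f (x + t • (y - x) - w)
      ≤ ∫⁻ y, (Metric.ball (x - w) (t * D)).indicator f ((x - w) + t • (y - x)) := by
        rw [← lintegral_indicator Metric.isOpen_ball.measurableSet]
        refine lintegral_mono fun y => ?_
        by_cases hy : y ∈ Metric.ball x D
        · have : (x - w) + t • (y - x) ∈ Metric.ball (x - w) (t * D) := by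
            rw [mem_ball_iff_norm, add_sub_cancel_left, norm_smul, Real.norm_of_nonneg ht.le]
            exact mul_lt_mul_of_pos_left (mem_ball_iff_norm.1 hy) ht
          rw [indicator_of_mem hy, indicator_of_mem this]
          exact le_of_eq (congrArg f (by abel))
        · simp [hy]
    _ = ENNReal.ofReal (t ^ d)⁻¹ * ∫⁻ y in Metric.ball (x - w) (t * D), f y := by
        rw [lintegral_comp_homothety ht _ _ (hf.indicator hB), lintegral_indicator hB]
    _ = _ := by
        have htd : (0 : ℝ) < t ^ d := by positivity
        have h0 : ENNReal.ofReal (t ^ d) ≠ 0 := by simpa using htd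
        rw [setLAverage_eq, volume_ball_smul (x - w) 0 hD ht, ENNReal.div_eq_inv_mul,
          ENNReal.mul_inv (Or.inr hV1) (Or.inr hV0), ENNReal.ofReal_inv_of_pos htd]
        calc _ = (volume (Metric.ball (0 : E d) D) * (volume (Metric.ball (0 : E d) D))⁻¹) *
              ((ENNReal.ofReal (t ^ d))⁻¹ * ∫⁻ y in Metric.ball (x - w) (t * D), f y) := by
              rw [ENNReal.mul_inv_cancel hV0 hV1, one_mul]
          _ = _ := by ring

/-- Moving the integral over y innermost turns the segment estimate into a mollification of the
scale average. Both sides are then mollified quantities, with limits under a shrinking kernel. -/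
theorem lintegral_enorm_mollify_sub_le {d : ℕ} {Ω : Set (E d)} (hΩ : IsOpen Ω)
    (η : ContDiffBump (0 : E d)) {z : E d → ℝ} {G : E d → E d} (hz : IntegrableOn z Ω)
    (hGi : IntegrableOn G Ω) (hG : HasWeakGrad Ω z G)
    {f : E d → ℝ≥0∞} (hf : Measurable f) (hfG : (Ω.indicator fun y => ‖G y‖ₑ) =ᵐ[volume] f)
    {x y₀ : E d} {r D : ℝ} (hD : 0 < D) (hball : Metric.ball y₀ r ⊆ Metric.ball x D)
    (hxy : ∀ y ∈ Metric.ball y₀ r, ∀ t ∈ Ioc (0 : ℝ) 1,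
      Metric.closedBall (x + t • (y - x)) η.rOut ⊆ Ω) :
    ∫⁻ y in Metric.ball y₀ r, ‖mollify Ω η z x - mollify Ω η z y‖ₑ ≤
      ENNReal.ofReal D * volume (Metric.ball (0 : E d) D) *
        ∫⁻ w, ‖η.normed volume w‖ₑ * scaleAverage D f (x - w) := by
  have hk := (η.continuous_normed (μ := (volume : Measure (E d)))).enorm.measurable
  have hm3 : Measurable fun q : (E d × ℝ) × E d =>
      ‖η.normed volume q.2‖ₑ * f (x + q.1.2 • (q.1.1 - x) - q.2) :=
    (hk.comp measurable_snd).mul (hf.comp (by fun_prop))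
  have hm2 : Measurable fun q : E d × ℝ =>
      ∫⁻ w, ‖η.normed volume w‖ₑ * f (x + q.2 • (q.1 - x) - w) := hm3.lintegral_prod_right'
  have hm1 : Measurable fun y : E d => ∫⁻ t in Ioc (0 : ℝ) 1,
      ∫⁻ w, ‖η.normed volume w‖ₑ * f (x + t • (y - x) - w) := hm2.lintegral_prod_right'
  calc ∫⁻ y in Metric.ball y₀ r, ‖mollify Ω η z x - mollify Ω η z y‖ₑ
      ≤ ∫⁻ y in Metric.ball y₀ r, ENNReal.ofReal D * ∫⁻ t in Ioc (0 : ℝ) 1,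
          ∫⁻ w, ‖η.normed volume w‖ₑ * f (x + t • (y - x) - w) := by
        refine setLIntegral_mono' Metric.isOpen_ball.measurableSet fun y hy => ?_
        refine (enorm_mollify_sub_le hΩ η hz hGi hG hf hfG (hxy y hy)).trans ?_
        gcongr
        rw [← ofReal_norm]
        exact ENNReal.ofReal_le_ofReal (mem_ball_iff_norm.1 (hball hy)).le
    _ = ENNReal.ofReal D * ∫⁻ t in Ioc (0 : ℝ) 1, ∫⁻ w, ‖η.normed volume w‖ₑ *
          ∫⁻ y in Metric.ball y₀ r, f (x + t • (y - x) - w) := by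
        rw [lintegral_const_mul _ hm1, lintegral_lintegral_swap hm2.aemeasurable]
        congr 1
        refine lintegral_congr fun t => ?_
        rw [lintegral_lintegral_swap]
        · refine lintegral_congr fun w => ?_
          rw [lintegral_const_mul]
          exact hf.comp (by fun_prop)
        · exact (hm3.comp (f := fun q : E d × E d => ((q.1, t), q.2))
            (by fun_prop)).aemeasurable
    _ ≤ ENNReal.ofReal D * ∫⁻ t in Ioc (0 : ℝ) 1, ∫⁻ w, ‖η.normed volume w‖ₑ *
          (volume (Metric.ball (0 : E d) D) *
            ⨍⁻ y in Metric.ball (x - w) (t * D), f y ∂volume) := by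
        refine mul_le_mul_right (setLIntegral_mono' measurableSet_Ioc fun t ht => ?_) _
        refine lintegral_mono fun w => mul_le_mul_right ?_ _
        exact (lintegral_mono_set hball).trans (lintegral_homothety_ball_le ht.1 hD x w hf)
    _ = _ := by
        have hma : Measurable fun q : ℝ × E d =>
            ⨍⁻ y in Metric.ball (x - q.2) (q.1 * D), f y ∂volume :=
          (measurable_setLAverage_ball D hf).comp (f := fun q : ℝ × E d => (x - q.2, q.1))
            (by fun_prop)
        rw [lintegral_lintegral_swap
          ((hk.comp measurable_snd).mul (hma.const_mul _)).aemeasurable, mul_assoc]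
        congr 1
        have hms : Measurable fun w => ‖η.normed volume w‖ₑ * scaleAverage D f (x - w) :=
          hk.mul ((measurable_scaleAverage D hf).comp (measurable_const.sub measurable_id))
        rw [← lintegral_const_mul _ hms]
        refine lintegral_congr fun w => ?_
        have hmw : Measurable fun t : ℝ => ⨍⁻ y in Metric.ball (x - w) (t * D), f y ∂volume :=
          hma.comp (f := fun t : ℝ => (t, w)) (by fun_prop)
        rw [scaleAverage, lintegral_const_mul _ (hmw.const_mul _), lintegral_const_mul _ hmw]
        ring

theorem lintegral_normed_mul_eq_convolution {d : ℕ} (η : ContDiffBump (0 : E d))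
    {R : E d → ℝ≥0∞} (hR : Measurable R) (hRi : ∫⁻ x, R x ≠ ⊤) (x : E d) :
    ∫⁻ w, ‖η.normed volume w‖ₑ * R (x - w) = ENNReal.ofReal (convolution (η.normed volume)
      (fun y => (R y).toReal) (ContinuousLinearMap.lsmul ℝ ℝ) volume x) := by
  have hint : Integrable (fun y => (R y).toReal) volume :=
    integrable_toReal_of_lintegral_ne_top hR.aemeasurable hRi
  have hex := (η.hasCompactSupport_normed (μ := (volume : Measure (E d)))).convolutionExists_left
    (ContinuousLinearMap.lsmul ℝ ℝ) η.continuous_normed hint.locallyIntegrable x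
  have hfin : ∀ᵐ w, R (x - w) < ⊤ :=
    (quasiMeasurePreserving_sub_left volume x).ae (ae_lt_top hR hRi)
  rw [convolution_def, ofReal_integral_eq_lintegral_ofReal hex]
  · refine lintegral_congr_ae ?_
    filter_upwards [hfin] with w hw
    simp only [ContinuousLinearMap.lsmul_apply, smul_eq_mul]
    rw [ENNReal.ofReal_mul (η.nonneg_normed _), ENNReal.ofReal_toReal hw.ne,
      Real.enorm_of_nonneg (η.nonneg_normed _)]
  · exact Filter.Eventually.of_forall fun w =>
      mul_nonneg (η.nonneg_normed _) ENNReal.toReal_nonneg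

/-- The difference quotient estimate that underlies all Poincaré inequalities below. -/
theorem ae_lintegral_sub_le {d : ℕ} {Ω : Set (E d)} (hΩ : IsOpen Ω)
    {z : E d → ℝ} {G : E d → E d} (hz : IntegrableOn z Ω)
    (hGi : IntegrableOn G Ω) (hG : HasWeakGrad Ω z G)
    {f : E d → ℝ≥0∞} (hf : Measurable f) (hfG : (Ω.indicator fun y => ‖G y‖ₑ) =ᵐ[volume] f)
    (y₀ : E d) {r D : ℝ} (hr : 0 < r) (hD : 0 < D) :
    ∀ᵐ x, Metric.ball y₀ r ⊆ Metric.ball x D →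
      (∀ y ∈ Metric.closedBall y₀ r, segment ℝ x y ⊆ Ω) →
      ∫⁻ y in Metric.ball y₀ r, ‖z x - z y‖ₑ ≤
        ENNReal.ofReal D * volume (Metric.ball (0 : E d) D) * scaleAverage D f x := by
  -- The inner radius is half the outer one because the almost everywhere convergence of
  -- mollifications requires a bounded ratio of the two.
  let φ : ℕ → ContDiffBump (0 : E d) := fun n =>
    ⟨1 / (2 * ((n : ℝ) + 1)), 1 / ((n : ℝ) + 1), by positivity, by
      apply one_div_lt_one_div_of_lt <;> linarith [(Nat.cast_nonneg n : (0 : ℝ) ≤ n)]⟩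
  have hφ : Filter.Tendsto (fun n => (φ n).rOut) Filter.atTop (nhds 0) :=
    tendsto_one_div_add_atTop_nhds_zero_nat
  have hφK : ∀ᶠ n in Filter.atTop, (φ n).rOut ≤ 2 * (φ n).rIn :=
    Filter.Eventually.of_forall fun n => by
      change 1 / ((n : ℝ) + 1) ≤ 2 * (1 / (2 * ((n : ℝ) + 1)))
      apply le_of_eq; field_simp
  have hfi : ∫⁻ x, f x ≠ ⊤ := by
    rw [← lintegral_congr_ae hfG, lintegral_indicator hΩ.measurableSet]
    exact hGi.2.ne
  have hR := measurable_scaleAverage D hf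
  have hRi : ∫⁻ x, scaleAverage D f x ≠ ⊤ := by rwa [lintegral_scaleAverage hD hf]
  have hRint : Integrable (fun y => (scaleAverage D f y).toReal) volume :=
    integrable_toReal_of_lintegral_ne_top hR.aemeasurable hRi
  have lim1 := ContDiffBump.ae_convolution_tendsto_right_of_locallyIntegrable hφ hφK
    (hz.integrable_indicator hΩ.measurableSet).locallyIntegrable
  have lim2 := ContDiffBump.ae_convolution_tendsto_right_of_locallyIntegrable hφ hφK
    hRint.locallyIntegrable
  filter_upwards [lim1, lim2, ae_lt_top hR hRi] with x hx1 hx2 hx3 hball hseg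
  have hxΩ : x ∈ Ω := hseg y₀ (Metric.mem_closedBall_self hr.le) (left_mem_segment ℝ x y₀)
  have hsub : ∀ y ∈ Metric.ball y₀ r, y ∈ Ω := fun y hy =>
    hseg y (Metric.ball_subset_closedBall hy) (right_mem_segment ℝ x y)
  -- The union of the segments from x to the closed ball is compact in the open set Ω, so for large
  -- n the mollified estimate is valid along all of them at once.
  have hcomp : IsCompact ((fun q : ℝ × E d => x + q.1 • (q.2 - x)) ''
      (Icc (0 : ℝ) 1 ×ˢ Metric.closedBall y₀ r)) :=
    (isCompact_Icc.prod (isCompact_closedBall y₀ r)).image (by fun_prop)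
  obtain ⟨ε, hε, hεΩ⟩ := hcomp.exists_cthickening_subset_open hΩ (by
    rintro _ ⟨⟨t, y⟩, ⟨ht, hy⟩, rfl⟩
    refine hseg y hy ?_
    rw [segment_eq_image']
    exact ⟨t, ht, rfl⟩)
  have hsmall : ∀ᶠ n in Filter.atTop, (φ n).rOut < ε := hφ.eventually (gt_mem_nhds hε)
  have hle : ∀ᶠ n in Filter.atTop,
      ∫⁻ y in Metric.ball y₀ r, ‖mollify Ω (φ n) z x - mollify Ω (φ n) z y‖ₑ ≤
      ENNReal.ofReal D * volume (Metric.ball (0 : E d) D) *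
        ENNReal.ofReal (convolution ((φ n).normed volume)
          (fun y => (scaleAverage D f y).toReal) (ContinuousLinearMap.lsmul ℝ ℝ) volume x) := by
    filter_upwards [hsmall] with n hn
    rw [← lintegral_normed_mul_eq_convolution (φ n) hR hRi]
    refine lintegral_enorm_mollify_sub_le hΩ (φ n) hz hGi hG hf hfG hD hball fun y hy t ht => ?_
    refine (Metric.closedBall_subset_closedBall hn.le).trans
      ((Metric.closedBall_subset_cthickening ?_ ε).trans hεΩ)
    exact ⟨(t, y), ⟨⟨ht.1.le, ht.2⟩, Metric.ball_subset_closedBall hy⟩, rfl⟩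
  have hlim : Filter.Tendsto (fun n => ENNReal.ofReal D * volume (Metric.ball (0 : E d) D) *
        ENNReal.ofReal (convolution ((φ n).normed volume)
          (fun y => (scaleAverage D f y).toReal) (ContinuousLinearMap.lsmul ℝ ℝ) volume x))
      Filter.atTop (nhds (ENNReal.ofReal D * volume (Metric.ball (0 : E d) D) *
        scaleAverage D f x)) := by
    refine ENNReal.Tendsto.const_mul ?_
      (Or.inr (ENNReal.mul_ne_top ENNReal.ofReal_ne_top measure_ball_lt_top.ne))
    have := ENNReal.tendsto_ofReal hx2
    rwa [ENNReal.ofReal_toReal hx3.ne] at this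
  calc ∫⁻ y in Metric.ball y₀ r, ‖z x - z y‖ₑ
      = ∫⁻ y in Metric.ball y₀ r, Filter.liminf
          (fun n => ‖mollify Ω (φ n) z x - mollify Ω (φ n) z y‖ₑ) Filter.atTop := by
        refine lintegral_congr_ae ?_
        filter_upwards [ae_restrict_of_ae lim1,
          ae_restrict_mem Metric.isOpen_ball.measurableSet] with y hy hyB
        have : Filter.Tendsto (fun n => ‖mollify Ω (φ n) z x - mollify Ω (φ n) z y‖ₑ)
            Filter.atTop (nhds ‖Ω.indicator z x - Ω.indicator z y‖ₑ) :=
          (continuous_enorm.tendsto _).comp (hx1.sub hy)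
        rw [this.liminf_eq, indicator_of_mem hxΩ, indicator_of_mem (hsub y hyB)]
    _ ≤ Filter.liminf (fun n => ∫⁻ y in Metric.ball y₀ r,
          ‖mollify Ω (φ n) z x - mollify Ω (φ n) z y‖ₑ) Filter.atTop := by
        refine lintegral_liminf_le' fun n => ?_
        have := (contDiff_mollify hΩ (φ n) hz).continuous
        exact (by fun_prop : Continuous fun y =>
          ‖mollify Ω (φ n) z x - mollify Ω (φ n) z y‖ₑ).aemeasurable
    _ ≤ _ := (Filter.liminf_le_liminf hle).trans_eq hlim.liminf_eq

/-! ### Lipschitz charts and visible balls -/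

/-- Uniform size of the charts of a bounded Lipschitz domain. -/
theorem exists_uniform_charts {d : ℕ} {Ω : Set (E d)} (hb : Bornology.IsBounded Ω)
    (hL : HasLipschitzBoundary Ω) :
    ∃ (L : NNReal) (r : ℝ), 0 < r ∧ ∀ b ∈ frontier Ω, ∃ (n : E d) (g : E d → ℝ),
      ‖n‖ = 1 ∧ LipschitzWith L g ∧
        ∀ x ∈ Metric.ball b r, x ∈ Ω ↔ g (x - inner ℝ n x • n) < inner ℝ n x := by
  have hc : IsCompact (frontier Ω) := Metric.isCompact_of_isClosed_isBounded isClosed_frontier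
    (hb.closure.subset frontier_subset_closure)
  refine hc.induction_on (p := fun S => ∃ (L : NNReal) (r : ℝ), 0 < r ∧ ∀ b ∈ S,
      ∃ (n : E d) (g : E d → ℝ), ‖n‖ = 1 ∧ LipschitzWith L g ∧
        ∀ x ∈ Metric.ball b r, x ∈ Ω ↔ g (x - inner ℝ n x • n) < inner ℝ n x) ?_ ?_ ?_ ?_
  · exact ⟨0, 1, one_pos, by simp⟩
  · rintro S T hST ⟨L, r, hr, h⟩
    exact ⟨L, r, hr, fun b hb => h b (hST hb)⟩
  · rintro S T ⟨L, r, hr, h⟩ ⟨L', r', hr', h'⟩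
    refine ⟨max L L', min r r', lt_min hr hr', ?_⟩
    rintro b (hb | hb)
    · obtain ⟨n, g, hn, hg, hx⟩ := h b hb
      exact ⟨n, g, hn, hg.weaken (le_max_left _ _), fun x hxb =>
        hx x (Metric.ball_subset_ball (min_le_left _ _) hxb)⟩
    · obtain ⟨n, g, hn, hg, hx⟩ := h' b hb
      exact ⟨n, g, hn, hg.weaken (le_max_right _ _), fun x hxb =>
        hx x (Metric.ball_subset_ball (min_le_right _ _) hxb)⟩
  · intro b hb
    obtain ⟨n, r, L, g, hn, hr, hg, hx⟩ := hL b hb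
    refine ⟨Metric.ball b (r / 2), mem_nhdsWithin_of_mem_nhds
      (Metric.ball_mem_nhds b (by positivity)), L, r / 2, by positivity, fun b' hb' =>
      ⟨n, g, hn, hg, fun x hxb => hx x ?_⟩⟩
    have h1 := Metric.mem_ball.1 hb'
    have h2 := Metric.mem_ball.1 hxb
    have := dist_triangle x b' b
    rw [Metric.mem_ball]; linarith

/-- The climb outruns the lateral drift: after a fraction t of the segment the graph has risen by at
most 2Lrt, whereas the height has grown by at least (2L+3)rt - 2rt. -/
theorem segment_subset_of_chart {d : ℕ} {Ω : Set (E d)} {L : NNReal} {n : E d} {g : E d → ℝ}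
    (hn : ‖n‖ = 1) (hg : LipschitzWith L g) {B : Set (E d)} (hB : Convex ℝ B)
    (hch : ∀ x ∈ B, x ∈ Ω ↔ g (x - inner ℝ n x • n) < inner ℝ n x)
    {x y u : E d} {r : ℝ} (hx : x ∈ Ω) (hxB : x ∈ B) (hyB : y ∈ B) (hu : ‖u‖ ≤ 2 * r)
    (hy : y = x + u + ((2 * L + 3) * r) • n) : segment ℝ x y ⊆ Ω := by
  intro w hw
  have hwB := hB.segment_subset hxB hyB hw
  rw [segment_eq_image'] at hw
  obtain ⟨t, ⟨ht0, ht1⟩, rfl⟩ := hw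
  have hr : 0 ≤ r := by linarith [norm_nonneg u]
  have hx' := (hch x hxB).1 hx
  simp only at hwB ⊢
  rw [hch _ hwB]
  have hnn : inner ℝ n n = (1 : ℝ) := by rw [real_inner_self_eq_norm_sq, hn]; norm_num
  have hnu : |inner ℝ n u| ≤ 2 * r := by
    have := abs_real_inner_le_norm n u
    rw [hn, one_mul] at this; linarith
  set p : E d := x + t • (y - x)
  have hyx : y - x = u + ((2 * L + 3) * r) • n := by rw [hy]; abel
  have hip : inner ℝ n p = inner ℝ n x + t * (inner ℝ n u + (2 * L + 3) * r) := by
    simp only [p, hyx, inner_add_right, inner_smul_right, hnn]; ring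
  have hdiff : (p - inner ℝ n p • n) - (x - inner ℝ n x • n) =
      t • (u - (inner ℝ n u : ℝ) • n) := by
    rw [hip]; simp only [p, hyx]
    module
  have hproj : ‖u - (inner ℝ n u : ℝ) • n‖ ≤ ‖u‖ := by
    have : ‖u - (inner ℝ n u : ℝ) • n‖ ^ 2 ≤ ‖u‖ ^ 2 := by
      rw [norm_sub_sq_real, inner_smul_right, norm_smul, hn, real_inner_comm, mul_one,
        Real.norm_eq_abs, sq_abs]
      nlinarith [sq_nonneg (inner ℝ n u)]
    exact le_of_sq_le_sq this (norm_nonneg _)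
  have hgd : g (p - inner ℝ n p • n) ≤ g (x - inner ℝ n x • n) + L * (t * (2 * r)) := by
    have h1 := hg.dist_le_mul (p - inner ℝ n p • n) (x - inner ℝ n x • n)
    rw [Real.dist_eq, dist_eq_norm, hdiff, norm_smul, Real.norm_of_nonneg ht0] at h1
    have h2 : (L : ℝ) * (t * ‖u - (inner ℝ n u : ℝ) • n‖) ≤ L * (t * (2 * r)) := by
      gcongr; linarith
    linarith [le_abs_self (g (p - inner ℝ n p • n) - g (x - inner ℝ n x • n))]
  refine lt_of_le_of_lt hgd ?_
  rw [hip]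
  have : 0 ≤ t * (inner ℝ n u + 2 * r) := mul_nonneg ht0 (by linarith [neg_abs_le (inner ℝ n u : ℝ)])
  nlinarith [mul_nonneg ht0 hr]

theorem exists_mem_frontier {X : Type*} [TopologicalSpace X] {S T : Set X} (hS : IsPreconnected S)
    (h1 : (S ∩ T).Nonempty) (h2 : (S ∩ Tᶜ).Nonempty) : (S ∩ frontier T).Nonempty := by
  by_contra hcon
  have hno : ∀ x ∈ S, x ∉ frontier T := fun x hx hxf => hcon ⟨x, hx, hxf⟩
  obtain ⟨p, hpS, hpT⟩ := h1
  obtain ⟨q, hqS, hqT⟩ := h2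
  have hcl : ∀ x ∈ S, x ∈ closure T → x ∈ interior T := fun x hx hxc => by
    by_contra hxi; exact hno x hx ⟨hxc, hxi⟩
  obtain ⟨x, -, hx1, hx2⟩ := hS (interior T) (closure T)ᶜ isOpen_interior
    isClosed_closure.isOpen_compl (fun x hx => by
      by_cases hxc : x ∈ closure T
      · exact Or.inl (hcl x hx hxc)
      · exact Or.inr hxc)
    ⟨p, hpS, hcl p hpS (subset_closure hpT)⟩
    ⟨q, hqS, fun hqc => hqT (interior_subset (hcl q hqS hqc))⟩
  exact hx2 (subset_closure (interior_subset hx1))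

/-- At small scales, the points of a Lipschitz domain near a given point see a ball of comparable
size. -/
theorem exists_visible_ball {d : ℕ} {Ω : Set (E d)} (hb : Bornology.IsBounded Ω)
    (hL : HasLipschitzBoundary Ω) :
    ∃ Λ r₀ : ℝ, 0 < Λ ∧ 0 < r₀ ∧ ∀ (x₀ : E d) (r : ℝ), 0 < r → r ≤ r₀ →
      (Ω ∩ Metric.ball x₀ r).Nonempty → ∃ y₀, dist y₀ x₀ ≤ Λ * r ∧
        ∀ x ∈ Ω ∩ Metric.ball x₀ r, ∀ y ∈ Metric.closedBall y₀ r, segment ℝ x y ⊆ Ω := by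
  obtain ⟨L, r₁, hr₁, hch⟩ := exists_uniform_charts hb hL
  have hL0 : (0 : ℝ) ≤ L := L.2
  refine ⟨2 * L + 3, r₁ / (2 * L + 8), by positivity, by positivity, ?_⟩
  intro x₀ r hr hrr hne
  by_cases hcase : Metric.ball x₀ (2 * r) ⊆ Ω
  · refine ⟨x₀, by simp; positivity, fun x hx y hy => ?_⟩
    refine ((convex_ball x₀ (2 * r)).segment_subset ?_ ?_).trans hcase
    · exact Metric.ball_subset_ball (by linarith) hx.2
    · exact Metric.closedBall_subset_ball (by linarith) hy
  · obtain ⟨p, hp⟩ := hne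
    obtain ⟨q, hq, hqΩ⟩ := not_subset.1 hcase
    obtain ⟨b, hb, hbf⟩ := exists_mem_frontier (convex_ball x₀ (2 * r)).isPreconnected
      ⟨p, Metric.ball_subset_ball (by linarith) hp.2, hp.1⟩ ⟨q, hq, hqΩ⟩
    obtain ⟨n, g, hn, hg, hx⟩ := hch b hbf
    have hbd : dist b x₀ < 2 * r := hb
    have hr1 : (2 * L + 8) * r ≤ r₁ := by
      rw [le_div_iff₀ (by positivity)] at hrr; linarith
    refine ⟨x₀ + ((2 * L + 3) * r) • n, ?_, fun x hxx y hy => ?_⟩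
    · rw [dist_eq_norm, add_sub_cancel_left, norm_smul, hn, Real.norm_of_nonneg (by positivity),
        mul_one]
    · have hxd : dist x x₀ < r := hxx.2
      have hyd : ‖y - (x₀ + ((2 * L + 3) * r) • n)‖ ≤ r := by
        rw [← dist_eq_norm]; exact hy
      have hLr : 0 ≤ L * r := by positivity
      refine segment_subset_of_chart hn hg (convex_ball b r₁) hx hxx.1
        (u := (y - (x₀ + ((2 * L + 3) * r) • n)) + (x₀ - x)) (r := r) ?_ ?_ ?_ ?_
      · have := dist_triangle_right x b x₀
        rw [Metric.mem_ball]; nlinarith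
      · have h1 : dist y x₀ ≤ r + (2 * L + 3) * r := by
          rw [dist_eq_norm]
          calc ‖y - x₀‖ = ‖(y - (x₀ + ((2 * L + 3) * r) • n)) + ((2 * L + 3) * r) • n‖ := by
                congr 1; abel
            _ ≤ _ := (norm_add_le _ _).trans (by
                rw [norm_smul, hn, Real.norm_of_nonneg (by positivity : 0 ≤ (2 * L + 3) * r),
                  mul_one]; linarith)
        have := dist_triangle_right y b x₀
        rw [Metric.mem_ball]; nlinarith
      · have : ‖x₀ - x‖ < r := by rw [← dist_eq_norm, dist_comm]; exact hxd
        linarith [norm_add_le (y - (x₀ + ((2 * L + 3) * r) • n)) (x₀ - x)]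
      · abel

/-! ### Poincaré inequalities -/

/-- `z` and its weak gradient `G` are integrable in `Ω`. -/
structure IsSobolevPair {d : ℕ} (Ω : Set (E d)) (z : E d → ℝ) (G : E d → E d) : Prop where
  integrable : IntegrableOn z Ω
  grad_integrable : IntegrableOn G Ω
  weakGrad : HasWeakGrad Ω z G

theorem scaleAverage_const_mul {d : ℕ} (D : ℝ) {f : E d → ℝ≥0∞} (hf : Measurable f) (c : ℝ≥0∞)
    (x : E d) : scaleAverage D (fun y => c * f y) x = c * scaleAverage D f x := by
  have hm : Measurable fun t : ℝ => ⨍⁻ y in Metric.ball x (t * D), f y ∂volume :=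
    (measurable_setLAverage_ball D hf).comp (f := fun t : ℝ => (x, t)) (by fun_prop)
  unfold scaleAverage
  rw [← lintegral_const_mul _ hm]
  refine lintegral_congr fun t => ?_
  rw [setLAverage_eq, setLAverage_eq, lintegral_const_mul _ hf, mul_div_assoc]

/-- Jensen in the scale and Fubini reduce this to a fixed radius, where the bound is uniform. This
is the substitute for a maximal function theorem. -/
theorem AveragingPair.lintegral_scaleAverage_le {d : ℕ} {a : ℝ≥0∞} {g : ℝ≥0∞ → ℝ≥0∞}
    {ν : Measure (E d)} (h : AveragingPair a g ν) {D : ℝ} (hD : 0 < D) {f : E d → ℝ≥0∞}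
    (hf : Measurable f) :
    ∫⁻ x, g (scaleAverage D f x) ∂ν ≤ 8 ^ d * a * ∫⁻ x, g (f x) ∂ν := by
  have := h.sfinite
  have hm := measurable_setLAverage_ball D hf
  calc ∫⁻ x, g (scaleAverage D f x) ∂ν
      ≤ ∫⁻ x, (∫⁻ t in Ioc (0 : ℝ) 1, g (⨍⁻ y in Metric.ball x (t * D), f y ∂volume)) ∂ν :=
        lintegral_mono fun x => h.jensen _
          (hm.comp (f := fun t : ℝ => (x, t)) (by fun_prop))
    _ = ∫⁻ t in Ioc (0 : ℝ) 1, ∫⁻ x, g (⨍⁻ y in Metric.ball x (t * D), f y ∂volume) ∂ν :=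
        lintegral_lintegral_swap (h.measurable.comp hm).aemeasurable
    _ ≤ ∫⁻ t in Ioc (0 : ℝ) 1, 8 ^ d * a * ∫⁻ x, g (f x) ∂ν :=
        setLIntegral_mono' measurableSet_Ioc fun t ht =>
          h.lintegral_average_le (mul_pos ht.1 hD) hf
    _ = _ := by simp

theorem enorm_sub_setAverage_le {d : ℕ} {z : E d → ℝ} {B : Set (E d)}
    (hz : IntegrableOn z B) (h0 : volume B ≠ 0) (h1 : volume B ≠ ⊤) (s : ℝ) :
    ‖s - ⨍ y in B, z y ∂volume‖ₑ ≤ (volume B)⁻¹ * ∫⁻ y in B, ‖s - z y‖ₑ := by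
  have : Fact (volume B < ⊤) := ⟨h1.lt_top⟩
  have hr : volume.real B ≠ 0 := by
    rw [Measure.real, ENNReal.toReal_ne_zero]; exact ⟨h0, h1⟩
  have e : s - ⨍ y in B, z y ∂volume = (volume.real B)⁻¹ * ∫ y in B, (s - z y) := by
    rw [integral_sub (integrable_const s) hz, setAverage_eq]
    simp [mul_sub, hr]
  rw [e, enorm_mul]
  gcongr
  · rw [Real.enorm_of_nonneg (by positivity), ENNReal.ofReal_inv_of_pos (by positivity),
      ofReal_measureReal h1]
  · exact enorm_integral_le_lintegral_enorm _

theorem exists_le_two_pow (s : ℝ) : ∃ m : ℕ, ENNReal.ofReal s ≤ 2 ^ m := by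
  obtain ⟨m, hm⟩ := pow_unbounded_of_one_lt s one_lt_two
  refine ⟨m, (ENNReal.ofReal_le_ofReal hm.le).trans (le_of_eq ?_)⟩
  rw [ENNReal.ofReal_pow zero_le_two]; simp

theorem exists_le_two_pow' {c : ℝ≥0∞} (hc : c ≠ ⊤) : ∃ m : ℕ, c ≤ 2 ^ m := by
  obtain ⟨m, hm⟩ := exists_le_two_pow c.toReal
  exact ⟨m, by rwa [ENNReal.ofReal_toReal hc] at hm⟩

theorem scaleAverage_indicator_ball {d : ℕ} {D ρ r : ℝ} (hD : 0 ≤ D) (hρ : r + D ≤ ρ) {x₀ x : E d}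
    (hx : x ∈ Metric.ball x₀ r) (f : E d → ℝ≥0∞) :
    scaleAverage D ((Metric.ball x₀ ρ).indicator f) x = scaleAverage D f x := by
  refine setLIntegral_congr_fun measurableSet_Ioc fun t ht => ?_
  simp only [setLAverage_eq]
  congr 1
  refine setLIntegral_congr_fun Metric.isOpen_ball.measurableSet fun y hy => ?_
  refine indicator_of_mem ?_ f
  have h1 := Metric.mem_ball.1 hx
  have h2 := Metric.mem_ball.1 hy
  have := dist_triangle y x x₀
  have : t * D ≤ D := mul_le_of_le_one_left hD ht.2
  rw [Metric.mem_ball]; linarith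

/-- Poincaré's inequality at small scales. -/
theorem exists_local_poincare {d : ℕ} {Ω : Set (E d)} (hΩ : IsOpen Ω)
    (hb : Bornology.IsBounded Ω) (hL : HasLipschitzBoundary Ω) :
    ∃ (Λ r₀ : ℝ) (m : ℕ), 1 ≤ Λ ∧ 0 < r₀ ∧ ∀ {a : ℝ≥0∞} {g : ℝ≥0∞ → ℝ≥0∞} {ν : Measure (E d)},
      AveragingPair a g ν → ∀ {z : E d → ℝ} {G : E d → E d}, IsSobolevPair Ω z G →
      ∀ (x₀ : E d) (r : ℝ), 0 < r → r ≤ r₀ → ∃ q : ℝ,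
        volume (Metric.ball (0 : E d) r) * ‖q‖ₑ ≤ ∫⁻ x in Ω, ‖z x‖ₑ ∧
        ∫⁻ x in Ω ∩ Metric.ball x₀ r, g ‖z x - q‖ₑ ∂ν ≤
          2 ^ m * a * ∫⁻ x in Ω ∩ Metric.ball x₀ (Λ * r), g (ENNReal.ofReal r * ‖G x‖ₑ) ∂ν := by
  obtain ⟨Λ, r₀, hΛ, hr₀, hvis⟩ := exists_visible_ball hb hL
  obtain ⟨m₀, hm₀⟩ := exists_le_two_pow ((Λ + 2) ^ (d + 1))
  -- A point x of B(x₀, r) is within (Λ+1)r of the centre of the visible ball, so D = (Λ+2)r covers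
  -- that ball; the scale average at x then only looks into B(x₀, (Λ+3)r). The ratio D|B_D|/(r|B_r|)
  -- = (Λ+2)^(d+1) determines m₀, and 4^m₀ · 8^d is the resulting power of 2.
  refine ⟨Λ + 3, r₀, 2 * m₀ + 3 * d, by linarith, hr₀, ?_⟩
  intro a g ν h z G hzG x₀ r hr hrr
  by_cases hne : (Ω ∩ Metric.ball x₀ r).Nonempty
  swap
  · rw [not_nonempty_iff_eq_empty.1 hne]
    exact ⟨0, by simp⟩
  obtain ⟨y₀, hy₀, hseg⟩ := hvis x₀ r hr hrr hne
  set D := (Λ + 2) * r with hDdef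
  have hD : 0 < D := by positivity
  have hfm : AEMeasurable (Ω.indicator fun y => ‖G y‖ₑ) volume :=
    (aemeasurable_indicator_iff hΩ.measurableSet).2 hzG.grad_integrable.aestronglyMeasurable.enorm
  set f := hfm.mk _
  have hf : Measurable f := hfm.measurable_mk
  have hfG : (Ω.indicator fun y => ‖G y‖ₑ) =ᵐ[volume] f := hfm.ae_eq_mk
  set B := Metric.ball y₀ r
  have hB0 : volume B ≠ 0 := (Metric.measure_ball_pos volume y₀ hr).ne'
  have hB1 : volume B ≠ ⊤ := measure_ball_lt_top.ne
  have hBΩ : B ⊆ Ω := by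
    obtain ⟨p, hp⟩ := hne
    exact fun y hy => hseg p hp y (Metric.ball_subset_closedBall hy) (right_mem_segment ℝ p y)
  have hbm : MeasurableSet (Metric.ball x₀ ((Λ + 3) * r)) := Metric.isOpen_ball.measurableSet
  set F : E d → ℝ≥0∞ := fun y =>
    ENNReal.ofReal r * (Metric.ball x₀ ((Λ + 3) * r)).indicator f y
  have hF : Measurable F := (hf.indicator hbm).const_mul _
  refine ⟨⨍ y in B, z y ∂volume, ?_, ?_⟩
  · rw [← Measure.addHaar_ball_center volume y₀ r, setAverage_eq, smul_eq_mul, enorm_mul,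
      Real.enorm_of_nonneg (by positivity), Measure.real, ← ENNReal.toReal_inv,
      ENNReal.ofReal_toReal (by simpa using hB0), ← mul_assoc, ENNReal.mul_inv_cancel hB0 hB1,
      one_mul]
    exact (enorm_integral_le_lintegral_enorm _).trans (lintegral_mono_set hBΩ)
  have hpt : ∀ᵐ x, x ∈ Ω ∩ Metric.ball x₀ r →
      g ‖z x - ⨍ y in B, z y ∂volume‖ₑ ≤ 4 ^ m₀ * g (scaleAverage D F x) := by
    filter_upwards [ae_lintegral_sub_le hΩ hzG.integrable hzG.grad_integrable hzG.weakGrad hf hfG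
      y₀ hr hD] with x hx hxm
    refine (h.mono ?_).trans (h.pow_two_mul m₀ _)
    have hsub : B ⊆ Metric.ball x D := by
      refine Metric.ball_subset_ball' ?_
      have := dist_triangle_right y₀ x x₀
      have := Metric.mem_ball.1 hxm.2
      rw [hDdef]; linarith
    calc ‖z x - ⨍ y in B, z y ∂volume‖ₑ ≤ (volume B)⁻¹ * ∫⁻ y in B, ‖z x - z y‖ₑ :=
          enorm_sub_setAverage_le (hzG.integrable.mono_set hBΩ) hB0 hB1 _
      _ ≤ (volume B)⁻¹ * (ENNReal.ofReal D * volume (Metric.ball (0 : E d) D) *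
            scaleAverage D f x) := by
          gcongr; exact hx hsub (hseg x hxm)
      _ = ENNReal.ofReal ((Λ + 2) ^ (d + 1)) * scaleAverage D F x := by
          rw [scaleAverage_const_mul D (hf.indicator hbm),
            scaleAverage_indicator_ball hD.le (by rw [hDdef]; linarith) hxm.2, hDdef,
            volume_ball_smul 0 y₀ hr (by linarith), pow_succ,
            ENNReal.ofReal_mul (by linarith), ENNReal.ofReal_mul (by positivity)]
          calc _ = ((volume B)⁻¹ * volume B) * (ENNReal.ofReal ((Λ + 2) ^ d) *
                ENNReal.ofReal (Λ + 2) * (ENNReal.ofReal r * scaleAverage ((Λ + 2) * r) f x)) := by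
                ring
            _ = _ := by rw [ENNReal.inv_mul_cancel hB0 hB1, one_mul]
      _ ≤ 2 ^ m₀ * scaleAverage D F x := by gcongr
  have hOm : MeasurableSet (Ω ∩ Metric.ball x₀ r) :=
    hΩ.measurableSet.inter Metric.isOpen_ball.measurableSet
  calc ∫⁻ x in Ω ∩ Metric.ball x₀ r, g ‖z x - ⨍ y in B, z y ∂volume‖ₑ ∂ν
      ≤ ∫⁻ x in Ω ∩ Metric.ball x₀ r, 4 ^ m₀ * g (scaleAverage D F x) ∂ν :=
        lintegral_mono_ae ((ae_restrict_iff' hOm).2 (h.ac.ae_le hpt))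
    _ ≤ ∫⁻ x, 4 ^ m₀ * g (scaleAverage D F x) ∂ν := setLIntegral_le_lintegral _ _
    _ = 4 ^ m₀ * ∫⁻ x, g (scaleAverage D F x) ∂ν :=
        lintegral_const_mul _ (h.measurable.comp (measurable_scaleAverage D hF))
    _ ≤ 4 ^ m₀ * (8 ^ d * a * ∫⁻ x, g (F x) ∂ν) :=
        mul_le_mul_right (h.lintegral_scaleAverage_le hD hF) _
    _ = 2 ^ (2 * m₀ + 3 * d) * a * ∫⁻ x, g (F x) ∂ν := by
        have e1 : (4 : ℝ≥0∞) ^ m₀ = 2 ^ (2 * m₀) := by rw [pow_mul]; norm_num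
        have e2 : (8 : ℝ≥0∞) ^ d = 2 ^ (3 * d) := by rw [pow_mul]; norm_num
        rw [e1, e2, pow_add]; ring
    _ = _ := by
        congr 1
        rw [← lintegral_indicator (hΩ.measurableSet.inter hbm)]
        refine lintegral_congr_ae ?_
        filter_upwards [h.ac.ae_le hfG] with x hx
        simp only [F]
        by_cases h1 : x ∈ Metric.ball x₀ ((Λ + 3) * r)
        · rw [indicator_of_mem h1, ← hx]
          by_cases h2 : x ∈ Ω
          · rw [indicator_of_mem h2, indicator_of_mem (mem_inter h2 h1)]
          · rw [indicator_of_notMem h2, indicator_of_notMem (fun h3 => h2 h3.1), mul_zero, h.zero]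
        · rw [indicator_of_notMem h1, indicator_of_notMem (fun h3 => h1 h3.2), mul_zero, h.zero]

theorem averagingPair_id (d : ℕ) : AveragingPair 1 id (volume : Measure (E d)) where
  mono := monotone_id
  zero := rfl
  two_mul t := by
    simp only [id]; gcongr; norm_num
  jensen f _ := le_rfl
  average x r hr f _ := by
    have : Fact (volume (Metric.ball x r) < ⊤) := ⟨measure_ball_lt_top⟩
    rw [id, measure_mul_setLAverage f measure_ball_lt_top.ne, one_mul]; rfl
  ac := Measure.AbsolutelyContinuous.rfl
  sfinite := inferInstance

/-- Poincaré's inequality in `L¹` on a subset `U` of `Ω`. -/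
def HasL1Poincare {d : ℕ} (Ω U : Set (E d)) : Prop :=
  ∃ c : ℝ≥0∞, c ≠ ⊤ ∧ ∀ (z : E d → ℝ) (G : E d → E d), IsSobolevPair Ω z G →
    ∃ q : ℝ, ∫⁻ x in U, ‖z x - q‖ₑ ≤ c * ∫⁻ x in Ω, ‖G x‖ₑ

theorem HasL1Poincare.mono {d : ℕ} {Ω U V : Set (E d)} (h : HasL1Poincare Ω V) (hUV : U ⊆ V) :
    HasL1Poincare Ω U := by
  obtain ⟨c, hc, h⟩ := h
  refine ⟨c, hc, fun z G hzG => ?_⟩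
  obtain ⟨q, hq⟩ := h z G hzG
  exact ⟨q, (lintegral_mono_set hUV).trans hq⟩

/-- The two constants q₁ and q₂ are compared by integrating their difference over the overlap. The
gradient is always integrated over all of Ω, so nothing is lost in gluing. -/
theorem HasL1Poincare.union {d : ℕ} {Ω U V : Set (E d)} (hb : Bornology.IsBounded Ω)
    (hU : HasL1Poincare Ω U) (hV : HasL1Poincare Ω V) (hUΩ : U ⊆ Ω) (hVΩ : V ⊆ Ω)
    (h0 : volume (U ∩ V) ≠ 0) : HasL1Poincare Ω (U ∪ V) := by
  obtain ⟨c₁, hc₁, hU⟩ := hU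
  obtain ⟨c₂, hc₂, hV⟩ := hV
  have hVt : volume V ≠ ⊤ := (hb.subset hVΩ).measure_lt_top.ne
  have hIt : volume (U ∩ V) ≠ ⊤ := (hb.subset (inter_subset_left.trans hUΩ)).measure_lt_top.ne
  refine ⟨c₁ + (c₂ + volume V * ((volume (U ∩ V))⁻¹ * (c₁ + c₂))), ?_, fun z G hzG => ?_⟩
  · refine ENNReal.add_ne_top.2 ⟨hc₁, ENNReal.add_ne_top.2 ⟨hc₂, ?_⟩⟩
    exact ENNReal.mul_ne_top hVt (ENNReal.mul_ne_top (by simpa using h0)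
      (ENNReal.add_ne_top.2 ⟨hc₁, hc₂⟩))
  obtain ⟨q₁, hq₁⟩ := hU z G hzG
  obtain ⟨q₂, hq₂⟩ := hV z G hzG
  have hm : ∀ q : ℝ, AEMeasurable (fun x => ‖z x - q‖ₑ) (volume.restrict V) := fun q =>
    ((hzG.integrable.mono_set hVΩ).aestronglyMeasurable.sub aestronglyMeasurable_const).enorm
  set I := ∫⁻ x in Ω, ‖G x‖ₑ
  have hdiff : ‖q₂ - q₁‖ₑ ≤ (volume (U ∩ V))⁻¹ * (c₁ + c₂) * I := by
    have h1 : ‖q₂ - q₁‖ₑ * volume (U ∩ V) ≤ (c₁ + c₂) * I := by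
      rw [← setLIntegral_const]
      calc _ ≤ ∫⁻ x in U ∩ V, (‖z x - q₂‖ₑ + ‖z x - q₁‖ₑ) := lintegral_mono fun x => by
              rw [enorm_sub_rev q₂ q₁, add_comm]
              calc ‖q₁ - q₂‖ₑ = ‖(z x - q₂) - (z x - q₁)‖ₑ := by congr 1; ring
                _ ≤ _ := by rw [add_comm]; exact enorm_sub_le
        _ = (∫⁻ x in U ∩ V, ‖z x - q₂‖ₑ) + ∫⁻ x in U ∩ V, ‖z x - q₁‖ₑ :=
            lintegral_add_left' ((hm q₂).mono_measure
              (Measure.restrict_mono inter_subset_right le_rfl)) _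
        _ ≤ c₂ * I + c₁ * I := by
            gcongr
            · exact (lintegral_mono_set inter_subset_right).trans hq₂
            · exact (lintegral_mono_set inter_subset_left).trans hq₁
        _ = _ := by ring
    rw [mul_assoc, ← ENNReal.div_eq_inv_mul]
    exact (ENNReal.le_div_iff_mul_le (Or.inl h0) (Or.inl hIt)).2 h1
  refine ⟨q₁, (lintegral_union_le _ _ _).trans ?_⟩
  calc (∫⁻ x in U, ‖z x - q₁‖ₑ) + ∫⁻ x in V, ‖z x - q₁‖ₑ
      ≤ c₁ * I + ∫⁻ x in V, (‖z x - q₂‖ₑ + ‖q₂ - q₁‖ₑ) := by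
        gcongr with x
        calc ‖z x - q₁‖ₑ = ‖(z x - q₂) + (q₂ - q₁)‖ₑ := by congr 1; ring
          _ ≤ _ := enorm_add_le _ _
    _ = c₁ * I + ((∫⁻ x in V, ‖z x - q₂‖ₑ) + ‖q₂ - q₁‖ₑ * volume V) := by
        rw [lintegral_add_left' (hm q₂), setLIntegral_const]
    _ ≤ c₁ * I + (c₂ * I + (volume (U ∩ V))⁻¹ * (c₁ + c₂) * I * volume V) := by gcongr
    _ = _ := by ring

/-- Balls of the local radius centred at nearby points of Ω overlap in Ω with positive measure.
Connectedness links any two centres, and compactness of the closure leaves finitely many pieces to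
glue. -/
theorem hasL1Poincare_self {d : ℕ} {Ω : Set (E d)} (hΩ : IsOpen Ω) (hconn : IsConnected Ω)
    (hb : Bornology.IsBounded Ω) (hL : HasLipschitzBoundary Ω) : HasL1Poincare Ω Ω := by
  obtain ⟨Λ, r, m, hΛ, hr, hloc⟩ := exists_local_poincare hΩ hb hL
  have hU : ∀ x₀, HasL1Poincare Ω (Ω ∩ Metric.ball x₀ r) := by
    intro x₀
    refine ⟨2 ^ m * ENNReal.ofReal r, ENNReal.mul_ne_top (by simp) (by simp),
      fun z G hzG => ?_⟩
    obtain ⟨q, -, hq⟩ := hloc (averagingPair_id d) hzG x₀ r hr le_rfl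
    refine ⟨q, hq.trans ?_⟩
    simp only [id, mul_one]
    rw [lintegral_const_mul'' _ (hzG.grad_integrable.mono_set
      inter_subset_left).aestronglyMeasurable.enorm, mul_assoc]
    gcongr
    exact inter_subset_left
  have hpos : ∀ x ∈ Ω, ∀ V : Set (E d), IsOpen V → x ∈ V → volume (Ω ∩ V) ≠ 0 :=
    fun x hx V hV hxV => ((hΩ.inter hV).measure_pos volume ⟨x, hx, hxV⟩).ne'
  have hpair : ∀ {x y : E d}, x ∈ Ω → y ∈ Ω →
      HasL1Poincare Ω ((Ω ∩ Metric.ball x r) ∪ (Ω ∩ Metric.ball y r)) := by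
    refine hconn.isPreconnected.induction₂
      (fun x y => HasL1Poincare Ω ((Ω ∩ Metric.ball x r) ∪ (Ω ∩ Metric.ball y r))) ?_ ?_ ?_
    · intro x hx
      filter_upwards [mem_nhdsWithin_of_mem_nhds (Metric.ball_mem_nhds x hr),
        self_mem_nhdsWithin] with y hy hyΩ
      refine (hU x).union hb (hU y) inter_subset_left inter_subset_left ?_
      rw [← inter_inter_distrib_left]
      exact hpos y hyΩ _ (Metric.isOpen_ball.inter Metric.isOpen_ball)
        ⟨hy, Metric.mem_ball_self hr⟩
    · intro x y w _ hy _ hxy hyw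
      refine (hxy.union hb hyw (union_subset inter_subset_left inter_subset_left)
        (union_subset inter_subset_left inter_subset_left) ?_).mono ?_
      · intro h0
        refine hpos y hy _ Metric.isOpen_ball (Metric.mem_ball_self hr) (measure_mono_null ?_ h0)
        exact subset_inter subset_union_right subset_union_left
      · exact union_subset_union subset_union_left subset_union_right
    · intro x y _ _ h
      rwa [union_comm]
  obtain ⟨p, hp⟩ := hconn.nonempty
  have hcl : IsCompact (closure Ω) := Metric.isCompact_of_isClosed_isBounded isClosed_closure
    hb.closure
  -- The ball at the fixed point p is carried along so that any two members of the family overlap in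
  -- positive measure.
  have := hcl.induction_on
    (p := fun S => HasL1Poincare Ω ((Ω ∩ Metric.ball p r) ∪ (Ω ∩ S))) ?_ ?_ ?_ ?_
  · exact this.mono fun x hx => Or.inr ⟨hx, subset_closure hx⟩
  · simpa using hU p
  · intro S T hST h
    exact h.mono (by gcongr)
  · intro S T hS hT
    refine (hS.union hb hT (union_subset inter_subset_left inter_subset_left)
        (union_subset inter_subset_left inter_subset_left) ?_).mono ?_
    · intro h0
      refine hpos p hp _ Metric.isOpen_ball (Metric.mem_ball_self hr) (measure_mono_null ?_ h0)
      exact subset_inter subset_union_left subset_union_left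
    · rw [inter_union_distrib_left]
      exact union_subset (subset_union_left.trans subset_union_left)
        (union_subset_union subset_union_right subset_union_right)
  · intro b hbΩ
    obtain ⟨x, hxΩ, hx⟩ := Metric.mem_closure_iff.1 hbΩ (r / 2) (by positivity)
    refine ⟨Metric.ball b (r / 2), mem_nhdsWithin_of_mem_nhds
      (Metric.ball_mem_nhds b (by positivity)), (hpair hp hxΩ).mono ?_⟩
    gcongr
    exact Metric.ball_subset_ball' (by linarith)

theorem exists_average_domain_le {d : ℕ} {Ω : Set (E d)} (hΩ : IsOpen Ω) (hne : Ω.Nonempty)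
    (hb : Bornology.IsBounded Ω) :
    ∃ k : ℕ, ∀ {a : ℝ≥0∞} {g : ℝ≥0∞ → ℝ≥0∞} {ν : Measure (E d)}, AveragingPair a g ν →
      ∀ f : E d → ℝ≥0∞, AEMeasurable f (volume.restrict Ω) →
        ν Ω * g (⨍⁻ x in Ω, f x ∂volume) ≤ 4 ^ k * a * ∫⁻ x in Ω, g (f x) ∂ν := by
  obtain ⟨R, hR, hΩR⟩ := hb.subset_ball_lt 0 0
  have h0 : volume Ω ≠ 0 := (hΩ.measure_pos volume hne).ne'
  have h1 : volume Ω ≠ ⊤ := hb.measure_lt_top.ne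
  obtain ⟨k, hk⟩ := exists_le_two_pow' (c := volume (Metric.ball (0 : E d) R) / volume Ω)
    (ENNReal.div_ne_top measure_ball_lt_top.ne h0)
  refine ⟨k, fun {a g ν} h f hf => ?_⟩
  refine le_trans ?_ (h.average_subset hΩ.measurableSet hR hΩR
    ((ENNReal.div_le_iff h0 h1).1 hk) hf)
  gcongr

/-- Local inequalities are summed over a finite cover; their constants q are controlled by ∫_Ω |z|,
hence by the L¹ inequality. The bound is chosen before g and ν, so it depends on the pair only
through `a`. -/
theorem exists_global_poincare {d : ℕ} {Ω : Set (E d)} (hΩ : IsOpen Ω) (hconn : IsConnected Ω)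
    (hb : Bornology.IsBounded Ω) (hL : HasLipschitzBoundary Ω) {a : ℝ≥0∞} (ha : a ≠ ⊤) :
    ∃ c : ℝ≥0∞, c ≠ ⊤ ∧ ∀ {g : ℝ≥0∞ → ℝ≥0∞} {ν : Measure (E d)}, AveragingPair a g ν →
      ∀ {z : E d → ℝ} {G : E d → E d}, IsSobolevPair Ω z G → ∫ x in Ω, z x = 0 →
        ∫⁻ x in Ω, g ‖z x‖ₑ ∂ν ≤ c * ∫⁻ x in Ω, g ‖G x‖ₑ ∂ν := by
  have h0 : volume Ω ≠ 0 := (hΩ.measure_pos volume hconn.nonempty).ne'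
  have h1 : volume Ω ≠ ⊤ := hb.measure_lt_top.ne
  obtain ⟨c₁, hc₁, hP⟩ := hasL1Poincare_self hΩ hconn hb hL
  have hL1 : ∀ {z : E d → ℝ} {G : E d → E d}, IsSobolevPair Ω z G → ∫ x in Ω, z x = 0 →
      ∫⁻ x in Ω, ‖z x‖ₑ ≤ 2 * c₁ * ∫⁻ x in Ω, ‖G x‖ₑ := by
    intro z G hzG hmean
    obtain ⟨q, hq⟩ := hP z G hzG
    have hq' : volume Ω * ‖q‖ₑ ≤ c₁ * ∫⁻ x in Ω, ‖G x‖ₑ := by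
      refine le_trans ?_ hq
      have := enorm_sub_setAverage_le hzG.integrable h0 h1 q
      rw [setAverage_eq, hmean, smul_zero, sub_zero] at this
      calc volume Ω * ‖q‖ₑ ≤ volume Ω * ((volume Ω)⁻¹ * ∫⁻ y in Ω, ‖q - z y‖ₑ) := by gcongr
        _ = ∫⁻ y in Ω, ‖q - z y‖ₑ := by
            rw [← mul_assoc, ENNReal.mul_inv_cancel h0 h1, one_mul]
        _ = _ := lintegral_congr fun y => enorm_sub_rev _ _
    calc ∫⁻ x in Ω, ‖z x‖ₑ ≤ ∫⁻ x in Ω, (‖z x - q‖ₑ + ‖q‖ₑ) := lintegral_mono fun x => by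
          calc ‖z x‖ₑ = ‖(z x - q) + q‖ₑ := by congr 1; ring
            _ ≤ _ := enorm_add_le _ _
      _ = (∫⁻ x in Ω, ‖z x - q‖ₑ) + volume Ω * ‖q‖ₑ := by
          rw [lintegral_add_right _ measurable_const, setLIntegral_const, mul_comm]
      _ ≤ _ := (add_le_add hq hq').trans (le_of_eq (by ring))
  obtain ⟨Λ, r, m, hΛ, hr, hloc⟩ := exists_local_poincare hΩ hb hL
  obtain ⟨k, hk⟩ := exists_average_domain_le hΩ hconn.nonempty hb
  obtain ⟨n, hn⟩ := exists_le_two_pow r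
  have hV0 : volume (Metric.ball (0 : E d) r) ≠ 0 := (Metric.measure_ball_pos volume 0 hr).ne'
  have hV1 : volume (Metric.ball (0 : E d) r) ≠ ⊤ := measure_ball_lt_top.ne
  obtain ⟨j, hj⟩ := exists_le_two_pow'
    (c := (volume (Metric.ball (0 : E d) r))⁻¹ * (2 * c₁ * volume Ω))
    (ENNReal.mul_ne_top (by simpa using hV0)
      (ENNReal.mul_ne_top (ENNReal.mul_ne_top (by simp) hc₁) h1))
  have hcl : IsCompact (closure Ω) := Metric.isCompact_of_isClosed_isBounded isClosed_closure
    hb.closure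
  have := hcl.induction_on (p := fun S => ∃ c : ℝ≥0∞, c ≠ ⊤ ∧
      ∀ {g : ℝ≥0∞ → ℝ≥0∞} {ν : Measure (E d)}, AveragingPair a g ν →
      ∀ {z : E d → ℝ} {G : E d → E d}, IsSobolevPair Ω z G → ∫ x in Ω, z x = 0 →
        ∫⁻ x in Ω ∩ S, g ‖z x‖ₑ ∂ν ≤ c * ∫⁻ x in Ω, g ‖G x‖ₑ ∂ν) ?_ ?_ ?_ ?_
  · rwa [inter_eq_self_of_subset_left subset_closure] at this
  · exact ⟨0, by simp, by simp⟩
  · rintro S T hST ⟨c, hc, h⟩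
    exact ⟨c, hc, fun {g ν} hg {z G} hzG hm => (lintegral_mono_set (by gcongr)).trans (h hg hzG hm)⟩
  · rintro S T ⟨c, hc, h⟩ ⟨c', hc', h'⟩
    refine ⟨c + c', ENNReal.add_ne_top.2 ⟨hc, hc'⟩, fun {g ν} hg {z G} hzG hm => ?_⟩
    rw [inter_union_distrib_left, add_mul]
    exact (lintegral_union_le _ _ _).trans (add_le_add (h hg hzG hm) (h' hg hzG hm))
  · intro b _
    refine ⟨Metric.ball b r, mem_nhdsWithin_of_mem_nhds (Metric.ball_mem_nhds b hr),
      4 * (2 ^ m * a * 4 ^ n) + 4 * (4 ^ j * (4 ^ k * a)), by finiteness, ?_⟩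
    intro g ν hg z G hzG hmean
    obtain ⟨q, hq1, hq2⟩ := hloc hg hzG b r hr le_rfl
    have hGm : AEMeasurable (fun x => ‖G x‖ₑ) (volume.restrict Ω) :=
      hzG.grad_integrable.aestronglyMeasurable.enorm
    have hq3 : ‖q‖ₑ ≤ 2 ^ j * ⨍⁻ x in Ω, ‖G x‖ₑ ∂volume := by
      calc ‖q‖ₑ = (volume (Metric.ball (0 : E d) r))⁻¹ *
            (volume (Metric.ball (0 : E d) r) * ‖q‖ₑ) := by
            rw [← mul_assoc, ENNReal.inv_mul_cancel hV0 hV1, one_mul]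
        _ ≤ (volume (Metric.ball (0 : E d) r))⁻¹ * (2 * c₁ * ∫⁻ x in Ω, ‖G x‖ₑ) := 
            mul_le_mul_right (hq1.trans (hL1 hzG hmean)) _
        _ = ((volume (Metric.ball (0 : E d) r))⁻¹ * (2 * c₁ * volume Ω)) *
            ⨍⁻ x in Ω, ‖G x‖ₑ ∂volume := by
            rw [← measure_mul_setLAverage _ h1]; ring
        _ ≤ _ := by gcongr
    -- A power of 2 times the mean of |∇z| over Ω bounds |q|, and the averaging inequality on Ω
    -- brings this back to the modular of ∇z.
    have hq4 : ν Ω * g ‖q‖ₑ ≤ 4 ^ j * (4 ^ k * a * ∫⁻ x in Ω, g ‖G x‖ₑ ∂ν) := by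
      calc ν Ω * g ‖q‖ₑ ≤ ν Ω * (4 ^ j * g (⨍⁻ x in Ω, ‖G x‖ₑ ∂volume)) := by
            gcongr; exact (hg.mono hq3).trans (hg.pow_two_mul _ _)
        _ = 4 ^ j * (ν Ω * g (⨍⁻ x in Ω, ‖G x‖ₑ ∂volume)) := by ring
        _ ≤ _ := mul_le_mul_right (hk hg _ hGm) _
    have hq5 : ∫⁻ x in Ω ∩ Metric.ball b (Λ * r), g (ENNReal.ofReal r * ‖G x‖ₑ) ∂ν ≤
        4 ^ n * ∫⁻ x in Ω, g ‖G x‖ₑ ∂ν := by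
      refine (lintegral_mono_set inter_subset_left).trans ?_
      rw [← lintegral_const_mul' _ _ (by simp)]
      exact lintegral_mono fun x => (hg.mono (by gcongr)).trans (hg.pow_two_mul n _)
    calc ∫⁻ x in Ω ∩ Metric.ball b r, g ‖z x‖ₑ ∂ν
        ≤ ∫⁻ x in Ω ∩ Metric.ball b r, (4 * g ‖z x - q‖ₑ + 4 * g ‖q‖ₑ) ∂ν :=
          lintegral_mono fun x => by
            refine (hg.mono ?_).trans (hg.add_le _ _)
            calc ‖z x‖ₑ = ‖(z x - q) + q‖ₑ := by congr 1; ring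
              _ ≤ _ := enorm_add_le _ _
      _ = 4 * (∫⁻ x in Ω ∩ Metric.ball b r, g ‖z x - q‖ₑ ∂ν) +
          4 * (ν (Ω ∩ Metric.ball b r) * g ‖q‖ₑ) := by
          rw [lintegral_add_right _ measurable_const, setLIntegral_const,
            lintegral_const_mul' _ _ (by simp)]
          ring
      _ ≤ 4 * (2 ^ m * a * (4 ^ n * ∫⁻ x in Ω, g ‖G x‖ₑ ∂ν)) +
          4 * (4 ^ j * (4 ^ k * a * ∫⁻ x in Ω, g ‖G x‖ₑ ∂ν)) := by
          refine add_le_add (mul_le_mul_right (hq2.trans (mul_le_mul_right hq5 _)) _)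
            (mul_le_mul_right (le_trans ?_ hq4) _)
          gcongr
          exact inter_subset_left
      _ = _ := by ring

/-! ### First-order approximation on stable covers -/

theorem lintegral_biUnion_finset_le {α ι : Type*} [MeasurableSpace α] (μ : Measure α)
    (T : Finset ι) (S : ι → Set α) (f : α → ℝ≥0∞) :
    ∫⁻ x in ⋃ i ∈ T, S i, f x ∂μ ≤ ∑ i ∈ T, ∫⁻ x in S i, f x ∂μ := by
  classical
  induction T using Finset.induction_on with
  | empty => simp
  | insert i T hi ih =>
    rw [Finset.set_biUnion_insert, Finset.sum_insert hi]
    exact (lintegral_union_le _ _ _).trans (by gcongr)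

/-- A finite cover of `Ω` by sets `K i` at scale `h`, with neighbourhoods `S i ⊆ Ω` of bounded overlap
that fill a fixed portion of a ball. -/
structure IsStableCover {d : ℕ} {ι : Type*} (Ω : Set (E d)) (T : Finset ι) (K S : ι → Set (E d))
    (h : ℝ) (m N : ℕ) : Prop where
  measurable : ∀ i ∈ T, MeasurableSet (S i)
  measurable_cell : ∀ i ∈ T, MeasurableSet (K i)
  subset : ∀ i ∈ T, K i ⊆ S i
  cover : Ω ⊆ ⋃ i ∈ T, K i
  subset_domain : ∀ i ∈ T, S i ≤ᵐ[volume] Ω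
  size : ∀ i ∈ T, ∃ (x : E d) (r : ℝ), 0 < r ∧ S i ⊆ Metric.ball x r ∧
    volume (Metric.ball x r) ≤ 2 ^ m * volume (S i)
  dist_le : ∀ i ∈ T, ∀ x ∈ S i, ∀ y ∈ S i, dist x y ≤ 3 * h
  overlap : ∀ᵐ x, ∑ i ∈ T, (S i).indicator (fun _ => (1 : ℝ≥0∞)) x ≤ N

section

variable {d : ℕ} {ι : Type*} {Ω : Set (E d)} {T : Finset ι} {K S : ι → Set (E d)} {h : ℝ}
  {m N : ℕ} {a : ℝ≥0∞} {g : ℝ≥0∞ → ℝ≥0∞} {ν : Measure (E d)}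

theorem IsStableCover.sum_setLIntegral_le (hC : IsStableCover Ω T K S h m N) (hν : ν ≪ volume)
    {V : Set (E d)} {T' : Finset ι} (hT' : T' ⊆ T)
    (hS : ∀ i ∈ T', S i ∩ Ω ⊆ V) {H : E d → ℝ≥0∞} (hH : AEMeasurable H (ν.restrict V)) :
    ∑ i ∈ T', ∫⁻ x in S i, H x ∂ν ≤ N * ∫⁻ x in V, H x ∂ν := by
  calc ∑ i ∈ T', ∫⁻ x in S i, H x ∂ν
      ≤ ∑ i ∈ T', ∫⁻ x in V, (S i).indicator H x ∂ν := by
        refine Finset.sum_le_sum fun i hi => ?_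
        rw [setLIntegral_indicator (hC.measurable i (hT' hi))]
        refine lintegral_mono' (Measure.restrict_mono_ae ?_) le_rfl
        filter_upwards [hν.ae_le (hC.subset_domain i (hT' hi))] with x hx hxS
        exact ⟨hxS, hS i hi ⟨hxS, hx hxS⟩⟩
    _ = ∫⁻ x in V, ∑ i ∈ T', (S i).indicator H x ∂ν :=
        (lintegral_finsetSum' _ fun i hi => hH.indicator (hC.measurable i (hT' hi))).symm
    _ ≤ ∫⁻ x in V, N * H x ∂ν := by
        refine lintegral_mono_ae (ae_restrict_of_ae ?_)
        filter_upwards [hν.ae_le hC.overlap] with x hx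
        calc ∑ i ∈ T', (S i).indicator H x
            ≤ ∑ i ∈ T, (S i).indicator (fun _ => (1 : ℝ≥0∞)) x * H x := by
              refine (Finset.sum_le_sum_of_subset hT').trans (Finset.sum_le_sum fun i _ => ?_)
              by_cases hi : x ∈ S i <;> simp [hi]
          _ ≤ _ := by rw [← Finset.sum_mul]; gcongr
    _ = _ := lintegral_const_mul'' _ hH

-- On a cell meeting U, |w - q| is at most 2^l times the mean of |z - q| over its neighbourhood. The
-- averaging inequality turns the measure of the cell times g of that mean into an integral over the
-- neighbourhood, and bounded overlap sums these integrals.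
open Classical in
theorem IsStableCover.setLIntegral_sub_le (hC : IsStableCover Ω T K S h m N)
    (hg : AveragingPair a g ν) {z w : E d → ℝ} (hz : IntegrableOn z Ω) {l : ℕ} (q : ℝ)
    (hw : ∀ i ∈ T, ∀ᵐ x, x ∈ Ω → x ∈ K i →
      ‖w x - q‖ₑ ≤ 2 ^ l * ⨍⁻ y in S i, ‖z y - q‖ₑ ∂volume)
    {U V : Set (E d)} (hU : MeasurableSet U) (hUV : U ⊆ V) (hV : V ⊆ Ω)
    (hSV : ∀ i ∈ T, (K i ∩ U).Nonempty → S i ∩ Ω ⊆ V) :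
    ∫⁻ x in U, g ‖z x - w x‖ₑ ∂ν ≤
      (4 + 4 * (4 ^ l * (4 ^ m * a) * N)) * ∫⁻ x in V, g ‖z x - q‖ₑ ∂ν := by
  have hzm : AEMeasurable (fun x => ‖z x - q‖ₑ) (volume.restrict Ω) :=
    (hz.aestronglyMeasurable.sub aestronglyMeasurable_const).enorm
  have hgm : AEMeasurable (fun x => g ‖z x - q‖ₑ) (ν.restrict V) :=
    hg.measurable.comp_aemeasurable ((hzm.mono_ac (hg.ac.restrict Ω)).mono_measure
      (Measure.restrict_mono hV le_rfl))
  set T' : Finset ι := T.filter fun i => (K i ∩ U).Nonempty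
  have hT' : T' ⊆ T := Finset.filter_subset _ _
  have hcov : U ⊆ ⋃ i ∈ T', K i ∩ U := by
    intro x hx
    obtain ⟨i, hi, hxi⟩ := mem_iUnion₂.1 (hC.cover (hV (hUV hx)))
    exact mem_iUnion₂.2 ⟨i, Finset.mem_filter.2 ⟨hi, ⟨x, hxi, hx⟩⟩, hxi, hx⟩
  have hpiece : ∀ i ∈ T', ∫⁻ x in K i ∩ U, g ‖w x - q‖ₑ ∂ν ≤
      4 ^ l * (4 ^ m * a) * ∫⁻ x in S i, g ‖z x - q‖ₑ ∂ν := by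
    intro i hi
    have hiT := hT' hi
    obtain ⟨b, r, hr, hSB, hvol⟩ := hC.size i hiT
    have hzS : AEMeasurable (fun x => ‖z x - q‖ₑ) (volume.restrict (S i)) :=
      hzm.mono_measure (Measure.restrict_mono_ae (hC.subset_domain i hiT))
    calc ∫⁻ x in K i ∩ U, g ‖w x - q‖ₑ ∂ν
        ≤ ∫⁻ x in K i ∩ U, 4 ^ l * g (⨍⁻ y in S i, ‖z y - q‖ₑ ∂volume) ∂ν := by
          refine lintegral_mono_ae ?_
          filter_upwards [ae_restrict_mem ((hC.measurable_cell i hiT).inter hU),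
            ae_restrict_of_ae (hg.ac.ae_le (hw i hiT))] with x hx hx2
          exact (hg.mono (hx2 (hV (hUV hx.2)) hx.1)).trans (hg.pow_two_mul _ _)
      _ = 4 ^ l * (ν (K i ∩ U) * g (⨍⁻ y in S i, ‖z y - q‖ₑ ∂volume)) := by
          rw [setLIntegral_const]; ring
      _ ≤ 4 ^ l * (ν (Metric.ball b r) * g (⨍⁻ y in S i, ‖z y - q‖ₑ ∂volume)) := by
          gcongr
          exact inter_subset_left.trans ((hC.subset i hiT).trans hSB)
      _ ≤ 4 ^ l * (4 ^ m * a * ∫⁻ x in S i, g ‖z x - q‖ₑ ∂ν) :=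
          mul_le_mul_right (hg.average_subset (hC.measurable i hiT) hr hSB hvol hzS) _
      _ = _ := by ring
  have hwq : ∫⁻ x in U, g ‖w x - q‖ₑ ∂ν ≤
      4 ^ l * (4 ^ m * a) * N * ∫⁻ x in V, g ‖z x - q‖ₑ ∂ν := by
    calc ∫⁻ x in U, g ‖w x - q‖ₑ ∂ν ≤ ∫⁻ x in ⋃ i ∈ T', K i ∩ U, g ‖w x - q‖ₑ ∂ν :=
          lintegral_mono_set hcov
      _ ≤ ∑ i ∈ T', ∫⁻ x in K i ∩ U, g ‖w x - q‖ₑ ∂ν := by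
          exact lintegral_biUnion_finset_le ν T' _ _
      _ ≤ ∑ i ∈ T', 4 ^ l * (4 ^ m * a) * ∫⁻ x in S i, g ‖z x - q‖ₑ ∂ν :=
          Finset.sum_le_sum hpiece
      _ = 4 ^ l * (4 ^ m * a) * ∑ i ∈ T', ∫⁻ x in S i, g ‖z x - q‖ₑ ∂ν := by
          rw [Finset.mul_sum]
      _ ≤ 4 ^ l * (4 ^ m * a) * (N * ∫⁻ x in V, g ‖z x - q‖ₑ ∂ν) :=
          mul_le_mul_right (hC.sum_setLIntegral_le hg.ac hT'
            (fun i hi => hSV i (hT' hi) (Finset.mem_filter.1 hi).2) hgm) _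
      _ = _ := by ring
  calc ∫⁻ x in U, g ‖z x - w x‖ₑ ∂ν
      ≤ ∫⁻ x in U, (4 * g ‖z x - q‖ₑ + 4 * g ‖w x - q‖ₑ) ∂ν := lintegral_mono fun x => by
        refine (hg.mono ?_).trans (hg.add_le _ _)
        calc ‖z x - w x‖ₑ = ‖(z x - q) - (w x - q)‖ₑ := by congr 1; ring
          _ ≤ _ := enorm_sub_le
    _ = 4 * (∫⁻ x in U, g ‖z x - q‖ₑ ∂ν) + 4 * ∫⁻ x in U, g ‖w x - q‖ₑ ∂ν := by
        rw [lintegral_add_left' ((hgm.mono_measure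
          (Measure.restrict_mono hUV le_rfl)).const_mul _),
          lintegral_const_mul' _ _ (by simp), lintegral_const_mul' _ _ (by simp)]
    _ ≤ 4 * (∫⁻ x in V, g ‖z x - q‖ₑ ∂ν) +
        4 * (4 ^ l * (4 ^ m * a) * N * ∫⁻ x in V, g ‖z x - q‖ₑ ∂ν) := by gcongr
    _ = _ := by ring

/-- Locally stable approximations that preserve constants are of first order. -/
theorem exists_approximation_le (hΩ : IsOpen Ω) (hconn : IsConnected Ω)
    (hb : Bornology.IsBounded Ω) (hL : HasLipschitzBoundary Ω) (ha : a ≠ ⊤) (m N l : ℕ) :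
    ∃ c : ℝ≥0∞, c ≠ ⊤ ∧ ∀ {g : ℝ≥0∞ → ℝ≥0∞} {ν : Measure (E d)}, AveragingPair a g ν →
      ∀ {z : E d → ℝ} {G : E d → E d}, IsSobolevPair Ω z G → ∫ x in Ω, z x = 0 →
      ∀ {ι : Type} {T : Finset ι} {K S : ι → Set (E d)} {h : ℝ}, 0 < h →
      IsStableCover Ω T K S h m N → ∀ {w : E d → ℝ}, AEStronglyMeasurable w (volume.restrict Ω) →
      (∀ q : ℝ, ∀ i ∈ T, ∀ᵐ x, x ∈ Ω → x ∈ K i →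
        ‖w x - q‖ₑ ≤ 2 ^ l * ⨍⁻ y in S i, ‖z y - q‖ₑ ∂volume) →
      ∫⁻ x in Ω, g ‖z x - w x‖ₑ ∂ν ≤ c * ∫⁻ x in Ω, g (ENNReal.ofReal h * ‖G x‖ₑ) ∂ν := by
  obtain ⟨Λ, r₀, n, hΛ, hr₀, hloc⟩ := exists_local_poincare hΩ hb hL
  obtain ⟨c₂, hc₂, hglob⟩ := exists_global_poincare hΩ hconn hb hL ha
  obtain ⟨k, hk⟩ := exists_le_two_pow (5 / r₀)
  set c₁ : ℝ≥0∞ := 4 + 4 * (4 ^ l * (4 ^ m * a) * N)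
  have hc₁ : c₁ ≠ ⊤ := by finiteness
  refine ⟨ENNReal.ofReal ((5 * Λ) ^ d) * (c₁ * (2 ^ n * a * 4 ^ 3)) + c₁ * (c₂ * 4 ^ k),
    by finiteness, ?_⟩
  intro g ν hg z G hzG hmean ι T K S h hh hC w hwm hw
  have := hg.sfinite
  rw [add_mul]
  rcases le_or_gt (5 * h) r₀ with hsmall | hlarge
  · refine le_trans ?_ le_self_add
    have hV0 : volume (Metric.ball (0 : E d) h) ≠ 0 := (Metric.measure_ball_pos volume 0 hh).ne'
    have hV1 : volume (Metric.ball (0 : E d) h) ≠ ⊤ := measure_ball_lt_top.ne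
    have hlocal : ∀ x₀, ∫⁻ x in Metric.ball x₀ h, g ‖z x - w x‖ₑ ∂(ν.restrict Ω) ≤
        c₁ * (2 ^ n * a * 4 ^ 3) * ∫⁻ x in Metric.ball x₀ (5 * Λ * h),
          g (ENNReal.ofReal h * ‖G x‖ₑ) ∂(ν.restrict Ω) := by
      intro x₀
      rw [Measure.restrict_restrict Metric.isOpen_ball.measurableSet,
        Measure.restrict_restrict Metric.isOpen_ball.measurableSet, inter_comm, inter_comm _ Ω]
      -- Neighbourhoods of cells meeting B(x₀, h) have diameter at most 3h, so within Ω they lie in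
      -- B(x₀, 5h), where one constant q serves all of them.
      obtain ⟨q, -, hq⟩ := hloc hg hzG x₀ (5 * h) (by positivity) hsmall
      have h5 : ∫⁻ x in Ω ∩ Metric.ball x₀ (Λ * (5 * h)), g (ENNReal.ofReal (5 * h) * ‖G x‖ₑ) ∂ν ≤
          4 ^ 3 * ∫⁻ x in Ω ∩ Metric.ball x₀ (5 * Λ * h),
            g (ENNReal.ofReal h * ‖G x‖ₑ) ∂ν := by
        rw [show Λ * (5 * h) = 5 * Λ * h by ring, ← lintegral_const_mul' _ _ (by simp)]
        refine lintegral_mono fun x => (hg.mono ?_).trans (hg.pow_two_mul 3 _)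
        rw [ENNReal.ofReal_mul (by norm_num), mul_assoc]
        gcongr
        norm_num
      refine (hC.setLIntegral_sub_le hg hzG.integrable q (hw q)
        (V := Ω ∩ Metric.ball x₀ (5 * h))
        (hΩ.measurableSet.inter Metric.isOpen_ball.measurableSet) ?_ inter_subset_left ?_).trans ?_
      · gcongr; linarith
      · rintro i hi ⟨p, hpK, -, hpx⟩ y ⟨hyS, hyΩ⟩
        refine ⟨hyΩ, ?_⟩
        have h1 := hC.dist_le i hi y hyS p (hC.subset i hi hpK)
        have h2 := Metric.mem_ball.1 hpx
        have := dist_triangle y p x₀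
        rw [Metric.mem_ball]; linarith
      · refine (mul_le_mul_right (hq.trans (mul_le_mul_right h5 _)) _).trans (le_of_eq (by ring))
    have hm1 : AEMeasurable (fun x => g ‖z x - w x‖ₑ) (ν.restrict Ω) :=
      hg.measurable.comp_aemeasurable
        ((hzG.integrable.aestronglyMeasurable.sub hwm).enorm.mono_ac (hg.ac.restrict Ω))
    have hm2 : AEMeasurable (fun x => g (ENNReal.ofReal h * ‖G x‖ₑ)) (ν.restrict Ω) :=
      hg.measurable.comp_aemeasurable
        ((hzG.grad_integrable.aestronglyMeasurable.enorm.const_mul _).mono_ac (hg.ac.restrict Ω))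
    -- Integrating over all centres x₀ makes each side the volume of a ball times the full integral,
    -- so no further covering of Ω by balls is needed.
    have tot := lintegral_mono (μ := (volume : Measure (E d))) hlocal
    rw [lintegral_setLIntegral_ball _ _ hm1, lintegral_const_mul' _ _ (by finiteness),
      lintegral_setLIntegral_ball _ _ hm2, volume_ball_smul 0 0 hh (by linarith)] at tot
    rw [← ENNReal.mul_le_mul_iff_right hV0 hV1]
    exact tot.trans (le_of_eq (by ring))
  -- For h > r₀/5 the factor h is bounded below, and stability with q = 0 together with the global
  -- inequality suffices.
  · refine le_trans ?_ le_add_self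
    have h1 := hC.setLIntegral_sub_le hg hzG.integrable 0 (hw 0) hΩ.measurableSet le_rfl le_rfl
      (fun i _ _ => inter_subset_right)
    simp only [sub_zero] at h1
    have h2 : ∫⁻ x in Ω, g ‖G x‖ₑ ∂ν ≤
        4 ^ k * ∫⁻ x in Ω, g (ENNReal.ofReal h * ‖G x‖ₑ) ∂ν := by
      rw [← lintegral_const_mul' _ _ (by simp)]
      refine lintegral_mono fun x => (hg.mono ?_).trans (hg.pow_two_mul k _)
      rw [← mul_assoc]
      refine le_mul_of_one_le_left' ?_
      calc (1 : ℝ≥0∞) = ENNReal.ofReal 1 := by simp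
        _ ≤ ENNReal.ofReal (5 / r₀ * h) := ENNReal.ofReal_le_ofReal (by
            rw [div_mul_eq_mul_div, le_div_iff₀ hr₀]; linarith)
        _ ≤ _ := by rw [ENNReal.ofReal_mul (by positivity)]; gcongr
    calc _ ≤ c₁ * ∫⁻ x in Ω, g ‖z x‖ₑ ∂ν := h1
      _ ≤ c₁ * (c₂ * ∫⁻ x in Ω, g ‖G x‖ₑ ∂ν) := mul_le_mul_right (hglob hg hzG hmean) _
      _ ≤ c₁ * (c₂ * (4 ^ k * ∫⁻ x in Ω, g (ENNReal.ofReal h * ‖G x‖ₑ) ∂ν)) := by gcongr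
      _ = _ := by ring

end

/-! ### Simplices and shape-regular triangulations -/

theorem measure_hyperplane {d : ℕ} {n : E d} (hn : n ≠ 0) (b : ℝ) :
    volume {x : E d | inner ℝ n x = b} = 0 := by
  by_cases hne : ∃ x₀ : E d, inner ℝ n x₀ = b
  · obtain ⟨x₀, hx₀⟩ := hne
    set W : Submodule ℝ (E d) := LinearMap.ker (innerₛₗ ℝ n)
    have hW : AffineSubspace.mk' x₀ W ≠ ⊤ := by
      intro h
      have h2 := congrArg AffineSubspace.direction h
      rw [AffineSubspace.direction_mk', AffineSubspace.direction_top] at h2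
      have : n ∈ W := h2 ▸ Submodule.mem_top
      exact hn (inner_self_eq_zero.1 (LinearMap.mem_ker.1 this))
    refine measure_mono_null (fun x hx => ?_) (Measure.addHaar_affineSubspace volume _ hW)
    rw [SetLike.mem_coe, AffineSubspace.mem_mk', vsub_eq_sub, LinearMap.mem_ker]
    simp only [innerₛₗ_apply_apply, inner_sub_right, hx₀]
    rw [mem_ofPred_eq] at hx
    rw [hx, sub_self]
  · convert measure_empty (μ := (volume : Measure (E d)))
    ext x
    simp only [mem_ofPred_eq, mem_empty_iff_false, iff_false]
    exact fun h => hne ⟨x, h⟩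

/-- The cells cover the closure of Ω while the integrals live on Ω. Polyhedrality makes the
difference null: finitely many hyperplanes contain the boundary. -/
theorem IsPolyhedralLipschitzDomain.closure_ae_le {d : ℕ} {Ω : Set (E d)}
    (hΩ : IsPolyhedralLipschitzDomain Ω) : closure Ω ≤ᵐ[volume] Ω := by
  obtain ⟨H, hH, hfr⟩ := hΩ.polyhedral
  have h0 : volume (frontier Ω) = 0 := by
    refine measure_mono_null (t := ⋃ nb ∈ H, {x | inner ℝ nb.1 x = nb.2}) (fun x hx => ?_) ?_
    · obtain ⟨nb, hnb, hx⟩ := hfr hx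
      exact mem_iUnion₂.2 ⟨nb, hnb, hx⟩
    · exact (measure_biUnion_null_iff H.countable_toSet).2
        fun nb hnb => measure_hyperplane (hH nb hnb) _
  filter_upwards [measure_eq_zero_iff_ae_notMem.1 h0] with x hx hxc
  by_contra hxΩ
  exact hx ⟨hxc, fun hi => hxΩ (interior_subset hi)⟩

section cell

variable {d : ℕ} {K : Finset (E d)}

theorem isCompact_cell (K : Finset (E d)) : IsCompact (cell K) :=
  Set.Finite.isCompact_convexHull ℝ K.finite_toSet

theorem convex_cell (K : Finset (E d)) : Convex ℝ (cell K) := convex_convexHull ℝ _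

theorem interior_cell_nonempty (hcard : K.card = d + 1)
    (hind : AffineIndependent ℝ ((↑) : K → E d)) : (interior (cell K)).Nonempty := by
  rw [cell, interior_convexHull_nonempty_iff_affineSpan_eq_top]
  have := (hind.affineSpan_eq_top_iff_card_eq_finrank_add_one).2 (by simp [hcard])
  simpa using this

theorem le_diam_of_ball_subset (hd : 0 < d) {S : Set (E d)} (hS : Bornology.IsBounded S) {x : E d}
    {r : ℝ} (h : Metric.ball x r ⊆ S) : r ≤ Metric.diam S := by
  refine le_of_forall_lt_imp_le_of_dense fun s hs => ?_
  rcases lt_or_ge s 0 with hs0 | hs0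
  · exact hs0.le.trans Metric.diam_nonneg
  · set e : E d := EuclideanSpace.single ⟨0, hd⟩ 1
    have he : ‖e‖ = 1 := by simp [e]
    have hn : ‖s • e‖ = s := by rw [norm_smul, he, mul_one, Real.norm_of_nonneg hs0]
    have h1 : x ∈ S := h (Metric.mem_ball_self (hs0.trans_lt hs))
    have h2 : x + s • e ∈ S := h (by rw [mem_ball_iff_norm, add_sub_cancel_left, hn]; exact hs)
    have := Metric.dist_le_diam_of_mem hS h2 h1
    rwa [dist_eq_norm, add_sub_cancel_left, hn] at this

/-- A simplex of bounded chunkiness contains a ball of comparable size. -/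
theorem exists_ball_subset_cell (hd : 0 < d) (hcard : K.card = d + 1)
    (hind : AffineIndependent ℝ ((↑) : K → E d)) {κ : ℝ} (hκ : 0 < κ) (hch : chunkiness K ≤ κ) :
    0 < Metric.diam (cell K) ∧
      ∃ x, Metric.ball x ((2 * κ)⁻¹ * Metric.diam (cell K)) ⊆ cell K := by
  set R : Set ℝ := {r : ℝ | 0 ≤ r ∧ ∃ x, Metric.ball x r ⊆ cell K}
  have hbd : BddAbove R := ⟨Metric.diam (cell K), fun r hr => by
    obtain ⟨-, x, hx⟩ := hr
    exact le_diam_of_ball_subset hd (isCompact_cell K).isBounded hx⟩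
  obtain ⟨p, hp⟩ := interior_cell_nonempty hcard hind
  obtain ⟨ε, hε, hpε⟩ := Metric.isOpen_iff.1 isOpen_interior p hp
  have hεR : ε ∈ R := ⟨hε.le, p, hpε.trans interior_subset⟩
  have hin : 0 < inradius (cell K) := hε.trans_le (le_csSup hbd hεR)
  have hdiam : 0 < Metric.diam (cell K) :=
    hε.trans_le (le_diam_of_ball_subset hd (isCompact_cell K).isBounded (hpε.trans interior_subset))
  refine ⟨hdiam, ?_⟩
  have h1 : Metric.diam (cell K) ≤ κ * inradius (cell K) := (div_le_iff₀ hin).1 hch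
  -- The factor 2 makes the inequality strict, as the supremum defining the inradius need not be
  -- known to be attained.
  have h2 : (2 * κ)⁻¹ * Metric.diam (cell K) < inradius (cell K) := by
    rw [inv_mul_lt_iff₀ (by positivity)]
    nlinarith [mul_pos hκ hin]
  obtain ⟨r, ⟨-, x, hx⟩, hr⟩ := exists_lt_of_lt_csSup ⟨ε, hεR⟩ h2
  exact ⟨x, (Metric.ball_subset_ball hr.le).trans hx⟩

end cell

section triangulation

variable {d : ℕ} {Ω : Set (E d)} {T : Finset (Finset (E d))}

/-- The intersection is the hull of the common vertices. For it to have interior there must be d+1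
of them, and then the two simplices coincide. -/
theorem IsTriangulation.interior_disjoint (hT : IsTriangulation Ω T) {K K' : Finset (E d)}
    (hK : K ∈ T) (hK' : K' ∈ T) (hne : K ≠ K') :
    Disjoint (interior (cell K)) (interior (cell K')) := by
  classical
  rw [Set.disjoint_iff_inter_eq_empty, ← interior_inter, hT.conforming K hK K' hK']
  by_contra hcon
  rw [← ne_eq, ← nonempty_iff_ne_empty,
    interior_convexHull_nonempty_iff_affineSpan_eq_top, ← Finset.coe_inter] at hcon
  have hind : AffineIndependent ℝ ((↑) : ((K ∩ K' : Finset (E d)) : Set (E d)) → E d) :=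
    AffineIndependent.mono (t := (K : Set (E d))) (hT.indep K hK) (by simp)
  have h1 := (hind.affineSpan_eq_top_iff_card_eq_finrank_add_one).1 (by
    rw [Subtype.range_coe]; exact hcon)
  have h2 : (K ∩ K').card = d + 1 := by simpa using h1
  have e1 : K ∩ K' = K := Finset.eq_of_subset_of_card_le Finset.inter_subset_left
    (by rw [h2, hT.card K hK])
  have e2 : K ∩ K' = K' := Finset.eq_of_subset_of_card_le Finset.inter_subset_right
    (by rw [h2, hT.card K' hK'])
  exact hne (e1.symm.trans e2)

theorem IsTriangulation.ae_unique (hT : IsTriangulation Ω T) :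
    ∀ᵐ x, ∀ K ∈ T, ∀ K' ∈ T, x ∈ cell K → x ∈ cell K' → K = K' := by
  have h : ∀ᵐ x, ∀ K ∈ T, x ∉ frontier (cell K) :=
    (Finset.eventually_all T).2 fun K _ =>
      measure_eq_zero_iff_ae_notMem.1 ((convex_cell K).addHaar_frontier volume)
  filter_upwards [h] with x hx K hK K' hK' hxK hxK'
  by_contra hne
  have hi : ∀ K ∈ T, x ∈ cell K → x ∈ interior (cell K) := fun K hK hxK => by
    by_contra hxi
    exact hx K hK ⟨subset_closure hxK, hxi⟩
  exact disjoint_left.1 (hT.interior_disjoint hK hK' hne) (hi K hK hxK) (hi K' hK' hxK')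

theorem IsTriangulation.diam_le (T : Finset (Finset (E d))) {K : Finset (E d)} (hK : K ∈ T) :
    Metric.diam (cell K) ≤ meshSize T :=
  le_csSup (T.finite_toSet.image _).bddAbove ⟨K, hK, rfl⟩

/-- Shape regularity bounds the number of simplices at a vertex. -/
theorem IsTriangulation.card_vertex_le (hd : 0 < d) (hT : IsTriangulation Ω T) {κ : ℝ} (hκ : 0 < κ)
    (hch : ∀ K ∈ T, chunkiness K ≤ κ) (v : E d) [DecidablePred fun K : Finset (E d) => v ∈ K] :
    ((T.filter fun K => v ∈ K).card : ℝ) ≤ (2 * κ) ^ d := by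
  set T' := T.filter fun K => v ∈ K
  -- Each simplex at v is rescaled about v to unit diameter. By convexity the rescaled interiors
  -- remain disjoint; they lie in the unit ball and each contains a ball of radius 1/(2κ). Diameters
  -- of neighbouring simplices thus need not be compared.
  set Q : Finset (E d) → Set (E d) := fun K =>
    (fun y => v + Metric.diam (cell K) • y) ⁻¹' interior (cell K)
  have hT' : ∀ K ∈ T', K ∈ T ∧ v ∈ cell K := fun K hK =>
    ⟨(Finset.mem_filter.1 hK).1, subset_convexHull ℝ _ (Finset.mem_filter.1 hK).2⟩
  have hball : ∀ K ∈ T', 0 < Metric.diam (cell K) ∧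
      ∃ x, Metric.ball x ((2 * κ)⁻¹ * Metric.diam (cell K)) ⊆ cell K := fun K hK =>
    exists_ball_subset_cell hd (hT.card K (hT' K hK).1) (hT.indep K (hT' K hK).1) hκ
      (hch K (hT' K hK).1)
  have hmeas : ∀ K ∈ T', MeasurableSet (Q K) := fun K _ =>
    (isOpen_interior.preimage (by fun_prop)).measurableSet
  have hdisj : (T' : Set (Finset (E d))).PairwiseDisjoint Q := by
    intro K hK K' hK' hne
    refine disjoint_left.2 fun y hy hy' => ?_
    have hshrink : ∀ K ∈ T', y ∈ Q K → ∀ s, 0 < s → s ≤ Metric.diam (cell K) →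
        v + s • y ∈ interior (cell K) := by
      intro K hK hy s hs hsd
      have hD := (hball K hK).1
      have := (convex_cell K).add_smul_sub_mem_interior (hT' K hK).2 hy
        (t := s / Metric.diam (cell K)) ⟨by positivity, (div_le_one hD).2 hsd⟩
      simpa [smul_smul, div_mul_cancel₀ _ hD.ne'] using this
    have hs := lt_min (hball K hK).1 (hball K' hK').1
    exact disjoint_left.1 (hT.interior_disjoint (hT' K hK).1 (hT' K' hK').1 hne)
      (hshrink K hK hy _ hs (min_le_left _ _)) (hshrink K' hK' hy' _ hs (min_le_right _ _))
  have hsub : ⋃ K ∈ T', Q K ⊆ Metric.closedBall 0 1 := by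
    refine iUnion₂_subset fun K hK y hy => ?_
    have hD := (hball K hK).1
    have := Metric.dist_le_diam_of_mem (isCompact_cell K).isBounded (interior_subset hy)
      (hT' K hK).2
    rw [dist_eq_norm, add_sub_cancel_left, norm_smul, Real.norm_of_nonneg hD.le] at this
    rw [mem_closedBall_zero_iff]
    exact le_of_mul_le_mul_left (by linarith) hD
  have hbig : ∀ K ∈ T', ENNReal.ofReal ((2 * κ)⁻¹ ^ d) * volume (Metric.ball (0 : E d) 1) ≤
      volume (Q K) := by
    intro K hK
    obtain ⟨hD, x, hx⟩ := hball K hK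
    rw [← volume_ball_smul ((Metric.diam (cell K))⁻¹ • (x - v)) 0 one_pos (by positivity), mul_one]
    refine measure_mono fun y hy => ?_
    have hx' := interior_maximal hx Metric.isOpen_ball
    refine hx' ?_
    rw [mem_ball_iff_norm] at hy ⊢
    have e : v + Metric.diam (cell K) • y - x =
        Metric.diam (cell K) • (y - (Metric.diam (cell K))⁻¹ • (x - v)) := by
      rw [smul_sub, smul_smul, mul_inv_cancel₀ hD.ne', one_smul]; abel
    rw [e, norm_smul, Real.norm_of_nonneg hD.le, mul_comm]
    exact mul_lt_mul_of_pos_right hy hD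
  have hV0 : volume (Metric.ball (0 : E d) 1) ≠ 0 := (Metric.measure_ball_pos _ _ one_pos).ne'
  have hV1 : volume (Metric.ball (0 : E d) 1) ≠ ⊤ := measure_ball_lt_top.ne
  have : Nontrivial (E d) := by
    have : Nonempty (Fin d) := ⟨⟨0, hd⟩⟩
    infer_instance
  have tot : (T'.card : ℝ≥0∞) * (ENNReal.ofReal ((2 * κ)⁻¹ ^ d) *
      volume (Metric.ball (0 : E d) 1)) ≤ volume (Metric.ball (0 : E d) 1) := by
    calc _ = ∑ K ∈ T', ENNReal.ofReal ((2 * κ)⁻¹ ^ d) * volume (Metric.ball (0 : E d) 1) := by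
          rw [Finset.sum_const, nsmul_eq_mul]
      _ ≤ ∑ K ∈ T', volume (Q K) := Finset.sum_le_sum hbig
      _ = volume (⋃ K ∈ T', Q K) := (measure_biUnion_finset hdisj hmeas).symm
      _ ≤ volume (Metric.closedBall (0 : E d) 1) := measure_mono hsub
      _ = _ := Measure.addHaar_closedBall_eq_addHaar_ball volume 0 1
  rw [← mul_assoc] at tot
  have tot2 : (T'.card : ℝ≥0∞) * ENNReal.ofReal ((2 * κ)⁻¹ ^ d) ≤ 1 := by
    rw [← ENNReal.mul_le_mul_iff_left hV0 hV1, one_mul]; exact tot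
  rw [← ENNReal.ofReal_natCast, ← ENNReal.ofReal_mul (by positivity),
    ENNReal.ofReal_le_one, inv_pow, ← div_eq_mul_inv, div_le_one (by positivity)] at tot2
  exact tot2

theorem IsTriangulation.cell_ae_le (hΩ : IsPolyhedralLipschitzDomain Ω)
    (hT : IsTriangulation Ω T) {K : Finset (E d)} (hK : K ∈ T) : cell K ≤ᵐ[volume] Ω := by
  have h : cell K ≤ closure Ω := by
    rw [← hT.cover]
    exact subset_biUnion_of_mem (u := fun K => cell K) hK
  exact h.eventuallyLE.trans hΩ.closure_ae_le

theorem patch_subset_closure (hT : IsTriangulation Ω T) (K : Finset (E d)) :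
    patch T K ≤ closure Ω := by
  rw [← hT.cover]
  exact biUnion_mono (fun K' hK' => hK'.1) fun _ _ => le_rfl

theorem isClosed_patch (T : Finset (Finset (E d))) (K : Finset (E d)) : IsClosed (patch T K) :=
  (T.finite_toSet.subset (sep_subset _ _)).isClosed_biUnion fun K' _ => (isCompact_cell K').isClosed

theorem cell_nonempty {K : Finset (E d)} (hcard : K.card = d + 1) : (cell K).Nonempty := by
  have : K.Nonempty := Finset.card_pos.1 (by omega)
  simpa [cell] using this

theorem cell_subset_patch (hT : IsTriangulation Ω T) {K : Finset (E d)} (hK : K ∈ T) :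
    cell K ⊆ patch T K :=
  subset_biUnion_of_mem (u := fun K => cell K)
    (show K ∈ {K' ∈ (T : Set (Finset (E d))) | (cell K' ∩ cell K).Nonempty} from
      ⟨hK, by rw [inter_self]; exact cell_nonempty (hT.card K hK)⟩)

theorem exists_two_pow_volume (d : ℕ) {c : ℝ} (hc : 0 < c) :
    ∃ m : ℕ, ∀ (x y : E d) (r : ℝ), 0 < r →
      volume (Metric.ball x (c * r)) ≤ 2 ^ m * volume (Metric.ball y r) := by
  obtain ⟨m, hm⟩ := exists_le_two_pow (c ^ d)
  refine ⟨m, fun x y r hr => ?_⟩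
  rw [volume_ball_smul x y hr hc]
  gcongr

theorem exists_isStableCover_cell (hd : 0 < d) {κ : ℝ} (hκ : 0 < κ) :
    ∃ m : ℕ, ∀ {Ω : Set (E d)} {T : Finset (Finset (E d))}, IsPolyhedralLipschitzDomain Ω →
      IsTriangulation Ω T → (∀ K ∈ T, chunkiness K ≤ κ) →
      IsStableCover Ω T cell cell (meshSize T) m 1 := by
  obtain ⟨m, hm⟩ := exists_two_pow_volume d (c := 2 * (2 * κ)) (by positivity)
  refine ⟨m, fun {Ω T} hΩ hT hch => ?_⟩
  constructor
  · exact fun K _ => (isCompact_cell K).measurableSet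
  · exact fun K _ => (isCompact_cell K).measurableSet
  · exact fun K _ => le_rfl
  · rw [hT.cover]; exact subset_closure
  · exact fun K hK => hT.cell_ae_le hΩ hK
  · intro K hK
    obtain ⟨hD, x, hx⟩ := exists_ball_subset_cell hd (hT.card K hK) (hT.indep K hK) hκ (hch K hK)
    have hr : 0 < (2 * κ)⁻¹ * Metric.diam (cell K) := by positivity
    have hxK : x ∈ cell K := hx (Metric.mem_ball_self hr)
    refine ⟨x, 2 * (2 * κ) * ((2 * κ)⁻¹ * Metric.diam (cell K)), by positivity, fun y hy => ?_,
      (hm x x _ hr).trans (by gcongr)⟩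
    have := Metric.dist_le_diam_of_mem (isCompact_cell K).isBounded hy hxK
    rw [Metric.mem_ball, mul_assoc 2, mul_inv_cancel_left₀ (by positivity)]
    linarith
  · intro K hK x hx y hy
    have := Metric.dist_le_diam_of_mem (isCompact_cell K).isBounded hx hy
    have h2 := IsTriangulation.diam_le T hK
    have h3 : 0 ≤ Metric.diam (cell K) := Metric.diam_nonneg
    linarith
  · classical
    filter_upwards [hT.ae_unique] with x hx
    calc ∑ K ∈ T, (cell K).indicator (fun _ => (1 : ℝ≥0∞)) x
        = ((T.filter fun K => x ∈ cell K).card : ℝ≥0∞) := by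
          simp [Set.indicator_apply]
      _ ≤ _ := by
          refine Nat.cast_le.2 (Finset.card_le_one.2 fun K hK K' hK' => ?_)
          rw [Finset.mem_filter] at hK hK'
          exact hx K hK.1 K' hK'.1 hK.2 hK'.2

/-- For almost every x only one simplex K₀ contains x. By conformity, any K whose patch contains x
shares a vertex with K₀, and the vertex count bounds the number of such K. -/
theorem exists_isStableCover_patch (hd : 0 < d) {κ : ℝ} (hκ : 0 < κ) :
    ∃ m N : ℕ, ∀ {Ω : Set (E d)} {T : Finset (Finset (E d))}, IsPolyhedralLipschitzDomain Ω →
      IsTriangulation Ω T → (∀ K ∈ T, chunkiness K ≤ κ) →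
      IsStableCover Ω T cell (patch T) (meshSize T) m N := by
  obtain ⟨m, hm⟩ := exists_two_pow_volume d (c := 3 * (2 * κ)) (by positivity)
  refine ⟨m, (d + 1) * ⌈(2 * κ) ^ d⌉₊, fun {Ω T} hΩ hT hch => ?_⟩
  have hmem : ∀ {K x}, x ∈ patch T K ↔
      ∃ K' ∈ T, (cell K' ∩ cell K).Nonempty ∧ x ∈ cell K' := by
    intro K x
    simp only [patch, mem_iUnion₂, mem_ofPred_eq, Finset.mem_coe, exists_prop, and_assoc]
  constructor
  · exact fun K _ => (isClosed_patch T K).measurableSet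
  · exact fun K _ => (isCompact_cell K).measurableSet
  · exact fun K hK => cell_subset_patch hT hK
  · rw [hT.cover]; exact subset_closure
  · exact fun K _ => (patch_subset_closure hT K).eventuallyLE.trans hΩ.closure_ae_le
  · classical
    intro K hK
    -- The largest simplex of the patch already fills a fixed portion of a ball around the whole
    -- patch.
    obtain ⟨K₀, hK₀, hmax⟩ := (T.filter fun K' => (cell K' ∩ cell K).Nonempty).exists_max_image
      (fun K' => Metric.diam (cell K'))
      ⟨K, Finset.mem_filter.2 ⟨hK, by rw [inter_self]; exact cell_nonempty (hT.card K hK)⟩⟩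
    rw [Finset.mem_filter] at hK₀
    obtain ⟨hD, x, hx⟩ := exists_ball_subset_cell hd (hT.card K₀ hK₀.1) (hT.indep K₀ hK₀.1) hκ
      (hch K₀ hK₀.1)
    have hr : 0 < (2 * κ)⁻¹ * Metric.diam (cell K₀) := by positivity
    obtain ⟨b, hb⟩ := cell_nonempty (hT.card K hK)
    refine ⟨b, 3 * (2 * κ) * ((2 * κ)⁻¹ * Metric.diam (cell K₀)), by positivity, fun y hy => ?_,
      (hm b x _ hr).trans ?_⟩
    · obtain ⟨K', hK', ⟨p, hp'⟩, hy'⟩ := hmem.1 hy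
      have h1 := Metric.dist_le_diam_of_mem (isCompact_cell K').isBounded hy' hp'.1
      have h2 := Metric.dist_le_diam_of_mem (isCompact_cell K).isBounded hp'.2 hb
      have h3 := hmax K' (Finset.mem_filter.2 ⟨hK', p, hp'⟩)
      have h4 := hmax K (Finset.mem_filter.2 ⟨hK, b, hb, hb⟩)
      have := dist_triangle y p b
      rw [Metric.mem_ball, mul_assoc 3, mul_inv_cancel_left₀ (by positivity)]
      linarith
    · gcongr
      exact hx.trans fun y hy => hmem.2 ⟨K₀, hK₀.1, hK₀.2, hy⟩
  · intro K hK x hx y hy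
    obtain ⟨K₁, hK₁, ⟨p, hp⟩, hx⟩ := hmem.1 hx
    obtain ⟨K₂, hK₂, ⟨q, hq⟩, hy⟩ := hmem.1 hy
    have h1 := Metric.dist_le_diam_of_mem (isCompact_cell K₁).isBounded hx hp.1
    have h2 := Metric.dist_le_diam_of_mem (isCompact_cell K).isBounded hp.2 hq.2
    have h3 := Metric.dist_le_diam_of_mem (isCompact_cell K₂).isBounded hq.1 hy
    have := dist_triangle4 x p q y
    have := IsTriangulation.diam_le T hK
    have := IsTriangulation.diam_le T hK₁
    have := IsTriangulation.diam_le T hK₂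
    linarith
  · classical
    filter_upwards [hT.ae_unique] with x hx
    calc ∑ K ∈ T, (patch T K).indicator (fun _ => (1 : ℝ≥0∞)) x
        = ((T.filter fun K => x ∈ patch T K).card : ℝ≥0∞) := by
          simp [Set.indicator_apply]
      _ ≤ _ := by
          refine Nat.cast_le.2 ?_
          by_cases hxT : ∃ K₀ ∈ T, x ∈ cell K₀
          · obtain ⟨K₀, hK₀, hxK₀⟩ := hxT
            have hsub : (T.filter fun K => x ∈ patch T K) ⊆
                K₀.biUnion fun v => T.filter fun K => v ∈ K := by
              intro K hK
              rw [Finset.mem_filter] at hK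
              obtain ⟨K', hK', hne, hxK'⟩ := hmem.1 hK.2
              obtain rfl := hx K₀ hK₀ K' hK' hxK₀ hxK'
              rw [hT.conforming K₀ hK₀ K hK.1, convexHull_nonempty_iff] at hne
              obtain ⟨v, hv₀, hv⟩ := hne
              exact Finset.mem_biUnion.2 ⟨v, hv₀, Finset.mem_filter.2 ⟨hK.1, hv⟩⟩
            refine (Finset.card_le_card hsub).trans ?_
            rw [← hT.card K₀ hK₀]
            refine Finset.card_biUnion_le_card_mul _ _ _ fun v _ => ?_
            exact_mod_cast (hT.card_vertex_le hd hκ hch v).trans (Nat.le_ceil _)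
          · rw [Finset.filter_eq_empty_iff.2 fun K _ hxK => hxT ?_]
            · simp
            · obtain ⟨K', hK', -, hxK'⟩ := hmem.1 hxK
              exact ⟨K', hK', hxK'⟩

end triangulation

/-! ### Inverse estimates and stability on constants -/

theorem measurable_mvPolynomial_eval {d : ℕ} (P : MvPolynomial (Fin d) ℝ) :
    Measurable fun x : E d => MvPolynomial.eval (fun i => x i) P :=
  ((MvPolynomial.continuous_eval P).comp
    (by fun_prop : Continuous fun x : E d => fun i => x i)).measurable

/-- Extrapolation of polynomials of degree at most `k` along a segment. -/
theorem exists_extrapolation (k : ℕ) : ∃ lam : ℕ → ℝ, ∀ {d : ℕ} (P : MvPolynomial (Fin d) ℝ),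
    P.totalDegree ≤ k → ∀ x y : E d, MvPolynomial.eval (fun i => x i) P =
      ∑ j ∈ Finset.range (k + 1), MvPolynomial.eval
        (fun i => (x + ((j : ℝ) + 1)⁻¹ • (y - x)) i) P * lam j := by
  -- The nodes 1/(j+1) lie in (0,1]: convexity keeps the sample points in the set, and none
  -- degenerates to x, so the later change of variables is possible.
  set v : ℕ → ℝ := fun j => ((j : ℝ) + 1)⁻¹
  have hv : InjOn v (Finset.range (k + 1)) := fun i _ j _ hij => by
    simpa [v] using hij
  refine ⟨fun j => (Lagrange.basis (Finset.range (k + 1)) v j).eval 0, fun {d} P hP x y => ?_⟩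
  set p : Polynomial ℝ := MvPolynomial.aeval
    (fun i => Polynomial.C (x i) + Polynomial.X * Polynomial.C (y i - x i)) P with hp
  have heval : ∀ t : ℝ, p.eval t = MvPolynomial.eval (fun i => (x + t • (y - x)) i) P := by
    intro t
    rw [hp]
    clear_value p
    clear hp hP
    induction P using MvPolynomial.induction_on with
    | C a => simp
    | add P Q hP hQ => simp only [map_add, Polynomial.eval_add, hP, hQ]
    | mul_X P i hP => simp only [map_mul, Polynomial.eval_mul, hP, MvPolynomial.aeval_X]; simp
  have hdeg : p.degree < (Finset.range (k + 1)).card := by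
    rw [Finset.card_range]
    refine (Polynomial.degree_le_of_natDegree_le (n := k) ?_).trans_lt
      (by exact_mod_cast Nat.lt_succ_self k)
    rw [← mul_one k]
    refine MvPolynomial.aeval_natDegree_le P hP _ fun i => ?_
    compute_degree
  have h0 := congrArg (Polynomial.eval 0) (Lagrange.eq_interpolate hv hdeg)
  rw [heval, Lagrange.interpolate_apply, Polynomial.eval_finsetSum] at h0
  simp only [Polynomial.eval_mul, Polynomial.eval_C, heval, zero_smul, add_zero] at h0
  exact h0

/-- Polynomials on a convex set are bounded by their means over balls contained in it. -/
theorem exists_inverse_estimate (d k : ℕ) : ∃ c : ℝ≥0∞, c ≠ ⊤ ∧ ∀ P : MvPolynomial (Fin d) ℝ,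
    P.totalDegree ≤ k → ∀ S : Set (E d), MeasurableSet S → Convex ℝ S → ∀ (b : E d) (ρ : ℝ),
      Metric.ball b ρ ⊆ S → ∀ x ∈ S, ‖MvPolynomial.eval (fun i => x i) P‖ₑ *
        volume (Metric.ball b ρ) ≤ c * ∫⁻ y in S, ‖MvPolynomial.eval (fun i => y i) P‖ₑ := by
  obtain ⟨lam, hlam⟩ := exists_extrapolation k
  refine ⟨∑ j ∈ Finset.range (k + 1), ENNReal.ofReal ((((j : ℝ) + 1)⁻¹) ^ d)⁻¹ * ‖lam j‖ₑ,
    ENNReal.sum_ne_top.2 fun j _ => ENNReal.mul_ne_top ENNReal.ofReal_ne_top (by simp), ?_⟩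
  intro P hP S hSm hS b ρ hbS x hx
  set f : E d → ℝ≥0∞ := fun y => ‖MvPolynomial.eval (fun i => y i) P‖ₑ
  have hf : Measurable f := (measurable_mvPolynomial_eval P).enorm
  have hfS : Measurable (S.indicator f) := hf.indicator hSm
  have hm : ∀ j : ℕ, Measurable fun y =>
      S.indicator f (x + ((j : ℝ) + 1)⁻¹ • (y - x)) * ‖lam j‖ₑ := fun j =>
    (hfS.comp (by fun_prop : Measurable fun y => x + ((j : ℝ) + 1)⁻¹ • (y - x))).mul_const _
  rw [← setLIntegral_const]
  calc ∫⁻ y in Metric.ball b ρ, f x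
      ≤ ∫⁻ y in Metric.ball b ρ, ∑ j ∈ Finset.range (k + 1),
          S.indicator f (x + ((j : ℝ) + 1)⁻¹ • (y - x)) * ‖lam j‖ₑ := by
        refine setLIntegral_mono' Metric.isOpen_ball.measurableSet fun y hy => ?_
        simp only [f]
        rw [hlam P hP x y]
        refine (enorm_sum_le _ _).trans (Finset.sum_le_sum fun j _ => ?_)
        have hj : ((j : ℝ) + 1)⁻¹ ≤ 1 := inv_le_one_of_one_le₀ (by linarith [j.cast_nonneg (α := ℝ)])
        rw [indicator_of_mem (hS.add_smul_sub_mem hx (hbS hy) ⟨by positivity, hj⟩), enorm_mul]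
    _ ≤ ∫⁻ y, ∑ j ∈ Finset.range (k + 1),
          S.indicator f (x + ((j : ℝ) + 1)⁻¹ • (y - x)) * ‖lam j‖ₑ := setLIntegral_le_lintegral _ _
    -- Each sample point is a homothetic image of y about x, so its term integrates to (j+1)^d |λ_j|
    -- times the L¹-norm over S. No reference simplex is involved.
    _ = _ := by
        rw [lintegral_finsetSum _ fun j _ => hm j, Finset.sum_mul]
        refine Finset.sum_congr rfl fun j _ => ?_
        rw [lintegral_mul_const' _ _ (by simp),
          lintegral_comp_homothety (by positivity) x x hfS, lintegral_indicator hSm]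
        ring

section

variable {d : ℕ} {Ω : Set (E d)} {T : Finset (Finset (E d))} {q : ℝ≥0∞}

theorem restrict_restrict_of_ae_le {S : Set (E d)} (hS : MeasurableSet S)
    (h : S ≤ᵐ[volume] Ω) : (volume.restrict Ω).restrict S = volume.restrict S := by
  rw [Measure.restrict_restrict hS]
  refine Measure.restrict_congr_set ?_
  filter_upwards [h] with x hx
  exact propext ⟨fun hxS => hxS.1, fun hxS => ⟨hxS, hx hxS⟩⟩

/-- Bounded chunkiness makes the volume of the cell comparable to that of an inscribed ball, which
turns the inverse estimate into a bound by the mean. -/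
theorem exists_le_average_cell (hd : 0 < d) (k : ℕ) {κ : ℝ} (hκ : 0 < κ) :
    ∃ l : ℕ, ∀ {Ω : Set (E d)} {T : Finset (Finset (E d))} {q : ℝ≥0∞},
      IsPolyhedralLipschitzDomain Ω → IsTriangulation Ω T → (∀ K ∈ T, chunkiness K ≤ κ) →
      ∀ w ∈ Qhk Ω T k q, ∀ K ∈ T, ∀ᵐ x, x ∈ Ω → x ∈ cell K →
        ‖w x‖ₑ ≤ 2 ^ l * ⨍⁻ y in cell K, ‖w y‖ₑ ∂volume := by
  obtain ⟨c, hc, hinv⟩ := exists_inverse_estimate d k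
  obtain ⟨m₁, hm₁⟩ := exists_two_pow_volume d (c := 2 * (2 * κ)) (by positivity)
  obtain ⟨m₂, hm₂⟩ := exists_le_two_pow' hc
  refine ⟨m₁ + m₂, fun {Ω T q} hΩ hT hch w hw K hK => ?_⟩
  obtain ⟨P, hP, hPw⟩ := hw K hK
  obtain ⟨hD, b, hb⟩ := exists_ball_subset_cell hd (hT.card K hK) (hT.indep K hK) hκ (hch K hK)
  set D := Metric.diam (cell K)
  have hr : 0 < (2 * κ)⁻¹ * D := by positivity
  have hKm : MeasurableSet (cell K) := (isCompact_cell K).measurableSet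
  have hKΩ := hT.cell_ae_le hΩ hK
  have hbK : b ∈ cell K := hb (Metric.mem_ball_self hr)
  have hvol : volume (cell K) ≤ 2 ^ m₁ * volume (Metric.ball b ((2 * κ)⁻¹ * D)) := by
    refine (measure_mono fun y hy => ?_).trans (hm₁ b b _ hr)
    have := Metric.dist_le_diam_of_mem (isCompact_cell K).isBounded hy hbK
    rw [Metric.mem_ball, mul_assoc 2, mul_inv_cancel_left₀ (by positivity)]
    linarith
  have hV0 : volume (cell K) ≠ 0 :=
    ((Metric.measure_ball_pos volume b hr).trans_le (measure_mono hb)).ne'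
  have hV1 : volume (cell K) ≠ ⊤ := (isCompact_cell K).measure_lt_top.ne
  have hint : ∫⁻ y in cell K, ‖w y‖ₑ =
      ∫⁻ y in cell K, ‖MvPolynomial.eval (fun i => y i) P‖ₑ := by
    refine lintegral_congr_ae ?_
    have := ae_mono (Measure.restrict_mono_ae hKΩ) hPw
    filter_upwards [this, ae_restrict_mem hKm] with y hy hyK
    rw [hy hyK]
  filter_upwards [ae_imp_of_ae_restrict hPw] with x hx hxΩ hxK
  rw [setLAverage_eq, hint, hx hxΩ hxK, ← mul_div_assoc, ENNReal.le_div_iff_mul_le (Or.inl hV0)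
    (Or.inl hV1)]
  calc _ ≤ ‖MvPolynomial.eval (fun i => x i) P‖ₑ *
        (2 ^ m₁ * volume (Metric.ball b ((2 * κ)⁻¹ * D))) := by gcongr
    _ = 2 ^ m₁ * (‖MvPolynomial.eval (fun i => x i) P‖ₑ *
        volume (Metric.ball b ((2 * κ)⁻¹ * D))) := by ring
    _ ≤ 2 ^ m₁ * (c * ∫⁻ y in cell K, ‖MvPolynomial.eval (fun i => y i) P‖ₑ) :=
        mul_le_mul_right (hinv P hP (cell K) hKm (convex_cell K) b _ hb x hxK) _
    _ ≤ 2 ^ m₁ * (2 ^ m₂ * ∫⁻ y in cell K, ‖MvPolynomial.eval (fun i => y i) P‖ₑ) := by gcongr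
    _ = _ := by rw [pow_add]; ring

theorem ofReal_setAverage_abs {S : Set (E d)} (hS : MeasurableSet S) (hSΩ : S ≤ᵐ[volume] Ω)
    {f : E d → ℝ} (hf : IntegrableOn f Ω) :
    ENNReal.ofReal (⨍ x in S, |f x| ∂(volume.restrict Ω)) = ⨍⁻ x in S, ‖f x‖ₑ ∂volume := by
  have hfS : IntegrableOn f S := Integrable.mono_measure hf (Measure.restrict_mono_ae hSΩ)
  rw [restrict_restrict_of_ae_le hS hSΩ, ofReal_average hfS.abs
    (Filter.Eventually.of_forall fun x => abs_nonneg _), laverage_eq]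
  simp only [← Real.norm_eq_abs, ofReal_norm]

theorem const_mem_Qhk (hq : IsFiniteMeasure (volume.restrict Ω)) (k : ℕ) (s : ℝ) :
    Lp.const q (volume.restrict Ω) s ∈ Qhk Ω T k q := by
  intro K _
  refine ⟨MvPolynomial.C s, by simp, ?_⟩
  filter_upwards [Lp.coeFn_const q (volume.restrict Ω) s] with x hx _
  rw [hx]; simp

/-- Constants are piecewise polynomials, so the projection commutes with subtracting s, and
L¹-stability applies to z - s. The inverse estimate upgrades the mean over the cell to a pointwise
bound. -/
theorem exists_isProj_le (hd : 0 < d) (k : ℕ) {κ : ℝ} (hκ : 0 < κ) (C : ℝ) :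
    ∃ l : ℕ, ∀ {Ω : Set (E d)} {T : Finset (Finset (E d))} {q : ℝ≥0∞}, 1 ≤ q →
      IsPolyhedralLipschitzDomain Ω → IsTriangulation Ω T → (∀ K ∈ T, chunkiness K ≤ κ) →
      ∀ P : Lp ℝ q (volume.restrict Ω) →ₗ[ℝ] Lp ℝ q (volume.restrict Ω),
        LinearMap.IsProj (Qhk Ω T k q) P → LocallyL1Stable Ω T q C P →
        ∀ (z : Lp ℝ q (volume.restrict Ω)) (s : ℝ), ∀ K ∈ T, ∀ᵐ x, x ∈ Ω → x ∈ cell K →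
          ‖P z x - s‖ₑ ≤ 2 ^ l * ⨍⁻ y in patch T K, ‖z y - s‖ₑ ∂volume := by
  obtain ⟨l₁, hl₁⟩ := exists_le_average_cell hd k hκ
  obtain ⟨l₂, hl₂⟩ := exists_le_two_pow C
  refine ⟨l₁ + l₂, fun {Ω T q} hq hΩ hT hch P hP hstab z s K hK => ?_⟩
  have hfin : IsFiniteMeasure (volume.restrict Ω) :=
    ⟨by rw [Measure.restrict_apply_univ]; exact hΩ.isBounded.measure_lt_top⟩
  set S := Lp.const q (volume.restrict Ω) s
  have hS : S ∈ Qhk Ω T k q := const_mem_Qhk hfin k s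
  have hPS : P (z - S) = P z - S := by rw [map_sub, hP.map_id S hS]
  have hint : ∀ f : Lp ℝ q (volume.restrict Ω), IntegrableOn f Ω := fun f =>
    (Lp.memLp f).integrable hq
  have hKm : MeasurableSet (cell K) := (isCompact_cell K).measurableSet
  have hpm : MeasurableSet (patch T K) := (isClosed_patch T K).measurableSet
  have hKΩ := hT.cell_ae_le hΩ hK
  have hpΩ : patch T K ≤ᵐ[volume] Ω :=
    (patch_subset_closure hT K).eventuallyLE.trans hΩ.closure_ae_le
  have hst : ⨍⁻ y in cell K, ‖P (z - S) y‖ₑ ∂volume ≤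
      2 ^ l₂ * ⨍⁻ y in patch T K, ‖z y - s‖ₑ ∂volume := by
    have hzs : ∫⁻ y in patch T K, ‖z y - s‖ₑ = ∫⁻ y in patch T K, ‖(z - S) y‖ₑ := by
      refine lintegral_congr_ae ?_
      filter_upwards [ae_mono (Measure.restrict_mono_ae hpΩ) (Lp.coeFn_sub z S),
        ae_mono (Measure.restrict_mono_ae hpΩ) (Lp.coeFn_const q (volume.restrict Ω) s)]
        with y hy hy2
      rw [hy, Pi.sub_apply, hy2]; rfl
    rw [setLAverage_eq _ _ (patch T K), hzs, ← setLAverage_eq,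
      ← ofReal_setAverage_abs hKm hKΩ (hint _), ← ofReal_setAverage_abs hpm hpΩ (hint _)]
    refine (ENNReal.ofReal_le_ofReal (hstab (z - S) K hK)).trans ?_
    rw [ENNReal.ofReal_mul' (by
      rw [average_eq]
      exact smul_nonneg (by positivity) (integral_nonneg fun x => abs_nonneg _))]
    gcongr
  filter_upwards [hl₁ hΩ hT hch _ (hP.map_mem (z - S)) K hK,
    ae_imp_of_ae_restrict (Lp.coeFn_sub (P z) S),
    ae_imp_of_ae_restrict (Lp.coeFn_const q (volume.restrict Ω) s)] with x hx h1 h2 hxΩ hxK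
  have e : P z x - s = P (z - S) x := by
    rw [hPS, h1 hxΩ, Pi.sub_apply, h2 hxΩ]; rfl
  rw [e]
  refine (hx hxΩ hxK).trans ?_
  rw [pow_add, mul_assoc]
  gcongr

/-! ### Piecewise means -/

/-- The piecewise means. -/
noncomputable def pieceMean (T : Finset (Finset (E d))) (z : E d → ℝ) (x : E d) : ℝ :=
  ∑ K ∈ T, (cell K).indicator (fun _ => ⨍ y in cell K, z y ∂volume) x

theorem memLp_pieceMean (hfin : IsFiniteMeasure (volume.restrict Ω)) (z : E d → ℝ) :
    MemLp (pieceMean T z) q (volume.restrict Ω) :=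
  memLp_finsetSum _ fun K _ => (memLp_const _).indicator (isCompact_cell K).measurableSet

theorem IsTriangulation.ae_sum_indicator (hT : IsTriangulation Ω T) :
    ∀ᵐ x, ∀ K ∈ T, x ∈ cell K → ∀ f : Finset (E d) → E d → ℝ,
      ∑ K' ∈ T, (cell K').indicator (f K') x = f K x := by
  filter_upwards [hT.ae_unique] with x hx K hK hxK f
  rw [Finset.sum_eq_single K]
  · exact indicator_of_mem hxK _
  · intro K' hK' hne
    exact indicator_of_notMem (fun h => hne (hx K' hK' K hK h hxK)) _
  · exact fun h => absurd hK h

theorem pieceMean_mem_Qhk (hT : IsTriangulation Ω T) (hfin : IsFiniteMeasure (volume.restrict Ω))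
    (z : E d → ℝ) (k : ℕ) : (memLp_pieceMean (T := T) hfin z).toLp (pieceMean T z) ∈ Qhk Ω T k q := by
  intro K hK
  refine ⟨MvPolynomial.C (⨍ y in cell K, z y ∂volume), by simp, ?_⟩
  filter_upwards [(memLp_pieceMean (T := T) (q := q) hfin z).coeFn_toLp,
    ae_restrict_of_ae hT.ae_sum_indicator] with x hx h2 hxK
  rw [hx, pieceMean, h2 K hK hxK fun K _ => ⨍ y in cell K, z y ∂volume]
  simp

/-- Preservation of the total integral is what makes the piecewise means of a mean-free function
admissible competitors in (ii). -/
theorem integral_pieceMean (hΩ : IsPolyhedralLipschitzDomain Ω) (hT : IsTriangulation Ω T)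
    {z : E d → ℝ} (hz : IntegrableOn z Ω) :
    ∫ x in Ω, pieceMean T z x = ∫ x in Ω, z x := by
  have hfin : IsFiniteMeasure (volume.restrict Ω) :=
    ⟨by rw [Measure.restrict_apply_univ]; exact hΩ.isBounded.measure_lt_top⟩
  have hm : ∀ K : Finset (E d), MeasurableSet (cell K) := fun K => (isCompact_cell K).measurableSet
  have e : ∫ x in Ω, z x = ∫ x in Ω, ∑ K ∈ T, (cell K).indicator z x := by
    refine integral_congr_ae ?_
    filter_upwards [ae_restrict_of_ae hT.ae_sum_indicator,
      ae_restrict_mem hΩ.isOpen.measurableSet] with x hx hxΩ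
    have : x ∈ ⋃ K ∈ T, cell K := by rw [hT.cover]; exact subset_closure hxΩ
    obtain ⟨K, hK, hxK⟩ := mem_iUnion₂.1 this
    exact (hx K hK hxK fun _ => z).symm
  rw [e]
  unfold pieceMean
  rw [integral_finsetSum _ fun K _ => (integrable_const _).indicator (hm K),
    integral_finsetSum _ fun K _ => hz.indicator (hm K)]
  refine Finset.sum_congr rfl fun K hK => ?_
  rw [integral_indicator (hm K), integral_indicator (hm K),
    restrict_restrict_of_ae_le (hm K) (hT.cell_ae_le hΩ hK), setIntegral_const]
  exact measure_smul_setAverage z (isCompact_cell K).measure_lt_top.ne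

theorem pieceMean_sub_le (hΩ : IsPolyhedralLipschitzDomain Ω)
    (hT : IsTriangulation Ω T) {z : E d → ℝ} (hz : IntegrableOn z Ω) (s : ℝ) {K : Finset (E d)}
    (hK : K ∈ T) : ∀ᵐ x, x ∈ cell K →
      ‖pieceMean T z x - s‖ₑ ≤ ⨍⁻ y in cell K, ‖z y - s‖ₑ ∂volume := by
  obtain ⟨p, hp⟩ := interior_cell_nonempty (hT.card K hK) (hT.indep K hK)
  have hV0 : volume (cell K) ≠ 0 :=
    ((isOpen_interior.measure_pos volume ⟨p, hp⟩).trans_le (measure_mono interior_subset)).ne'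
  filter_upwards [hT.ae_sum_indicator] with x hx hxK
  rw [pieceMean, hx K hK hxK fun K _ => ⨍ y in cell K, z y ∂volume, enorm_sub_rev]
  refine (enorm_sub_setAverage_le (Integrable.mono_measure hz
    (Measure.restrict_mono_ae (hT.cell_ae_le hΩ hK))) hV0 (isCompact_cell K).measure_lt_top.ne s).trans (le_of_eq ?_)
  rw [setLAverage_eq, ENNReal.div_eq_inv_mul]
  simp_rw [enorm_sub_rev s]

end

/-! ### Conjugates of the N-functions -/

/-- The convex conjugate as a function on `[0, ∞]`. -/
noncomputable def conjExt (ψ : ℝ → ℝ) (t : ℝ≥0∞) : ℝ≥0∞ :=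
  ⨆ (s : ℝ) (_ : 0 ≤ s), (ENNReal.ofReal s * t - ENNReal.ofReal (ψ s))

theorem conj_eq_conjExt {ψ : ℝ → ℝ} (hψ : ∀ s, 0 ≤ s → 0 ≤ ψ s) (t : ℝ) :
    conj ψ t = conjExt ψ (ENNReal.ofReal t) := by
  unfold conj conjExt
  refine iSup_congr fun s => iSup_congr fun hs => ?_
  rw [ENNReal.ofReal_sub _ (hψ s hs), ENNReal.ofReal_mul hs]

theorem conjExt_mono (ψ : ℝ → ℝ) : Monotone (conjExt ψ) := fun _ _ h =>
  iSup₂_mono fun _ _ => tsub_le_tsub_right (by gcongr) _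

/-- Jensen's inequality for the convex conjugate. -/
theorem conjExt_lintegral_le {α : Type*} [MeasurableSpace α] (P : Measure α)
    [IsProbabilityMeasure P] (ψ : ℝ → ℝ) {f : α → ℝ≥0∞} (hf : Measurable f) :
    conjExt ψ (∫⁻ x, f x ∂P) ≤ ∫⁻ x, conjExt ψ (f x) ∂P := by
  refine iSup₂_le fun s hs => ?_
  have h1 : ENNReal.ofReal (ψ s) = ∫⁻ _, ENNReal.ofReal (ψ s) ∂P := by simp
  rw [h1, ← lintegral_const_mul _ hf]
  refine (lintegral_sub_le _ _ measurable_const).trans (lintegral_mono fun x => ?_)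
  exact le_iSup₂ (f := fun (s : ℝ) (_ : 0 ≤ s) =>
    ENNReal.ofReal s * f x - ENNReal.ofReal (ψ s)) s hs

/-- The substitution s ↦ (b/c)s inside the supremum compares each term on the left with c times one
on the right. Growth of ψ thus becomes growth of its conjugate. -/
theorem conjExt_mul_le {ψ : ℝ → ℝ} {b c : ℝ} (hb : 0 ≤ b) (hc : 0 < c)
    (h : ∀ s, 0 ≤ s → c * ψ (b / c * s) ≤ ψ s) (t : ℝ≥0∞) :
    conjExt ψ (ENNReal.ofReal b * t) ≤ ENNReal.ofReal c * conjExt ψ t := by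
  refine iSup₂_le fun s hs => ?_
  have hs' : 0 ≤ b / c * s := by positivity
  calc ENNReal.ofReal s * (ENNReal.ofReal b * t) - ENNReal.ofReal (ψ s)
      ≤ ENNReal.ofReal c * (ENNReal.ofReal (b / c * s) * t) -
          ENNReal.ofReal c * ENNReal.ofReal (ψ (b / c * s)) := by
        refine tsub_le_tsub (le_of_eq ?_) ?_
        · rw [← mul_assoc, ← mul_assoc, ← ENNReal.ofReal_mul hs, ← ENNReal.ofReal_mul hc.le]
          congr 2
          field_simp
        · rw [← ENNReal.ofReal_mul hc.le]
          exact ENNReal.ofReal_le_ofReal (h s hs)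
    _ = ENNReal.ofReal c * (ENNReal.ofReal (b / c * s) * t - ENNReal.ofReal (ψ (b / c * s))) :=
        (ENNReal.mul_sub fun _ _ => ENNReal.ofReal_ne_top).symm
    _ ≤ _ := mul_le_mul_right (le_iSup₂ (f := fun (s : ℝ) (_ : 0 ≤ s) =>
        ENNReal.ofReal s * t - ENNReal.ofReal (ψ s)) _ hs') _

section phi

variable {p δ : ℝ}

theorem continuous_dphi (hp : 2 ≤ p) (δ : ℝ) : Continuous (dphi p δ) :=
  ((Real.continuous_rpow_const (by linarith)).comp (continuous_const.add continuous_id)).mul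
    continuous_id

theorem phi_nonneg (hδ : 0 ≤ δ) {t : ℝ} (ht : 0 ≤ t) : 0 ≤ phi p δ t :=
  intervalIntegral.integral_nonneg ht fun s hs =>
    mul_nonneg (Real.rpow_nonneg (by linarith [hs.1]) _) hs.1

theorem phi_mul {c : ℝ} (hc : c ≠ 0) (t : ℝ) :
    phi p δ (c * t) = ∫ s in (0 : ℝ)..t, c * dphi p δ (c * s) := by
  rw [intervalIntegral.integral_const_mul, intervalIntegral.integral_comp_mul_left _ hc, phi,
    mul_zero, smul_eq_mul, mul_inv_cancel_left₀ hc]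

theorem phi_mul_le (hp : 2 ≤ p) (hδ : 0 ≤ δ) {c : ℝ} (hc : 1 ≤ c) {t : ℝ} (ht : 0 ≤ t) :
    phi p δ (c * t) ≤ c ^ p * phi p δ t := by
  have hcont := continuous_dphi hp δ
  rw [phi_mul (by positivity), phi, ← intervalIntegral.integral_const_mul]
  refine intervalIntegral.integral_mono_on ht (Continuous.intervalIntegrable (by fun_prop) _ _)
    (Continuous.intervalIntegrable (by fun_prop) _ _) fun s hs => ?_
  have hs0 : 0 ≤ s := hs.1
  have hc0 : 0 < c := by linarith
  have e : c ^ p = c ^ (p - 2) * c ^ 2 := by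
    rw [← Real.rpow_natCast, ← Real.rpow_add hc0]; norm_num
  have h1 : (δ + c * s) ^ (p - 2) ≤ c ^ (p - 2) * (δ + s) ^ (p - 2) := by
    rw [← Real.mul_rpow hc0.le (by positivity)]
    refine Real.rpow_le_rpow (by positivity) ?_ (by linarith)
    nlinarith
  unfold dphi
  rw [e]
  calc c * ((δ + c * s) ^ (p - 2) * (c * s)) = (δ + c * s) ^ (p - 2) * (c ^ 2 * s) := by ring
    _ ≤ c ^ (p - 2) * (δ + s) ^ (p - 2) * (c ^ 2 * s) := by gcongr
    _ = _ := by ring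

theorem four_mul_phi_half_le (hp : 2 ≤ p) (hδ : 0 ≤ δ) {t : ℝ} (ht : 0 ≤ t) :
    4 * phi p δ (2 / 4 * t) ≤ phi p δ t := by
  have hcont := continuous_dphi hp δ
  have e : phi p δ t = phi p δ (2 * (2 / 4 * t)) := by congr 1; ring
  rw [e, phi_mul two_ne_zero]
  nth_rewrite 1 [phi]
  rw [← intervalIntegral.integral_const_mul]
  refine intervalIntegral.integral_mono_on (by positivity)
    (Continuous.intervalIntegrable (by fun_prop) _ _)
    (Continuous.intervalIntegrable (by fun_prop) _ _) fun s hs => ?_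
  have hs0 : 0 ≤ s := hs.1
  have h1 : (δ + s) ^ (p - 2) ≤ (δ + 2 * s) ^ (p - 2) :=
    Real.rpow_le_rpow (by positivity) (by linarith) (by linarith)
  unfold dphi
  nlinarith

theorem conjExt_phi_two_mul_le (hp : 2 ≤ p) (hδ : 0 ≤ δ) (t : ℝ≥0∞) :
    conjExt (phi p δ) (2 * t) ≤ 4 * conjExt (phi p δ) t := by
  have := conjExt_mul_le (ψ := phi p δ) (b := 2) (c := 4) (by norm_num) (by norm_num)
    (fun s hs => four_mul_phi_half_le hp hδ hs) t
  simpa using this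

/-- Here b = h and c = h^(p'), so b/c = h^(1-p') ≥ 1 because h ≤ 1. The p-growth of φ applies with
this factor, and p' + (1-p')p = 0 balances the powers. -/
theorem conjExt_phi_mul_le (hp : 2 ≤ p) (hδ : 0 ≤ δ) {h : ℝ} (hh : 0 < h) (hh1 : h ≤ 1)
    (t : ℝ≥0∞) : conjExt (phi p δ) (ENNReal.ofReal h * t) ≤
      ENNReal.ofReal (h ^ dualExp p) * conjExt (phi p δ) t := by
  refine conjExt_mul_le hh.le (Real.rpow_pos_of_pos hh _) (fun s hs => ?_) t
  have hp1 : 0 < p - 1 := by linarith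
  have e : h / h ^ dualExp p = h ^ (1 - dualExp p) := by
    rw [Real.rpow_sub hh, Real.rpow_one]
  have h1 : 1 ≤ h / h ^ dualExp p := by
    rw [e]
    refine Real.one_le_rpow_of_pos_of_le_one_of_nonpos hh hh1 ?_
    rw [dualExp, sub_nonpos, one_le_div hp1]; linarith
  calc h ^ dualExp p * phi p δ (h / h ^ dualExp p * s)
      ≤ h ^ dualExp p * ((h / h ^ dualExp p) ^ p * phi p δ s) := by
        gcongr; exact phi_mul_le hp hδ h1 hs
    _ = phi p δ s := by
        rw [e, ← Real.rpow_mul hh.le, ← mul_assoc, ← Real.rpow_add hh]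
        have : dualExp p + (1 - dualExp p) * p = 0 := by
          rw [dualExp]; field_simp; ring
        rw [this, Real.rpow_zero, one_mul]

theorem averagingPair_conjExt_phi (d : ℕ) (hp : 2 ≤ p) (hδ : 0 ≤ δ) :
    AveragingPair 1 (conjExt (phi p δ)) (volume : Measure (E d)) where
  mono := conjExt_mono _
  zero := by simp [conjExt]
  two_mul := conjExt_phi_two_mul_le hp hδ
  jensen f hf := by
    have : IsProbabilityMeasure (volume.restrict (Ioc (0 : ℝ) 1)) := ⟨by simp⟩
    exact conjExt_lintegral_le _ _ hf
  average x r hr f hf := by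
    have h0 : volume (Metric.ball x r) ≠ 0 := (Metric.measure_ball_pos volume x hr).ne'
    have h1 : volume (Metric.ball x r) ≠ ⊤ := measure_ball_lt_top.ne
    have : IsProbabilityMeasure ((volume (Metric.ball x r))⁻¹ •
        volume.restrict (Metric.ball x r)) := ⟨by
      rw [Measure.smul_apply, Measure.restrict_apply_univ, smul_eq_mul,
        ENNReal.inv_mul_cancel h0 h1]⟩
    have hJ := conjExt_lintegral_le ((volume (Metric.ball x r))⁻¹ •
      volume.restrict (Metric.ball x r)) (phi p δ) hf
    rw [lintegral_smul_measure, lintegral_smul_measure, smul_eq_mul, smul_eq_mul,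
      ← ENNReal.div_eq_inv_mul, ← setLAverage_eq] at hJ
    calc _ ≤ volume (Metric.ball x r) * ((volume (Metric.ball x r))⁻¹ *
          ∫⁻ y in Metric.ball x r, conjExt (phi p δ) (f y)) := mul_le_mul_right hJ _
      _ = _ := by rw [← mul_assoc, ENNReal.mul_inv_cancel h0 h1]
  ac := Measure.AbsolutelyContinuous.rfl
  sfinite := inferInstance

theorem phiShift_eq {a t : ℝ} (ha : 0 ≤ a) (ht : 0 ≤ t) :
    phiShift p δ a t = ∫ s in (0 : ℝ)..t, (δ + (a + s)) ^ (p - 2) * s := by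
  refine intervalIntegral.integral_congr fun s hs => ?_
  rw [uIcc_of_le ht] at hs
  simp only [dphi]
  rcases hs.1.eq_or_lt with h0 | h0
  · simp [← h0]
  · have : a + s ≠ 0 := by linarith
    field_simp

/-- The integrand of φ_a is (δ+a+s)^(p-2) s, nondecreasing in a because p ≥ 2. -/
theorem phi_le_phiShift (hp : 2 ≤ p) (hδ : 0 ≤ δ) {a t : ℝ} (ha : 0 ≤ a) (ht : 0 ≤ t) :
    phi p δ t ≤ phiShift p δ a t := by
  have hcont := continuous_dphi hp δ
  have hc2 : Continuous fun s : ℝ => (δ + (a + s)) ^ (p - 2) * s :=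
    ((Real.continuous_rpow_const (by linarith)).comp (by fun_prop)).mul continuous_id
  rw [phiShift_eq ha ht, phi]
  refine intervalIntegral.integral_mono_on ht (hcont.intervalIntegrable _ _)
    (hc2.intervalIntegrable _ _) fun s hs => ?_
  have hs0 : 0 ≤ s := hs.1
  unfold dphi
  gcongr
  linarith

theorem sq_le_phiShift (hp : 2 ≤ p) (hδ : 0 ≤ δ) {a t : ℝ} (ha : 0 ≤ a) (ht : 0 ≤ t) :
    (δ + a) ^ (p - 2) * (t ^ 2 / 2) ≤ phiShift p δ a t := by
  have hc2 : Continuous fun s : ℝ => (δ + (a + s)) ^ (p - 2) * s :=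
    ((Real.continuous_rpow_const (by linarith)).comp (by fun_prop)).mul continuous_id
  have e : (δ + a) ^ (p - 2) * (t ^ 2 / 2) = ∫ s in (0 : ℝ)..t, (δ + a) ^ (p - 2) * s := by
    rw [intervalIntegral.integral_const_mul, integral_id]; ring
  rw [phiShift_eq ha ht, e]
  refine intervalIntegral.integral_mono_on ht (Continuous.intervalIntegrable (by fun_prop) _ _)
    (hc2.intervalIntegrable _ _) fun s hs => ?_
  have hs0 : 0 ≤ s := hs.1
  gcongr
  linarith

theorem conj_phiShift_le_conj_phi (hp : 2 ≤ p) (hδ : 0 ≤ δ) {a : ℝ} (ha : 0 ≤ a) (t : ℝ) :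
    conj (phiShift p δ a) t ≤ conj (phi p δ) t :=
  iSup₂_mono fun s hs => ENNReal.ofReal_le_ofReal (by linarith [phi_le_phiShift hp hδ ha hs])

/-- With b = (δ+a)^(p-2), the conjugate is at most that of bs²/2, which is t²/(2b); the factor 1/2
is given away. -/
theorem conj_phiShift_le_sq (hp : 2 ≤ p) (hδ : 0 ≤ δ) {a : ℝ} (ha : 0 ≤ a)
    (hpos : 0 < (δ + a) ^ (p - 2)) (t : ℝ) :
    conj (phiShift p δ a) t ≤ ENNReal.ofReal (t ^ 2 * ((δ + a) ^ (p - 2))⁻¹) := by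
  refine iSup₂_le fun s hs => ENNReal.ofReal_le_ofReal ?_
  have h1 := sq_le_phiShift hp hδ ha hs
  set b := (δ + a) ^ (p - 2)
  have h2 : s * t - b * (s ^ 2 / 2) ≤ t ^ 2 * b⁻¹ := by
    rw [← div_eq_mul_inv, le_div_iff₀ hpos]
    nlinarith [sq_nonneg (s * b - t), sq_nonneg t]
  linarith

end phi

/-! ### The Muckenhoupt weight -/

section weight

theorem sq_lintegral_le {α : Type*} [MeasurableSpace α] {P : Measure α} {f σ τ : α → ℝ≥0∞}
    (hf : AEMeasurable f P) (hσ : AEMeasurable σ P) (hτ : AEMeasurable τ P)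
    (h : ∀ᵐ x ∂P, σ x * τ x = 1) :
    (∫⁻ x, f x ∂P) ^ 2 ≤ (∫⁻ x, f x ^ 2 * σ x ∂P) * ∫⁻ x, τ x ∂P := by
  have hH := ENNReal.lintegral_mul_le_Lp_mul_Lq P Real.HolderConjugate.two_two
    (f := fun x => f x * σ x ^ (1 / 2 : ℝ)) (g := fun x => τ x ^ (1 / 2 : ℝ))
    (hf.mul (hσ.pow_const _)) (hτ.pow_const _)
  have e1 : ∫⁻ x, ((fun x => f x * σ x ^ (1 / 2 : ℝ)) * fun x => τ x ^ (1 / 2 : ℝ)) x ∂P =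
      ∫⁻ x, f x ∂P := by
    refine lintegral_congr_ae ?_
    filter_upwards [h] with x hx
    simp only [Pi.mul_apply]
    rw [mul_assoc, ← ENNReal.mul_rpow_of_nonneg _ _ (by norm_num), hx, ENNReal.one_rpow, mul_one]
  have e2 : ∀ x, (f x * σ x ^ (1 / 2 : ℝ)) ^ (2 : ℝ) = f x ^ 2 * σ x := by
    intro x
    rw [ENNReal.mul_rpow_of_nonneg _ _ (by norm_num), ← ENNReal.rpow_mul]
    norm_num
  have e3 : ∀ x, (τ x ^ (1 / 2 : ℝ)) ^ (2 : ℝ) = τ x := by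
    intro x
    rw [← ENNReal.rpow_mul]; norm_num
  rw [e1] at hH
  simp_rw [e2, e3] at hH
  calc _ ≤ ((∫⁻ x, f x ^ 2 * σ x ∂P) ^ (1 / 2 : ℝ) * (∫⁻ x, τ x ∂P) ^ (1 / 2 : ℝ)) ^ 2 := by
        gcongr
    _ = _ := by
        rw [mul_pow, ← ENNReal.rpow_natCast, ← ENNReal.rpow_natCast, ← ENNReal.rpow_mul,
          ← ENNReal.rpow_mul]
        norm_num

variable {d : ℕ} {m : E d → ℝ}

theorem ofReal_inv_mul_ofReal {s : ℝ} (hs : 0 < s) :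
    ENNReal.ofReal s⁻¹ * ENNReal.ofReal s = 1 := by
  rw [← ENNReal.ofReal_mul (by positivity), inv_mul_cancel₀ hs.ne', ENNReal.ofReal_one]

/-- Cauchy-Schwarz splits f as f m^(-1/2) · m^(1/2). Multiplying by the ν-measure of the ball, the
integral of m⁻¹, leaves exactly the product of means in the A_2 constant. -/
theorem averagingPair_sq (hm : IsA2Weight m) :
    AveragingPair (A2const m) (fun t => t ^ 2)
      ((volume : Measure (E d)).withDensity fun x => ENNReal.ofReal (m x)⁻¹) where
  mono _ _ h := by dsimp only; gcongr
  zero := by simp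
  two_mul t := by rw [mul_pow]; norm_num
  jensen f hf := by
    have := sq_lintegral_le (P := volume.restrict (Ioc (0 : ℝ) 1)) (f := f) (σ := fun _ => 1)
      (τ := fun _ => 1) hf.aemeasurable aemeasurable_const aemeasurable_const (by simp)
    simpa using this
  average x r hr f hf := by
    have hmm : AEMeasurable m volume := hm.locallyIntegrable.aestronglyMeasurable.aemeasurable
    have hσ : AEMeasurable (fun x => ENNReal.ofReal (m x)⁻¹) volume := hmm.inv.ennreal_ofReal
    have hB : MeasurableSet (Metric.ball x r) := Metric.isOpen_ball.measurableSet
    have h0 : volume (Metric.ball x r) ≠ 0 := (Metric.measure_ball_pos volume x hr).ne'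
    have h1 : volume (Metric.ball x r) ≠ ⊤ := measure_ball_lt_top.ne
    have hA : (⨍⁻ y in Metric.ball x r, ENNReal.ofReal (m y) ∂volume) *
        ⨍⁻ y in Metric.ball x r, ENNReal.ofReal (m y)⁻¹ ∂volume ≤ A2const m :=
      le_iSup_of_le x (le_iSup_of_le r (le_iSup_of_le hr le_rfl))
    have hcs := sq_lintegral_le (P := volume.restrict (Metric.ball x r)) hf.aemeasurable
      hσ.restrict hmm.ennreal_ofReal.restrict (by
        filter_upwards [ae_restrict_of_ae hm.pos] with y hy
        exact ofReal_inv_mul_ofReal hy)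
    rw [withDensity_apply _ hB, restrict_withDensity hB,
      lintegral_withDensity_eq_lintegral_mul₀ hσ.restrict (hf.pow_const 2).aemeasurable]
    have e : ∫⁻ y in Metric.ball x r, ((fun x => ENNReal.ofReal (m x)⁻¹) * fun a => f a ^ 2) y =
        ∫⁻ y in Metric.ball x r, f y ^ 2 * ENNReal.ofReal (m y)⁻¹ :=
      lintegral_congr fun y => mul_comm _ _
    rw [e]
    rw [setLAverage_eq, setLAverage_eq, ENNReal.div_eq_inv_mul, ENNReal.div_eq_inv_mul] at hA
    rw [setLAverage_eq, ENNReal.div_eq_inv_mul, mul_pow]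
    set V := volume (Metric.ball x r)
    calc _ ≤ (∫⁻ y in Metric.ball x r, ENNReal.ofReal (m y)⁻¹) * (V⁻¹ ^ 2 *
          ((∫⁻ y in Metric.ball x r, f y ^ 2 * ENNReal.ofReal (m y)⁻¹) *
            ∫⁻ y in Metric.ball x r, ENNReal.ofReal (m y))) := by gcongr
      _ = (V⁻¹ * (∫⁻ y in Metric.ball x r, ENNReal.ofReal (m y)) *
          (V⁻¹ * ∫⁻ y in Metric.ball x r, ENNReal.ofReal (m y)⁻¹)) *
          ∫⁻ y in Metric.ball x r, f y ^ 2 * ENNReal.ofReal (m y)⁻¹ := by ring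
      _ ≤ _ := by gcongr
  ac := withDensity_absolutelyContinuous _ _
  sfinite := by
    have := SigmaFinite.withDensity_ofReal (μ := (volume : Measure (E d))) fun x => (m x)⁻¹
    infer_instance

end weight

/-! ### Assembly of the estimates -/

theorem AveragingPair.mono_const {d : ℕ} {a b : ℝ≥0∞} {g : ℝ≥0∞ → ℝ≥0∞} {ν : Measure (E d)}
    (h : AveragingPair a g ν) (hab : a ≤ b) : AveragingPair b g ν :=
  { h with average := fun x r hr f hf => (h.average x r hr f hf).trans (by gcongr) }

/-- The approximation estimates in the modular of an averaging pair. -/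
theorem exists_modular_estimate {d : ℕ} (hd : 0 < d) {Ω : Set (E d)}
    (hΩ : IsPolyhedralLipschitzDomain Ω) (k : ℕ) {κ : ℝ} (hκ : 0 < κ) (C : ℝ) {a : ℝ≥0∞}
    (ha : a ≠ ⊤) :
    ∃ c : ℝ≥0∞, c ≠ ⊤ ∧ ∀ {g : ℝ≥0∞ → ℝ≥0∞} {ν : Measure (E d)}, AveragingPair a g ν →
      ∀ {T : Finset (Finset (E d))}, IsTriangulation Ω T → (∀ K ∈ T, chunkiness K ≤ κ) →
      0 < meshSize T → ∀ {q : ℝ≥0∞}, 1 ≤ q → ∀ z : Lp ℝ q (volume.restrict Ω),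
      ∫ x in Ω, z x = 0 → ∀ G : E d → E d, IsSobolevPair Ω z G →
      (∀ P : Lp ℝ q (volume.restrict Ω) →ₗ[ℝ] Lp ℝ q (volume.restrict Ω),
        LinearMap.IsProj (Qhk Ω T k q) P → LocallyL1Stable Ω T q C P →
        ∀ s : ℝ, ‖s‖ₑ ≤ ‖⨍ y in Ω, P z y ∂volume‖ₑ →
        ∫⁻ x in Ω, g ‖z x - P z x - s‖ₑ ∂ν ≤
          c * ∫⁻ x in Ω, g (ENNReal.ofReal (meshSize T) * ‖G x‖ₑ) ∂ν) ∧
      ∃ w ∈ Qhk Ω T k q, ∫ x in Ω, w x = 0 ∧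
        ∫⁻ x in Ω, g ‖z x - w x‖ₑ ∂ν ≤
          c * ∫⁻ x in Ω, g (ENNReal.ofReal (meshSize T) * ‖G x‖ₑ) ∂ν := by
  obtain ⟨m₁, N₁, hcov₁⟩ := exists_isStableCover_patch hd hκ
  obtain ⟨m₂, hcov₂⟩ := exists_isStableCover_cell hd hκ
  obtain ⟨l, hl⟩ := exists_isProj_le hd k hκ C
  obtain ⟨c₁, hc₁, happ₁⟩ := exists_approximation_le hΩ.isOpen hΩ.isConnected hΩ.isBounded
    hΩ.lipschitz ha m₁ N₁ l
  obtain ⟨c₂, hc₂, happ₂⟩ := exists_approximation_le hΩ.isOpen hΩ.isConnected hΩ.isBounded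
    hΩ.lipschitz ha m₂ 1 0
  obtain ⟨j, hj⟩ := exists_average_domain_le hΩ.isOpen hΩ.isConnected.nonempty hΩ.isBounded
  refine ⟨(4 + 4 * (4 ^ j * a)) * c₁ + c₂, by finiteness, ?_⟩
  intro g ν hg T hT hch hh q hq z hmean G hzG
  have hfin : IsFiniteMeasure (volume.restrict Ω) :=
    ⟨by rw [Measure.restrict_apply_univ]; exact hΩ.isBounded.measure_lt_top⟩
  rw [add_mul]
  refine ⟨fun P hP hstab s hs => ?_, ?_⟩
  · refine le_trans ?_ le_self_add
    have hPint : IntegrableOn (P z) Ω := (Lp.memLp (P z)).integrable hq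
    have hPz := happ₁ hg hzG hmean hh (hcov₁ hΩ hT hch) (Lp.aestronglyMeasurable (P z))
      (fun s K hK => hl hq hΩ hT hch P hP hstab z s K hK)
    have hzP : AEMeasurable (fun x => ‖z x - P z x‖ₑ) (volume.restrict Ω) :=
      ((Lp.aestronglyMeasurable z).sub (Lp.aestronglyMeasurable (P z))).enorm
    -- As z has mean zero, ⟨Pz⟩ = -⟨z - Pz⟩, so the correction is bounded by the mean of the error.
    -- Only |s| matters, which covers both signs.
    have hs' : ‖s‖ₑ ≤ ⨍⁻ x in Ω, ‖z x - P z x‖ₑ ∂volume := by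
      have e : ∫ y in Ω, P z y = - ∫ y in Ω, (z y - P z y) := by
        rw [integral_sub hzG.integrable hPint, hmean, zero_sub, neg_neg]
      refine hs.trans ?_
      rw [setAverage_eq, e, smul_neg, enorm_neg, setLAverage_eq, ENNReal.div_eq_inv_mul,
        smul_eq_mul, enorm_mul]
      have h0 : volume Ω ≠ 0 := (hΩ.isOpen.measure_pos volume hΩ.isConnected.nonempty).ne'
      rw [Real.enorm_of_nonneg (by positivity), Measure.real, ← ENNReal.toReal_inv,
        ENNReal.ofReal_toReal (by simpa using h0)]
      gcongr
      exact enorm_integral_le_lintegral_enorm _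
    calc ∫⁻ x in Ω, g ‖z x - P z x - s‖ₑ ∂ν
        ≤ ∫⁻ x in Ω, (4 * g ‖z x - P z x‖ₑ +
            4 * g (⨍⁻ x in Ω, ‖z x - P z x‖ₑ ∂volume)) ∂ν := by
          refine lintegral_mono fun x => (hg.mono ?_).trans (hg.add_le _ _)
          exact enorm_sub_le.trans (by gcongr)
      _ = 4 * (∫⁻ x in Ω, g ‖z x - P z x‖ₑ ∂ν) +
            4 * (ν Ω * g (⨍⁻ x in Ω, ‖z x - P z x‖ₑ ∂volume)) := by
          rw [lintegral_add_right _ measurable_const, setLIntegral_const,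
            lintegral_const_mul' _ _ (by simp)]
          ring
      _ ≤ 4 * (∫⁻ x in Ω, g ‖z x - P z x‖ₑ ∂ν) +
            4 * (4 ^ j * a * ∫⁻ x in Ω, g ‖z x - P z x‖ₑ ∂ν) :=
          add_le_add le_rfl (mul_le_mul_right (hj hg _ hzP) _)
      _ = (4 + 4 * (4 ^ j * a)) * ∫⁻ x in Ω, g ‖z x - P z x‖ₑ ∂ν := by ring
      _ ≤ (4 + 4 * (4 ^ j * a)) * (c₁ *
            ∫⁻ x in Ω, g (ENNReal.ofReal (meshSize T) * ‖G x‖ₑ) ∂ν) := mul_le_mul_right hPz _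
      _ = _ := by ring
  -- Piecewise constants suffice for first order and belong to the space for every k.
  · have hmem := memLp_pieceMean (T := T) (q := q) hfin z
    refine ⟨hmem.toLp _, pieceMean_mem_Qhk hT hfin z k, ?_, le_trans ?_ le_add_self⟩
    · rw [integral_congr_ae hmem.coeFn_toLp, integral_pieceMean hΩ hT hzG.integrable, hmean]
    · refine happ₂ hg hzG hmean hh (hcov₂ hΩ hT hch) (Lp.aestronglyMeasurable _)
        fun s K hK => ?_
      filter_upwards [pieceMean_sub_le hΩ hT hzG.integrable s hK,
        ae_imp_of_ae_restrict hmem.coeFn_toLp] with x hx h1 hxΩ hxK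
      rw [h1 hxΩ, pow_zero, one_mul]
      exact hx hxK

theorem IsTriangulation.meshSize_pos {d : ℕ} (hd : 0 < d) {Ω : Set (E d)} (hne : Ω.Nonempty)
    {T : Finset (Finset (E d))} (hT : IsTriangulation Ω T) {κ : ℝ} (hκ : 0 < κ)
    (hch : ∀ K ∈ T, chunkiness K ≤ κ) : 0 < meshSize T := by
  obtain ⟨x, hx⟩ := hne
  have : x ∈ ⋃ K ∈ T, cell K := by rw [hT.cover]; exact subset_closure hx
  obtain ⟨K, hK, -⟩ := mem_iUnion₂.1 this
  exact (exists_ball_subset_cell hd (hT.card K hK) (hT.indep K hK) hκ (hch K hK)).1.trans_le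
    (IsTriangulation.diam_le T hK)

section modular

variable {d : ℕ} {Ω : Set (E d)} {p δ : ℝ} {A : E d → Matrix (Fin d) (Fin d) ℝ}

theorem conj_phi_eq (hδ : 0 ≤ δ) {F : Type*} [SeminormedAddGroup F] (u : F) :
    conj (phi p δ) ‖u‖ = conjExt (phi p δ) ‖u‖ₑ := by
  rw [conj_eq_conjExt (fun s hs => phi_nonneg hδ hs), ofReal_norm]

theorem modular_conjShift_le (hp : 2 ≤ p) (hδ : 0 ≤ δ) (u : E d → ℝ) :
    modular Ω (conjShift p δ A) u ≤ ∫⁻ x in Ω, conjExt (phi p δ) ‖u x‖ₑ := by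
  refine lintegral_mono fun x => ?_
  rw [← conj_phi_eq hδ]
  exact conj_phiShift_le_conj_phi hp hδ (Real.sqrt_nonneg _) _

theorem modular_conjShift_le_sq (hΩ : IsOpen Ω) (hp : 2 ≤ p) (hδ : 0 ≤ δ)
    (hA : IsA2Weight (muWeight Ω p δ A)) {u : E d → ℝ}
    (hu : AEStronglyMeasurable u (volume.restrict Ω)) :
    modular Ω (conjShift p δ A) u ≤ ∫⁻ x in Ω, ‖u x‖ₑ ^ 2 ∂((volume : Measure (E d)).withDensity
      fun x => ENNReal.ofReal (muWeight Ω p δ A x)⁻¹) := by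
  have hσ : AEMeasurable (fun x => ENNReal.ofReal (muWeight Ω p δ A x)⁻¹) volume :=
    hA.locallyIntegrable.aestronglyMeasurable.aemeasurable.inv.ennreal_ofReal
  rw [restrict_withDensity hΩ.measurableSet,
    lintegral_withDensity_eq_lintegral_mul₀ hσ.restrict (hu.enorm.pow_const 2)]
  refine lintegral_mono_ae ?_
  filter_upwards [ae_restrict_of_ae hA.pos, ae_restrict_mem hΩ.measurableSet] with x hx hxΩ
  have e : muWeight Ω p δ A x = (δ + frob (A x)) ^ (p - 2) := by
    rw [muWeight, indicator_of_mem hxΩ]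
  rw [e] at hx
  refine (conj_phiShift_le_sq (a := frob (A x)) hp hδ (Real.sqrt_nonneg _) hx _).trans
    (le_of_eq ?_)
  rw [Pi.mul_apply, e, ENNReal.ofReal_mul (by positivity), ENNReal.ofReal_pow (norm_nonneg _),
    ofReal_norm, mul_comm]

theorem lintegral_sq_eq_weightedSq (hΩ : IsOpen Ω) {m : E d → ℝ} (hm : AEMeasurable m volume)
    {G : E d → E d} (hG : AEStronglyMeasurable G (volume.restrict Ω)) {h : ℝ} (hh : 0 ≤ h) :
    ∫⁻ x in Ω, (ENNReal.ofReal h * ‖G x‖ₑ) ^ 2 ∂((volume : Measure (E d)).withDensity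
      fun x => ENNReal.ofReal (m x)⁻¹) =
      ENNReal.ofReal (h ^ 2) * weightedSq Ω (fun x => (m x)⁻¹) G := by
  have hσ : AEMeasurable (fun x => ENNReal.ofReal (m x)⁻¹) volume := hm.inv.ennreal_ofReal
  rw [restrict_withDensity hΩ.measurableSet,
    lintegral_withDensity_eq_lintegral_mul₀ hσ.restrict
      ((hG.enorm.const_mul _).pow_const 2), weightedSq,
    ← lintegral_const_mul' _ _ ENNReal.ofReal_ne_top]
  refine lintegral_congr fun x => ?_
  rw [Pi.mul_apply, ENNReal.ofReal_mul (by positivity), ENNReal.ofReal_pow (norm_nonneg _),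
    ofReal_norm, mul_pow, ENNReal.ofReal_pow hh]
  ring

/-- The weight is integrable over the bounded Ω, so Cauchy-Schwarz puts a gradient of finite
weighted norm into L¹, as the Poincaré argument requires. -/
theorem integrableOn_of_weightedSq_lt_top (hb : Bornology.IsBounded Ω)
    {m : E d → ℝ} (hm : IsA2Weight m) {G : E d → E d}
    (hG : AEStronglyMeasurable G (volume.restrict Ω))
    (h : weightedSq Ω (fun x => (m x)⁻¹) G < ⊤) : IntegrableOn G Ω := by
  refine ⟨hG, ?_⟩
  have hmm : AEMeasurable m volume := hm.locallyIntegrable.aestronglyMeasurable.aemeasurable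
  have hcs := sq_lintegral_le (P := volume.restrict Ω) hG.enorm
    hmm.inv.ennreal_ofReal.restrict hmm.ennreal_ofReal.restrict (by
        filter_upwards [ae_restrict_of_ae hm.pos] with y hy
        exact ofReal_inv_mul_ofReal hy)
  have h1 : ∫⁻ x in Ω, ‖G x‖ₑ ^ 2 * ENNReal.ofReal (m x)⁻¹ < ⊤ := by
    refine lt_of_eq_of_lt (lintegral_congr fun x => ?_) h
    rw [ENNReal.ofReal_mul (by positivity), ENNReal.ofReal_pow (norm_nonneg _), ofReal_norm]
  have h2 : ∫⁻ x in Ω, ENNReal.ofReal (m x) < ⊤ := by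
    have : IntegrableOn m Ω := (hm.locallyIntegrable.integrableOn_isCompact
      hb.isCompact_closure).mono_set subset_closure
    exact (lintegral_mono fun x => Real.ofReal_le_enorm _).trans_lt this.2
  have h3 := hcs.trans_lt (ENNReal.mul_lt_top h1 h2)
  rw [HasFiniteIntegral]
  by_contra hcon
  rw [not_lt_top_iff.1 hcon] at h3
  simp at h3

theorem lintegral_conjExt_phi_mul_le (hp : 2 ≤ p) (hδ : 0 ≤ δ) {h : ℝ} (hh : 0 < h) (hh1 : h ≤ 1)
    (G : E d → E d) :
    ∫⁻ x in Ω, conjExt (phi p δ) (ENNReal.ofReal h * ‖G x‖ₑ) ≤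
      ENNReal.ofReal (h ^ dualExp p) * modular Ω (fun _ => conj (phi p δ)) G := by
  rw [modular, ← lintegral_const_mul' _ _ ENNReal.ofReal_ne_top]
  refine lintegral_mono fun x => ?_
  rw [conj_phi_eq hδ]
  exact conjExt_phi_mul_le hp hδ hh hh1 _

end modular

end PressureApprox

open PressureApprox in
theorem lemma3p10 (d : ℕ) (hd : d = 2 ∨ d = 3) (Ω : Set (E d)) (hΩ : IsPolyhedralLipschitzDomain Ω)
    (p : ℝ) (hp : 2 ≤ p) (k : ℕ)
    -- bounds for the chunkiness, for the `A_2` constant, and the constant of local `L¹`-stability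
    (ω₀ M C : ℝ) :
    ∃ c : ℝ, 0 < c ∧
      ∀ (δ : ℝ), 0 ≤ δ →
      ∀ (A : E d → Matrix (Fin d) (Fin d) ℝ),
        (∀ i j, MemLp (fun x => A x i j) (ENNReal.ofReal p) (volume.restrict Ω)) →
        IsA2Weight (muWeight Ω p δ A) → A2const (muWeight Ω p δ A) ≤ ENNReal.ofReal M →
        (∀ i j, MemW1 Ω 2 (fun x => tensorF p δ (A x) i j)) →
      ∀ (T : Finset (Finset (E d))), IsTriangulation Ω T → meshSize T ≤ 1 →
        (∀ K ∈ T, chunkiness K ≤ ω₀) →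
      ∀ (z : Lp ℝ (ENNReal.ofReal (dualExp p)) (volume.restrict Ω)), ∫ x in Ω, z x = 0 →
      ∀ (G : E d → E d), HasWeakGrad Ω z G →
        -- the estimates for locally stable projections
        (∀ P : Lp ℝ (ENNReal.ofReal (dualExp p)) (volume.restrict Ω) →ₗ[ℝ]
            Lp ℝ (ENNReal.ofReal (dualExp p)) (volume.restrict Ω),
          LinearMap.IsProj (Qhk Ω T k (ENNReal.ofReal (dualExp p))) P →
          LocallyL1Stable Ω T (ENNReal.ofReal (dualExp p)) C P →
          (MemLp G (ENNReal.ofReal (dualExp p)) (volume.restrict Ω) →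
            modular Ω (conjShift p δ A) (fun x => z x - P z x - ⨍ y in Ω, P z y) ≤
                ENNReal.ofReal (c * meshSize T ^ dualExp p) *
                  modular Ω (fun _ => conj (phi p δ)) G ∧
              modular Ω (conjShift p δ A) (fun x => z x - (P z x - ⨍ y in Ω, P z y)) ≤
                ENNReal.ofReal (c * meshSize T ^ dualExp p) *
                  modular Ω (fun _ => conj (phi p δ)) G) ∧
          (weightedSq Ω (fun x => (muWeight Ω p δ A x)⁻¹) G < ⊤ →
            modular Ω (conjShift p δ A) (fun x => z x - P z x - ⨍ y in Ω, P z y) ≤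
                ENNReal.ofReal (c * meshSize T ^ 2) *
                  weightedSq Ω (fun x => (muWeight Ω p δ A x)⁻¹) G ∧
              modular Ω (conjShift p δ A) (fun x => z x - (P z x - ⨍ y in Ω, P z y)) ≤
                ENNReal.ofReal (c * meshSize T ^ 2) *
                  weightedSq Ω (fun x => (muWeight Ω p δ A x)⁻¹) G)) ∧
        -- the estimates for the best approximation by piecewise polynomials of zero mean
        (MemLp G (ENNReal.ofReal (dualExp p)) (volume.restrict Ω) →
          (⨅ w ∈ {w ∈ Qhk Ω T k (ENNReal.ofReal (dualExp p)) | ∫ x in Ω, w x = 0},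
              modular Ω (conjShift p δ A) (fun x => z x - w x)) ≤
            ENNReal.ofReal (c * meshSize T ^ dualExp p) *
              modular Ω (fun _ => conj (phi p δ)) G) ∧
        (weightedSq Ω (fun x => (muWeight Ω p δ A x)⁻¹) G < ⊤ →
          (⨅ w ∈ {w ∈ Qhk Ω T k (ENNReal.ofReal (dualExp p)) | ∫ x in Ω, w x = 0},
              modular Ω (conjShift p δ A) (fun x => z x - w x)) ≤
            ENNReal.ofReal (c * meshSize T ^ 2) *
              weightedSq Ω (fun x => (muWeight Ω p δ A x)⁻¹) G) := by
  have hd0 : 0 < d := by omega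
  have hκ : (0 : ℝ) < max ω₀ 1 := lt_max_of_lt_right one_pos
  -- One averaging constant serves both pairs, 1 for Jensen and M for the weight. It is fixed before
  -- δ, A and the mesh, so c is independent of them.
  obtain ⟨c, hc, hmain⟩ := exists_modular_estimate hd0 hΩ k hκ C
    (a := max 1 (ENNReal.ofReal M)) (by simp)
  have hcr : c ≤ ENNReal.ofReal (c.toReal + 1) := by
    rw [ENNReal.ofReal_add ENNReal.toReal_nonneg zero_le_one, ENNReal.ofReal_toReal hc]
    exact le_self_add
  refine ⟨c.toReal + 1, by positivity, ?_⟩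
  intro δ hδ A _ hA hAM _ T hT hh1 hch z hmean G hG
  have hch' : ∀ K ∈ T, chunkiness K ≤ max ω₀ 1 := fun K hK => (hch K hK).trans (le_max_left _ _)
  have hh : 0 < meshSize T := hT.meshSize_pos hd0 hΩ.isConnected.nonempty hκ hch'
  have hq : 1 ≤ ENNReal.ofReal (dualExp p) := by
    rw [ENNReal.one_le_ofReal, dualExp, one_le_div (by linarith)]; linarith
  have hfin : IsFiniteMeasure (volume.restrict Ω) :=
    ⟨by rw [Measure.restrict_apply_univ]; exact hΩ.isBounded.measure_lt_top⟩
  have hzi : IntegrableOn z Ω := (Lp.memLp z).integrable hq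
  have hGm : AEStronglyMeasurable G (volume.restrict Ω) := hG.2.1.aestronglyMeasurable
  have hmm : AEMeasurable (muWeight Ω p δ A) volume :=
    hA.locallyIntegrable.aestronglyMeasurable.aemeasurable
  have pair₁ := (averagingPair_conjExt_phi d hp hδ).mono_const (le_max_left 1 (ENNReal.ofReal M))
  have pair₂ := (averagingPair_sq hA).mono_const (hAM.trans (le_max_right 1 _))
  have main₁ := fun hGi : MemLp G (ENNReal.ofReal (dualExp p)) (volume.restrict Ω) =>
    hmain pair₁ hT hch' hh hq z hmean G ⟨hzi, hGi.integrable hq, hG⟩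
  have main₂ := fun hGi : weightedSq Ω (fun x => (muWeight Ω p δ A x)⁻¹) G < ⊤ =>
    hmain pair₂ hT hch' hh hq z hmean G
      ⟨hzi, integrableOn_of_weightedSq_lt_top hΩ.isBounded hA hGm hGi, hG⟩
  have fin₁ : c * ∫⁻ x in Ω, conjExt (phi p δ) (ENNReal.ofReal (meshSize T) * ‖G x‖ₑ) ≤
      ENNReal.ofReal ((c.toReal + 1) * meshSize T ^ dualExp p) *
        modular Ω (fun _ => conj (phi p δ)) G := by
    rw [ENNReal.ofReal_mul (by positivity), mul_assoc]
    exact mul_le_mul' hcr (lintegral_conjExt_phi_mul_le hp hδ hh hh1 G)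
  have fin₂ : c * ∫⁻ x in Ω, (ENNReal.ofReal (meshSize T) * ‖G x‖ₑ) ^ 2
      ∂((volume : Measure (E d)).withDensity fun x => ENNReal.ofReal (muWeight Ω p δ A x)⁻¹) ≤
      ENNReal.ofReal ((c.toReal + 1) * meshSize T ^ 2) *
        weightedSq Ω (fun x => (muWeight Ω p δ A x)⁻¹) G := by
    rw [ENNReal.ofReal_mul (by positivity), mul_assoc,
      lintegral_sq_eq_weightedSq hΩ.isOpen hmm hGm hh.le]
    exact mul_le_mul' hcr le_rfl
  have hplus : ∀ (P : Lp ℝ (ENNReal.ofReal (dualExp p)) (volume.restrict Ω) →ₗ[ℝ]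
      Lp ℝ (ENNReal.ofReal (dualExp p)) (volume.restrict Ω)) (s : ℝ) (x : E d),
      z x - (P z x - s) = z x - P z x - -s := fun P s x => by ring
  have hmeas : ∀ (w : Lp ℝ (ENNReal.ofReal (dualExp p)) (volume.restrict Ω)) (s : ℝ),
      AEStronglyMeasurable (fun x => z x - w x - s) (volume.restrict Ω) := fun w s =>
    ((Lp.aestronglyMeasurable z).sub (Lp.aestronglyMeasurable w)).sub aestronglyMeasurable_const
  refine ⟨fun P hP hstab => ⟨fun hGi => ⟨?_, ?_⟩, fun hGi => ⟨?_, ?_⟩⟩, fun hGi => ?_, fun hGi => ?_⟩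
  · exact ((modular_conjShift_le hp hδ _).trans ((main₁ hGi).1 P hP hstab _ le_rfl)).trans fin₁
  · simp_rw [hplus]
    exact ((modular_conjShift_le hp hδ _).trans
      ((main₁ hGi).1 P hP hstab _ (by rw [enorm_neg]))).trans fin₁
  · exact ((modular_conjShift_le_sq hΩ.isOpen hp hδ hA (hmeas _ _)).trans
      ((main₂ hGi).1 P hP hstab _ le_rfl)).trans fin₂
  · simp_rw [hplus]
    exact ((modular_conjShift_le_sq hΩ.isOpen hp hδ hA (hmeas _ _)).trans
      ((main₂ hGi).1 P hP hstab _ (by rw [enorm_neg]))).trans fin₂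
  · obtain ⟨w, hw, hw0, hle⟩ := (main₁ hGi).2
    exact ((iInf₂_le w ⟨hw, hw0⟩).trans (modular_conjShift_le hp hδ _)).trans (hle.trans fin₁)
  · obtain ⟨w, hw, hw0, hle⟩ := (main₂ hGi).2
    exact ((iInf₂_le w ⟨hw, hw0⟩).trans (modular_conjShift_le_sq hΩ.isOpen hp hδ hA
      ((Lp.aestronglyMeasurable z).sub (Lp.aestronglyMeasurable w)))).trans (hle.trans fin₂)
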